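/- **Model.** A static network is a finite set $V$ of nodes with path losses $f(u,v)>0$ ($u\ne v$). All nodes transmit with power $P>0$; the signal (interference) of $u$ at $v$ is $I_{uv}=P/f(u,v)$. For a constant $\zeta$ put $d(u,v)=f(u,v)^{1/\zeta}$ for $u\neq v$ and $d(u,u)=0$, and assume $d(u,v)\le d(u,w)+d(w,v)$ for all $u,v,w$. Let $R$ be the maximum transmission distance, $\varepsilon\in(0,1)$ the precision parameter, $B(u,r)=\{v:\max(d(u,v),d(v,u))<r\}$, $D(u,r)=\{v:d(v,u)<r\}$, $D_u^\rho=D(u,\rho R)$, $N(u)=\{v:d(u,v)\le(1-\varepsilon)R\}$ (so $u\in N(u)$) and $\Delta=\max_u|N(u)|$. We assume $(r_{\min},\lambda)$-bounded independence with $0<r_{\min}\le R/4$ and $1\le\lambda<\zeta$: for every $q\ge1$ and every node $u$, at most $C_{\rm ind}\,q^\lambda$ balls of radius $r_{\min}$ centered at nodes are contained in $D(u,qr_{\min})$ and pairwise disjoint. A node $u$ *mass-delivers* in a round if it transmits in it and all nodes of $N(u)\setminus\{u\}$ receive the transmission. The execution is asynchronous: each node starts at a time chosen by an adaptive adversary (or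 never), the rounds of one node have a fixed length, the lengths for different nodes differ by a factor of at most 2, and rounds of different nodes need not be aligned. In each round a node transmits, independently of other transmissions made at the same time given the history, with its current probability. Time is measured in arbitrarily small ticks; $p_t(w)$ is the transmission probability of the round of $w$ in progress at tick $t$ ($0$ if $w$ has not started or has stopped), $P_t(v)=\sum_{w\in B(v,R/2)}p_t(w)$ and $P_t^\rho(v)=\sum_{w\in D_v^\rho}p_t(w)$. The interference at $v$ in a round of $v$ is the sum of $I_{wv}$ over the nodes $w\ne v$ that transmit at some time during this round. The nodes know a number $n\ge|V|$. - *SuccClear*: for constants $\rho_c\ge0$, $I_c>0$, if $u$ transmits, no other node of $D_u^{\rho_c}$ transmits at some time during this round of $u$, and the interference at $u$ in this round is at most $I_c$, then all nodes of $N(u)\setminus\{u\}$ receive the message. Otherwise reception is adversarial. - *ACK*: for a constant $I_{ack}>0$, the outcome for a transmitting node $u$ is 1 if $u$ mass-delivers and the interference at $u$ is at most $I_{ack}$; it is 0 if some neighbor does not receive; otherwise it is adversarial. - *CD*, with outcomes Busy and Idle, for constants $h_1,h_2>1$, $\varphi_0\ge1$, $I_{cd}>0$. (i) For all $v$, $w\in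 B(v,R/2)$ and $\varphi>\varphi_0$: the probability that $P_t(v)>\varphi$ throughout a round of $w$ while $w$ detects Idle in it is at most $h_1^{-\varphi}$. (ii) For all $v$ and $\eta>0$: the probability that, in a round of $v$, $P_t^\rho(v)\le\eta$ throughout and the interference at $v$ from nodes outside $D_v^\rho$ is less than $I_{cd}$, while $v$ detects Busy, is at most $1-h_2^{-\eta}$. Both probabilities are conditional on the history before any time $r$ such that all rounds in progress at the start of the considered round started at time $r$ or later (in the synchronous case: the history before the round). **LocalBcast.** A node starts with transmission probability $\frac1{2n}$. After each round it replaces its probability $p$ by $\max\{p/2,1/n\}$ if it detected Busy, and by $\min\{2p,1/2\}$ otherwise; it stops for good after the first round in which it transmits and the outcome of ACK is 1. **Theorem.** 1. For all constants of the model there is $\rho_0>1$ such that for every $\rho\ge\rho_0$ and every $\kappa>0$ there are constants $C,C'>0$ (depending only on these) such that in every network as above, in every execution of LocalBcast in which CD holds with this $\rho$, each node $v$ satisfies: with probability at least $1-n^{-\kappa}$, $v$ never starts or $v$ mass-delivers within its first $C(|D_v^\rho|+\log n)$ rounds. Moreover, if $2r_{\min}\le(1-\varepsilon)R$ (in particular,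 if $\varepsilon\le 1/2$), then $C(|D_v^\rho|+\log n)\le C'(\Delta+\log n)$. 2. The same holds in the SINR model with threshold $\beta\ge1$ and noise $N_0>0$, that is, if $R=(P/(\beta N_0))^{1/\zeta}$, $d$ is symmetric, and SuccClear is replaced by the rule that $w\neq u$ receives the transmission of $u$ in a round of $u$ if and only if at all times $t$ during this round $w$ does not transmit and $I_{uw}>\beta\bigl(N_0+\sum_{x\in S_t\setminus\{u\}}I_{xw}\bigr)$, where $S_t$ is the set of nodes transmitting at time $t$. 3. This is optimal up to constants, even in the SINR model in the Euclidean plane with synchronous rounds and simultaneous start: for every $\kappa>0$ there is $c>0$ such that for all constants $\beta\ge1$, $N_0>0$, $P,\zeta,\lambda,C_{\rm ind},r_{\min},R,\varepsilon$ as above with $\lambda\ge2$, $C_{\rm ind}\ge9$, $R=(P/(\beta N_0))^{1/\zeta}$ and all integers $2\le\Delta\le n$ there are $n$ distinct points in the plane which, with $f(x,y)=|x-y|^\zeta$, form a network as above with maximum neighborhood size exactly $\Delta$ and such that the following holds. Let all nodes simultaneously start the same randomized algorithm, with independent private random bits, where in each round a node learns the message it receives (if any), the total interference at it, and whether it has mass-delivered.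 If each node mass-delivers within the first $T$ rounds with probability at least $1-n^{-\kappa}$, then $T\ge c(\Delta+\log n)$. -/

import Mathlib

open MeasureTheory

/-! ### Networks -/

/-- The constants of the model: transmission power `P`, metricity bound `ζ`, growth exponent `lam`,
packing constant `Cind`, the scale `rmin`, the maximum transmission distance `R`, and the precision
parameter `ε`. -/
structure RadioParams where
  P : ℝ
  ζ : ℝ
  lam : ℝ
  Cind : ℝ
  rmin : ℝ
  R : ℝ
  ε : ℝ
  P_pos : 0 < P
  one_le_lam : 1 ≤ lam
  lam_lt_ζ : lam < ζ
  Cind_pos : 0 < Cind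
  rmin_pos : 0 < rmin
  rmin_le : rmin ≤ R / 4
  ε_pos : 0 < ε
  ε_lt_one : ε < 1

/-- A static network on the set of nodes `V`, given by its path losses `f(u,v) > 0`, `u ≠ v`. -/
structure Network (V : Type*) where
  pathLoss : V → V → ℝ
  pathLoss_pos : ∀ u v, u ≠ v → 0 < pathLoss u v

namespace Network

variable {V : Type*} (G : Network V) (M : RadioParams)

/-- Strength of the signal of `u` at `v`: `I_{uv} = P / f(u,v)` (used for `u ≠ v` only). -/
noncomputable def signal (u v : V) : ℝ := M.P / G.pathLoss u v

open scoped Classical in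
/-- The quasi-distance `d(u,v) = f(u,v)^(1/ζ)` for `u ≠ v`, and `d(u,u) = 0`. -/
noncomputable def dist (u v : V) : ℝ :=
  if u = v then 0 else (G.pathLoss u v) ^ (1 / M.ζ)

variable [Fintype V]

open scoped Classical in
/-- The ball `B(u,r)`, with respect to the larger one of the two distances. -/
noncomputable def ball (u : V) (r : ℝ) : Finset V :=
  Finset.univ.filter fun v => max (G.dist M v u) (G.dist M u v) < r

open scoped Classical in
/-- The in-ball `D(u,r)`. -/
noncomputable def inBall (u : V) (r : ℝ) : Finset V :=
  Finset.univ.filter fun v => G.dist M v u < r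

open scoped Classical in
/-- The neighbourhood `N(u) = {v : d(u,v) ≤ (1-ε)R}`; it contains `u` itself. -/
noncomputable def neighbors (u : V) : Finset V :=
  Finset.univ.filter fun v => G.dist M u v ≤ (1 - M.ε) * M.R

/-- `Δ`, the maximum size of a neighbourhood. -/
noncomputable def maxDegree : ℕ :=
  Finset.univ.sup fun u => (G.neighbors M u).card

/-- `S` is an `r`-packing for `D`: the `r`-balls around the nodes in `S` are contained in `D` and
disjoint. -/
def IsPacking (r : ℝ) (S D : Finset V) : Prop :=
  (∀ s ∈ S, G.ball M s r ⊆ D) ∧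
    ∀ s ∈ S, ∀ s' ∈ S, s ≠ s' → Disjoint (G.ball M s r) (G.ball M s' r)

/-- The standing assumptions: the metricity is at most `ζ` and the quasi-metric has
`(rmin, lam)`-bounded independence, with packing constant `Cind`. -/
structure Admissible : Prop where
  metricity : ∀ u v w, G.dist M u v ≤ G.dist M u w + G.dist M w v
  boundedIndependence : ∀ (u : V) (q : ℝ), 1 ≤ q → ∀ S : Finset V,
    G.IsPacking M M.rmin S (G.inBall M u (q * M.rmin)) → (S.card : ℝ) ≤ M.Cind * q ^ M.lam

open scoped Classical in
/-- The SINR rule, for threshold `β` and ambient noise `noise`: when exactly the nodes in `S`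
transmit, the listening node `w` receives the transmission of `u`. -/
def SINRReceives (β noise : ℝ) (S : Set V) (u w : V) : Prop :=
  u ∈ S ∧ w ∉ S ∧
    β * ((∑ x ∈ Finset.univ.filter (fun x => x ∈ S ∧ x ≠ u), G.signal M x w) + noise)
      < G.signal M u w

end Network

/-- Nodes at distinct points of the Euclidean plane, with path loss `|x - y|^ζ`. -/
noncomputable def planarNetwork {V : Type*} (M : RadioParams) (pos : V → EuclideanSpace ℝ (Fin 2))
    (hpos : Function.Injective pos) : Network V where
  pathLoss u v := (Dist.dist (pos u) (pos v)) ^ M.ζ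
  pathLoss_pos _ _ h := Real.rpow_pos_of_pos (dist_pos.mpr fun e => h (hpos e)) _

/-! ### The algorithm -/

/-- The transmission probabilities of Try&Adjust with passiveness `b`, where `n` is the bound on the
number of nodes known to the node and `busy i` says that it detected a Busy channel in its round
`i` (its rounds are numbered from `0`). -/
noncomputable def tryAdjustProb (b : ℝ) (n : ℕ) (busy : ℕ → Prop) : ℕ → ℝ
  | 0 => 1 / 2 * (n : ℝ) ^ (-b)
  | i + 1 =>
    open scoped Classical in
    if busy i then max (tryAdjustProb b n busy i / 2) ((n : ℝ) ^ (-b))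
    else min (2 * tryAdjustProb b n busy i) (1 / 2)

open scoped Classical in
/-- The transmission probability of LocalBcast in round `i`: Try&Adjust with passiveness `1`, stopped
after the first round in which the node transmits and detects an acknowledgement. -/
noncomputable def localBcastProb (n : ℕ) (tx busy ack : ℕ → Prop) (i : ℕ) : ℝ :=
  if ∃ j < i, tx j ∧ ack j then 0 else tryAdjustProb 1 n busy i

/-! ### Asynchronous executions

Time is divided into arbitrarily short ticks.  Every round of node `v` lasts `len v` ticks, and the
first one starts at the tick `wake v`, at which `v` starts the algorithm (`⊤` if it never does); so
the rounds of different nodes need not be aligned. -/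

structure Trace (V Ω : Type*) where
  len : V → ℕ
  wake : V → Ω → ℕ∞
  /-- `tx v i`: node `v` transmits in its round `i` -/
  tx : V → ℕ → Ω → Prop
  /-- `busy v i`: the outcome of `CD` for `v` in its round `i` is Busy (otherwise it is Idle) -/
  busy : V → ℕ → Ω → Prop
  /-- `ack v i`: the outcome of `ACK` for `v` in its round `i` is 1 -/
  ack : V → ℕ → Ω → Prop
  /-- `recv u i w`: node `w` receives the transmission that `u` makes in its round `i` -/
  recv : V → ℕ → V → Ω → Prop

namespace Trace

variable {V Ω : Type*} (E : Trace V Ω)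

/-- The round `i` of `v` starts at tick `t`. -/
def Starts (v : V) (i t : ℕ) (ω : Ω) : Prop :=
  E.wake v ω + ((i * E.len v : ℕ) : ℕ∞) = (t : ℕ∞)

/-- Tick `t` belongs to the round `i` of `v`. -/
def InRound (v : V) (i t : ℕ) (ω : Ω) : Prop :=
  E.wake v ω + ((i * E.len v : ℕ) : ℕ∞) ≤ (t : ℕ∞) ∧
    (t : ℕ∞) < E.wake v ω + (((i + 1) * E.len v : ℕ) : ℕ∞)

/-- The set of nodes that are transmitting during tick `t`. -/
def transmitters (t : ℕ) (ω : Ω) : Set V :=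
  {v | ∃ i, E.InRound v i t ω ∧ E.tx v i ω}

/-- The set of nodes, other than `v`, that transmit at some time during the round `i` of `v`. -/
def concurrent (v : V) (i : ℕ) (ω : Ω) : Set V :=
  {w | w ≠ v ∧ ∃ t, E.InRound v i t ω ∧ w ∈ E.transmitters t ω}

/-- The transmission probability used by `v` in its round `i` under LocalBcast. -/
noncomputable def prob (n : ℕ) (v : V) (i : ℕ) (ω : Ω) : ℝ :=
  localBcastProb n (fun j => E.tx v j ω) (fun j => E.busy v j ω) (fun j => E.ack v j ω) i

open scoped Classical in
/-- The transmission probability `p_t(v)` of the round of `v` that is in progress at tick `t`, and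
`0` if `v` has not started.  (Rounds have at least one tick, so only rounds `i ≤ t` matter.) -/
noncomputable def curProb (n : ℕ) (v : V) (t : ℕ) (ω : Ω) : ℝ :=
  ∑ i ∈ Finset.range (t + 1), if E.InRound v i t ω then E.prob n v i ω else 0

open scoped Classical in
/-- The transmission probability of the round of `v` that starts at tick `t`, and `0` if there is no
such round. -/
noncomputable def startProb (n : ℕ) (v : V) (t : ℕ) (ω : Ω) : ℝ :=
  ∑ i ∈ Finset.range (t + 1), if E.Starts v i t ω then E.prob n v i ω else 0

/-- The contention of a set of nodes at tick `t`: the sum of their transmission probabilities. -/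
noncomputable def contention (n : ℕ) (S : Finset V) (t : ℕ) (ω : Ω) : ℝ :=
  ∑ v ∈ S, E.curProb n v t ω

section reception

variable [Fintype V] (G : Network V) (M : RadioParams)

open scoped Classical in
/-- The total interference at `v` in its round `i` from the nodes outside of `D`. -/
noncomputable def interferenceOutside (D : Finset V) (v : V) (i : ℕ) (ω : Ω) : ℝ :=
  ∑ w ∈ Finset.univ.filter (fun w => w ∈ E.concurrent v i ω ∧ w ∉ D), G.signal M w v

/-- The total interference at `v` in its round `i`. -/
noncomputable def interference (v : V) (i : ℕ) (ω : Ω) : ℝ :=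
  E.interferenceOutside G M ∅ v i ω

/-- Node `u` mass-delivers in its round `i`: it transmits and all its neighbours receive. -/
def MassDelivers (u : V) (i : ℕ) (ω : Ω) : Prop :=
  E.tx u i ω ∧ ∀ w ∈ G.neighbors M u, w ≠ u → E.recv u i w ω

/-- Node `v` mass-delivers at least once within its first `T` rounds. -/
def CompletesWithin (v : V) (T : ℝ) (ω : Ω) : Prop :=
  ∃ i : ℕ, (i : ℝ) + 1 ≤ T ∧ E.MassDelivers G M v i ω

/-- Success on a clear channel; all other receptions are arbitrary. -/
def SuccClear (ρc Ic : ℝ) : Prop :=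
  ∀ u i ω, E.tx u i ω → (∀ w ∈ E.concurrent u i ω, w ∉ G.inBall M u (ρc * M.R)) →
    E.interference G M u i ω ≤ Ic → ∀ w ∈ G.neighbors M u, w ≠ u → E.recv u i w ω

/-- Receptions are those of the SINR model: `w` receives a transmission if it listens and the SINR
inequality holds all through the round of the sender. -/
def SINRReception (β noise : ℝ) : Prop :=
  ∀ u i w ω, E.recv u i w ω ↔
    E.tx u i ω ∧ ∀ t, E.InRound u i t ω →
      G.SINRReceives M β noise (E.transmitters t ω) u w

/-- The acknowledgement primitive with interference threshold `Iack`. -/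
structure AckSpec (Iack : ℝ) : Prop where
  positive : ∀ u i ω, E.MassDelivers G M u i ω → E.interference G M u i ω ≤ Iack → E.ack u i ω
  negative : ∀ u i ω, E.tx u i ω → ¬ E.MassDelivers G M u i ω → ¬ E.ack u i ω

end reception

end Trace

/-- `E` is an execution of LocalBcast, where the nodes know the bound `n` on their number and `ℱ t`
is the history before the transmission decisions made at tick `t`.  Apart from the transmission
decisions everything may depend on the history (an adaptive adversary). -/
structure IsLocalBcast {V Ω : Type*} [mΩ : MeasurableSpace Ω]
    (μ : Measure Ω) (ℱ : Filtration ℕ mΩ) (n : ℕ) (E : Trace V Ω) : Prop where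
  len_pos : ∀ v, 0 < E.len v
  len_ratio : ∀ u v, E.len u ≤ 2 * E.len v
  wake_adapted : ∀ v t, MeasurableSet[ℱ t] {ω | E.wake v ω = (t : ℕ∞)}
  tx_adapted : ∀ v i t, MeasurableSet[ℱ (t + 1)] {ω | E.Starts v i t ω ∧ E.tx v i ω}
  busy_adapted : ∀ v i t, MeasurableSet[ℱ (t + E.len v)] {ω | E.Starts v i t ω ∧ E.busy v i ω}
  ack_adapted : ∀ v i t, MeasurableSet[ℱ (t + E.len v)] {ω | E.Starts v i t ω ∧ E.ack v i ω}
  recv_adapted : ∀ v i w t,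
    MeasurableSet[ℱ (t + E.len v)] {ω | E.Starts v i t ω ∧ E.recv v i w ω}
  /-- Given the history, the nodes that start a round at tick `t` transmit in it independently, with
  their current probabilities. -/
  coins : ∀ (t : ℕ) (A : Set Ω), MeasurableSet[ℱ t] A → ∀ W : Finset V,
    μ (A ∩ {ω | ∀ w ∈ W, ∃ i, E.Starts w i t ω ∧ E.tx w i ω}) =
      ∫⁻ ω in A, ∏ w ∈ W, ENNReal.ofReal (E.startProb n w t ω) ∂μ

/-- The constants of the sensing primitives. -/
structure SenseParams where
  h₁ : ℝ
  φ₀ : ℝ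
  h₂ : ℝ
  Icd : ℝ
  Iack : ℝ
  one_lt_h₁ : 1 < h₁
  one_le_φ₀ : 1 ≤ φ₀
  one_lt_h₂ : 1 < h₂
  Icd_pos : 0 < Icd
  Iack_pos : 0 < Iack

/-- The contention detection primitive, with vicinities of radius `ρ R`.

Both requirements are about a round of a node that starts at tick `s`, and bound the probability of
a wrong outcome given the history before any tick `r` such that all rounds in progress at tick `s`
started at tick `r` or later.  (If the rounds of all nodes consist of one tick, `r = s` is allowed,
and this is the history before the round.) -/
structure CDSpec {V Ω : Type*} [Fintype V] [mΩ : MeasurableSpace Ω] (M : RadioParams)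
    (Q : SenseParams) (ρ : ℝ) (G : Network V)
    (μ : Measure Ω) (ℱ : Filtration ℕ mΩ) (n : ℕ) (E : Trace V Ω) : Prop where
  /-- If the contention `P_t(v)` is above `φ`, then the nodes `w ∈ B(v, R/2)` detect Busy, except with
  probability at most `h₁ ^ (-φ)`. -/
  high : ∀ (v w : V), w ∈ G.ball M v (M.R / 2) → ∀ φ : ℝ, Q.φ₀ < φ →
    ∀ i r s : ℕ, (∀ u, r + E.len u ≤ s + 1) → ∀ A : Set Ω, MeasurableSet[ℱ r] A →
      μ (A ∩ {ω | E.Starts w i s ω ∧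
          (∀ t, E.InRound w i t ω → φ < E.contention n (G.ball M v (M.R / 2)) t ω) ∧
          ¬ E.busy w i ω})
        ≤ ENNReal.ofReal (Q.h₁ ^ (-φ)) * μ A
  /-- If the contention in the vicinity of `v` is at most `η` and the interference at `v` from outside
  its vicinity is below `Icd`, then `v` detects Idle, except with probability at most
  `1 - h₂ ^ (-η)`. -/
  low : ∀ (v : V) (η : ℝ), 0 < η →
    ∀ i r s : ℕ, (∀ u, r + E.len u ≤ s + 1) → ∀ A : Set Ω, MeasurableSet[ℱ r] A →
      μ (A ∩ {ω | E.Starts v i s ω ∧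
          (∀ t, E.InRound v i t ω → E.contention n (G.inBall M v (ρ * M.R)) t ω ≤ η) ∧
          E.interferenceOutside G M (G.inBall M v (ρ * M.R)) v i ω < Q.Icd ∧
          E.busy v i ω})
        ≤ ENNReal.ofReal (1 - Q.h₂ ^ (-η)) * μ A

/-! ### Arbitrary algorithms in synchronous, spontaneous SINR networks -/

/-- What a node observes in a round: the state of the node whose transmission it receives (if any),
the total strength of the signals from other nodes, and whether it has mass-delivered. -/
abbrev Feedback (S : Type*) := (S ⊕ Unit) × ℝ × Bool

/-- A randomized algorithm with set of states `S`.  All nodes run the same algorithm.  They start in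
independent random states, distributed as `init`; the initial state contains all random bits that
the node will ever use.  A node transmits if its state lies in `sends`, and the message consists of
its whole state. -/
structure RandAlgorithm (S : Type*) [MeasurableSpace S] where
  init : Measure S
  isProbabilityMeasure_init : IsProbabilityMeasure init
  sends : Set S
  measurableSet_sends : MeasurableSet sends
  next : S → Feedback S → S
  measurable_next : Measurable fun x : S × Feedback S => next x.1 x.2

namespace RandAlgorithm

variable {S V : Type*} [MeasurableSpace S] [Fintype V] (A : RandAlgorithm S)
  (M : RadioParams) (β noise : ℝ) (G : Network V)

/-- The transmitting nodes in the configuration `c`. -/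
def senders (c : V → S) : Set V := {v | c v ∈ A.sends}

/-- Node `u` mass-delivers in the round with configuration `c`. -/
def MassDelivers (c : V → S) (u : V) : Prop :=
  u ∈ A.senders c ∧ ∀ w ∈ G.neighbors M u, w ≠ u → G.SINRReceives M β noise (A.senders c) u w

open scoped Classical in
/-- The feedback of node `v` in the round with configuration `c`. -/
noncomputable def feedback (c : V → S) (v : V) : Feedback S :=
  (if h : ∃ u, G.SINRReceives M β noise (A.senders c) u v then Sum.inl (c h.choose)
    else Sum.inr (),
   ∑ x ∈ Finset.univ.filter (fun x => x ∈ A.senders c ∧ x ≠ v), G.signal M x v,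
   decide (A.MassDelivers M β noise G c v))

/-- The configuration in round `t`, from the initial configuration `c₀`. -/
noncomputable def config (c₀ : V → S) : ℕ → V → S
  | 0 => c₀
  | t + 1 => fun v => A.next (config c₀ t v) (A.feedback M β noise G (config c₀ t) v)

end RandAlgorithm

/-! Upper bound. Fix a node v and cut the time after its start into blocks of 16 l ticks, where l is
the largest round length. Every round has between l/2 and l ticks, so within a block all
transmission probabilities change by constant factors only, and the rounds starting at least l ticks
after the beginning of the block can be judged given the history at that beginning.

The potential is a weighted sum of the contentions in balls of radius R/2 around a net (`IsNet`,
`IsWeight`, `Trace.potential`). Because of bounded independence and λ < ζ, a fixed total weight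
suffices to control the contention in D(v, KR) and the expected interference from outside D(v, ρR)
and D(v, KR). Contention detection gives the potential a drift towards a constant
(`setLIntegral_contention_le`): while a ball is crowded its nodes mostly detect Busy and keep
halving. So the potential is rarely large, and its initial size O(n) costs only O(log n) blocks
(`measure_countMem_lt_le`).

In a block with small potential there are two cases. If the contention in D = D(v, ρR) is at least
η, then with constant conditional probability some node of D transmits with everyone in D(v, KR)
silent and little interference from farther away, so it is acknowledged and stops
(`IsLocalBcast.le_measure_inter_stopped`). As a node stops at most once, there are O(|D| + log n)
such blocks. If the contention in D is below η, then v rarely detects Busy, unless many nodes of D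
start during the block (`IsLocalBcast.measure_inter_busy_le`). The starting nodes contribute at most
1/2 to the contention in total, so this exception concerns boundedly many blocks. Hence in all but a
tenth of the blocks v only detects Idle in the relevant rounds and its probability grows by 2^10,
while in a bad block it shrinks by at most 2^32. As it never exceeds 1/2, v must have stopped
(`Trace.stoppedBy_of_count_le`), and stopping implies mass delivery.

Success in a block requires silence over an interval, during which an adaptive adversary reacts to
every coin. This is handled by a change of measure: `Trace.quietDensity` makes the nodes near v
silent, leaves the conditional transmission probabilities of all other nodes unchanged, and is
bounded where the contention is. All conditional statements are tested on events of the history, and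
the counts of blocks are bounded by exponential supermartingales (`measure_le_exp_neg`).

In the SINR model, a clear channel in the sense of `Trace.SuccClear` satisfies the SINR inequality,
so the first part applies.

Lower bound. In a cluster of Δ mutual neighbors at most one node mass-delivers per round, which
gives Ω(Δ). For Ω(log n), two nodes of the cluster are mirror images of each other. As long as both
transmit or both listen, neither succeeds, nobody decodes either of them, and their feedback is the
same. Their decision sequences of length T, computed as if both had the same random bits, agree with
probability at least 2^(-T) by Cauchy-Schwarz (`inv_card_le_lintegral_measure_eq`), and then they
stay tied (`RandAlgorithm.config_eq_of_twins`). -/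

/-! ### Dynamics of a single transmission probability -/

section tryAdjust

variable {n : ℕ} {busy : ℕ → Prop}

theorem tryAdjustProb_zero (n : ℕ) (busy : ℕ → Prop) :
    tryAdjustProb 1 n busy 0 = 1 / (2 * n) := by
  rw [tryAdjustProb, Real.rpow_neg_one]
  rw [one_div, one_div, mul_inv]

theorem tryAdjustProb_succ_of_busy {i : ℕ} (h : busy i) :
    tryAdjustProb 1 n busy (i + 1) = max (tryAdjustProb 1 n busy i / 2) (1 / n) := by
  rw [tryAdjustProb, if_pos h, Real.rpow_neg_one, one_div]

theorem tryAdjustProb_succ_of_not_busy {i : ℕ} (h : ¬ busy i) :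
    tryAdjustProb 1 n busy (i + 1) = min (2 * tryAdjustProb 1 n busy i) (1 / 2) := by
  rw [tryAdjustProb, if_neg h]

theorem inv_natCast_le_half (hn : 2 ≤ n) : (1 : ℝ) / n ≤ 1 / 2 := by
  have : (2 : ℝ) ≤ n := by exact_mod_cast hn
  exact one_div_le_one_div_of_le (by norm_num) this

theorem tryAdjustProb_mem (hn : 2 ≤ n) (i : ℕ) :
    1 / (2 * n) ≤ tryAdjustProb 1 n busy i ∧ tryAdjustProb 1 n busy i ≤ 1 / 2 := by
  have h2 : (2 : ℝ) ≤ n := by exact_mod_cast hn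
  have h0 : (0 : ℝ) < n := by linarith
  have e : (1 : ℝ) / (2 * n) = 1 / n / 2 := by field_simp
  have hh := inv_natCast_le_half hn
  have hp : (0 : ℝ) < 1 / n := by positivity
  induction i with
  | zero => rw [tryAdjustProb_zero]; constructor <;> linarith
  | succ i ih =>
    by_cases hb : busy i
    · rw [tryAdjustProb_succ_of_busy hb]
      refine ⟨le_trans ?_ (le_max_right _ _), max_le ?_ hh⟩ <;> linarith [ih.1, ih.2]
    · rw [tryAdjustProb_succ_of_not_busy hb]
      refine ⟨le_min ?_ ?_, min_le_right _ _⟩ <;> linarith [ih.1, ih.2]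

theorem tryAdjustProb_pos (hn : 2 ≤ n) (i : ℕ) : 0 < tryAdjustProb 1 n busy i := by
  have h2 : (2 : ℝ) ≤ n := by exact_mod_cast hn
  exact lt_of_lt_of_le (by positivity) (tryAdjustProb_mem hn i).1

/-- A Busy outcome can double the probability too: the floor 1/n is twice the initial value. The
lower bound 1/(2n) keeps this within a factor of 2. -/
theorem tryAdjustProb_succ_le (hn : 2 ≤ n) (i : ℕ) :
    tryAdjustProb 1 n busy (i + 1) ≤ 2 * tryAdjustProb 1 n busy i := by
  have h2 : (2 : ℝ) ≤ n := by exact_mod_cast hn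
  have e : (1 : ℝ) / (2 * n) = 1 / n / 2 := by field_simp
  have h := (tryAdjustProb_mem (busy := busy) hn i).1
  have h0 := tryAdjustProb_pos (busy := busy) hn i
  by_cases hb : busy i
  · rw [tryAdjustProb_succ_of_busy hb]
    exact max_le (by linarith) (by linarith)
  · rw [tryAdjustProb_succ_of_not_busy hb]
    exact min_le_left _ _

theorem tryAdjustProb_le_succ (hn : 2 ≤ n) (i : ℕ) :
    tryAdjustProb 1 n busy i / 2 ≤ tryAdjustProb 1 n busy (i + 1) := by
  have h := (tryAdjustProb_mem (busy := busy) hn i).2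
  have h0 := tryAdjustProb_pos (busy := busy) hn i
  by_cases hb : busy i
  · rw [tryAdjustProb_succ_of_busy hb]
    exact le_max_left _ _
  · rw [tryAdjustProb_succ_of_not_busy hb]
    exact le_min (by linarith) (by linarith)

theorem tryAdjustProb_le_add (hn : 2 ≤ n) (i m : ℕ) :
    tryAdjustProb 1 n busy i / 2 ^ m ≤ tryAdjustProb 1 n busy (i + m) := by
  induction m with
  | zero => simp
  | succ m ih =>
    have h := tryAdjustProb_le_succ (busy := busy) hn (i + m)
    rw [pow_succ, ← div_div, ← add_assoc]
    linarith

/-- Staying strictly below 1/2 means that the cap never acts, so the doubling is exact. -/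
theorem tryAdjustProb_add_of_not_busy (i m : ℕ)
    (hb : ∀ j, i ≤ j → j < i + m → ¬ busy j)
    (hlt : ∀ j, i < j → j ≤ i + m → tryAdjustProb 1 n busy j < 1 / 2) :
    tryAdjustProb 1 n busy (i + m) = 2 ^ m * tryAdjustProb 1 n busy i := by
  induction m with
  | zero => simp
  | succ m ih =>
    have h1 := ih (fun j h1 h2 => hb j h1 (by omega)) (fun j h1 h2 => hlt j h1 (by omega))
    have h2 := hlt (i + m + 1) (by omega) (by omega)
    have h3 := tryAdjustProb_succ_of_not_busy (n := n) (hb (i + m) (by omega) (by omega))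
    rw [← add_assoc, h3, h1]
    rw [h3, h1] at h2
    rcases min_lt_iff.mp h2 with h | h
    · rw [min_eq_left h.le, pow_succ]; ring
    · exact absurd h (lt_irrefl _)

end tryAdjust

/-! ### Transmission probabilities as functions of rounds and of ticks -/

namespace Trace

variable {V Ω : Type*} {E : Trace V Ω} {n : ℕ} {v : V} {ω : Ω}

theorem prob_eq_zero {i : ℕ} (h : ∃ j < i, E.tx v j ω ∧ E.ack v j ω) : E.prob n v i ω = 0 := by
  rw [prob, localBcastProb, if_pos h]

theorem prob_eq {i : ℕ} (h : ¬ ∃ j < i, E.tx v j ω ∧ E.ack v j ω) :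
    E.prob n v i ω = tryAdjustProb 1 n (fun j => E.busy v j ω) i := by
  rw [prob, localBcastProb, if_neg h]

theorem prob_nonneg (hn : 2 ≤ n) (i : ℕ) : 0 ≤ E.prob n v i ω := by
  by_cases h : ∃ j < i, E.tx v j ω ∧ E.ack v j ω
  · rw [prob_eq_zero h]
  · rw [prob_eq h]; exact (tryAdjustProb_pos hn i).le

theorem prob_le_half (hn : 2 ≤ n) (i : ℕ) : E.prob n v i ω ≤ 1 / 2 := by
  by_cases h : ∃ j < i, E.tx v j ω ∧ E.ack v j ω
  · rw [prob_eq_zero h]; norm_num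
  · rw [prob_eq h]; exact (tryAdjustProb_mem hn i).2

theorem prob_zero : E.prob n v 0 ω = 1 / (2 * n) := by
  rw [prob_eq (by simp), tryAdjustProb_zero]

theorem prob_succ_le (hn : 2 ≤ n) (i : ℕ) : E.prob n v (i + 1) ω ≤ 2 * E.prob n v i ω := by
  by_cases h : ∃ j < i + 1, E.tx v j ω ∧ E.ack v j ω
  · rw [prob_eq_zero h]; have := prob_nonneg (E := E) (v := v) (ω := ω) hn i; linarith
  · rw [prob_eq h, prob_eq fun ⟨j, hj, hh⟩ => h ⟨j, by omega, hh⟩]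
    exact tryAdjustProb_succ_le hn i

theorem prob_add_le (hn : 2 ≤ n) (i m : ℕ) : E.prob n v (i + m) ω ≤ 2 ^ m * E.prob n v i ω := by
  induction m with
  | zero => simp
  | succ m ih =>
    have h := prob_succ_le (E := E) (v := v) (ω := ω) hn (i + m)
    rw [pow_succ, ← add_assoc]
    linarith

theorem prob_le_of_le (hn : 2 ≤ n) {i i' m : ℕ} (h : i ≤ i') (h' : i' ≤ i + m) :
    E.prob n v i' ω ≤ 2 ^ m * E.prob n v i ω := by
  obtain ⟨k, rfl⟩ := Nat.exists_eq_add_of_le h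
  refine (prob_add_le hn i k).trans ?_
  exact mul_le_mul_of_nonneg_right (pow_le_pow_right₀ (by norm_num) (by omega)) (prob_nonneg hn i)

theorem prob_div_le (hn : 2 ≤ n) {i i' m : ℕ} (h : i ≤ i') (h' : i' ≤ i + m)
    (hs : ¬ ∃ j < i', E.tx v j ω ∧ E.ack v j ω) :
    E.prob n v i ω / 2 ^ m ≤ E.prob n v i' ω := by
  obtain ⟨k, rfl⟩ := Nat.exists_eq_add_of_le h
  rw [prob_eq hs, prob_eq fun ⟨j, hj, hh⟩ => hs ⟨j, by omega, hh⟩]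
  refine le_trans ?_ (tryAdjustProb_le_add hn i k)
  exact div_le_div_of_nonneg_left (tryAdjustProb_pos hn i).le (by positivity)
    (pow_le_pow_right₀ (by norm_num) (by omega))

/-- The term 2/n absorbs the floor: if p ≤ x + 2/n, then max (p/2) (1/n) ≤ x/2 + 2/n. -/
theorem prob_add_le_of_busy (hn : 2 ≤ n) (i m : ℕ)
    (hb : ∀ j, i ≤ j → j < i + m → E.busy v j ω) :
    E.prob n v (i + m) ω ≤ E.prob n v i ω / 2 ^ m + 2 / n := by
  have h0 : (0 : ℝ) ≤ 2 / n := by positivity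
  induction m with
  | zero => simpa using h0
  | succ m ih =>
    have ih := ih (fun j h1 h2 => hb j h1 (by omega))
    have hp := prob_nonneg (E := E) (v := v) (ω := ω) hn i
    rw [← add_assoc]
    by_cases h : ∃ j < i + m + 1, E.tx v j ω ∧ E.ack v j ω
    · rw [prob_eq_zero h]; positivity
    · rw [prob_eq (i := i + m) fun ⟨j, hj, hh⟩ => h ⟨j, by omega, hh⟩] at ih
      have hp' := tryAdjustProb_pos (busy := fun j => E.busy v j ω) hn (i + m)
      rw [prob_eq h, tryAdjustProb_succ_of_busy (hb (i + m) (by omega) (by omega)), pow_succ,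
        ← div_div]
      have : (1 : ℝ) / n = 2 / n / 2 := by ring
      rw [this]
      have : 0 ≤ E.prob n v i ω / 2 ^ m := by positivity
      exact max_le (by linarith) (by linarith)

section rounds

variable {a t : ℕ}

theorem inRound_iff (hw : E.wake v ω = a) (i : ℕ) :
    E.InRound v i t ω ↔ a + i * E.len v ≤ t ∧ t < a + (i + 1) * E.len v := by
  rw [InRound, hw]; norm_cast

theorem starts_iff (hw : E.wake v ω = a) (i : ℕ) :
    E.Starts v i t ω ↔ a + i * E.len v = t := by
  rw [Starts, hw]; norm_cast

theorem Starts.exists_wake {i : ℕ} (h : E.Starts v i t ω) :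
    ∃ a : ℕ, E.wake v ω = a ∧ a + i * E.len v = t := by
  have : E.wake v ω ≠ ⊤ := by
    intro h'; rw [Starts, h'] at h; simp at h
  obtain ⟨a, ha⟩ := ENat.ne_top_iff_exists.mp this
  exact ⟨a, ha.symm, (starts_iff ha.symm i).mp h⟩

theorem InRound.exists_wake {i : ℕ} (h : E.InRound v i t ω) :
    ∃ a : ℕ, E.wake v ω = a ∧ a + i * E.len v ≤ t ∧ t < a + (i + 1) * E.len v := by
  have : E.wake v ω ≠ ⊤ := by
    intro h'; rw [InRound, h'] at h; simp at h
  obtain ⟨a, ha⟩ := ENat.ne_top_iff_exists.mp this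
  exact ⟨a, ha.symm, (inRound_iff ha.symm i).mp h⟩

/-- The rounds of a node tile the time after its start, so the index of the current round is a
quotient. This turns estimates in ticks into estimates in rounds. -/
theorem inRound_div (hl : 0 < E.len v) (hw : E.wake v ω = a) (hat : a ≤ t) (i : ℕ) :
    E.InRound v i t ω ↔ i = (t - a) / E.len v := by
  rw [inRound_iff hw, eq_comm, Nat.div_eq_iff hl, add_mul]
  omega

theorem curProb_eq (hl : 0 < E.len v) (hw : E.wake v ω = a) (hat : a ≤ t) :
    E.curProb n v t ω = E.prob n v ((t - a) / E.len v) ω := by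
  rw [curProb, Finset.sum_eq_single ((t - a) / E.len v)]
  · rw [if_pos ((inRound_div hl hw hat _).mpr rfl)]
  · intro i _ hi
    rw [if_neg fun h => hi ((inRound_div hl hw hat i).mp h)]
  · intro h
    exact absurd (Finset.mem_range.mpr
      (Nat.lt_succ_of_le ((Nat.div_le_self _ _).trans (Nat.sub_le _ _)))) h

theorem curProb_eq_zero (h : ∀ a : ℕ, E.wake v ω = a → t < a) : E.curProb n v t ω = 0 := by
  rw [curProb]
  refine Finset.sum_eq_zero fun i _ => if_neg fun hi => ?_
  obtain ⟨a, ha, h1, -⟩ := hi.exists_wake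
  have := h a ha
  omega

theorem startProb_eq {i : ℕ} (hl : 0 < E.len v) (hs : E.Starts v i t ω) :
    E.startProb n v t ω = E.prob n v i ω := by
  obtain ⟨a, hw, ha⟩ := hs.exists_wake
  have hi : i ≤ i * E.len v := Nat.le_mul_of_pos_right _ hl
  rw [startProb, Finset.sum_eq_single i]
  · rw [if_pos hs]
  · intro j _ hj
    rw [if_neg fun h => hj ?_]
    rw [starts_iff hw] at h
    exact Nat.eq_of_mul_eq_mul_right hl (by omega)
  · intro h
    exact absurd (Finset.mem_range.mpr (by omega)) h

theorem startProb_eq_zero (h : ∀ i, ¬ E.Starts v i t ω) : E.startProb n v t ω = 0 := by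
  rw [startProb]
  exact Finset.sum_eq_zero fun i _ => if_neg (h i)

theorem startProb_nonneg (hn : 2 ≤ n) : 0 ≤ E.startProb n v t ω := by
  classical
  rw [startProb]
  refine Finset.sum_nonneg fun i _ => ?_
  split_ifs
  exacts [prob_nonneg hn i, le_rfl]

theorem curProb_nonneg (hn : 2 ≤ n) : 0 ≤ E.curProb n v t ω := by
  classical
  rw [curProb]
  refine Finset.sum_nonneg fun i _ => ?_
  split_ifs
  exacts [prob_nonneg hn i, le_rfl]

theorem startProb_le_half (hn : 2 ≤ n) (hl : 0 < E.len v) : E.startProb n v t ω ≤ 1 / 2 := by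
  by_cases h : ∃ i, E.Starts v i t ω
  · obtain ⟨i, hi⟩ := h
    rw [startProb_eq hl hi]; exact prob_le_half hn i
  · rw [startProb_eq_zero (not_exists.mp h)]; norm_num

theorem curProb_le_half (hn : 2 ≤ n) (hl : 0 < E.len v) : E.curProb n v t ω ≤ 1 / 2 := by
  by_cases h : ∃ a : ℕ, E.wake v ω = a ∧ a ≤ t
  · obtain ⟨a, ha, hat⟩ := h
    rw [curProb_eq hl ha hat]; exact prob_le_half hn _
  · rw [curProb_eq_zero fun a ha => lt_of_not_ge fun h' => h ⟨a, ha, h'⟩]; norm_num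

end rounds

/-- All rounds have at most `l` and at least `l / 2` ticks. -/
structure LengthBound (E : Trace V Ω) (l : ℕ) : Prop where
  pos : ∀ u, 0 < E.len u
  le : ∀ u, E.len u ≤ l
  le_two_mul : ∀ u, l ≤ 2 * E.len u

/-- Node `v` starts the algorithm after tick `t` and no later than tick `t'`. -/
def WokenBetween (E : Trace V Ω) (v : V) (t t' : ℕ) (ω : Ω) : Prop :=
  ∃ a : ℕ, E.wake v ω = a ∧ t < a ∧ a ≤ t'

/-- A round of `v` in which it transmits and detects an acknowledgement has ended by tick `t`. -/
def StoppedBy (E : Trace V Ω) (v : V) (t : ℕ) (ω : Ω) : Prop :=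
  ∃ i a : ℕ, E.wake v ω = a ∧ a + (i + 1) * E.len v ≤ t ∧ E.tx v i ω ∧ E.ack v i ω

/-- Node `v` transmits in a round that starts at tick `t`. -/
def TxAt (E : Trace V Ω) (v : V) (t : ℕ) (ω : Ω) : Prop :=
  ∃ i, E.Starts v i t ω ∧ E.tx v i ω

section growth

variable {l a t t' m : ℕ}

theorem LengthBound.l_pos (h : E.LengthBound l) (v : V) : 0 < l := (h.pos v).trans_le (h.le v)

theorem LengthBound.le_two_mul_mul (h : E.LengthBound l) (v : V) (m : ℕ) :
    m * l ≤ 2 * m * E.len v := by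
  have := Nat.mul_le_mul_left m (h.le_two_mul v)
  linarith

/-- Rounds have at least l/2 ticks. This is the source of the factors 4^m: at most 2m updates, each
by a factor of at most 2. -/
theorem div_le_div_add (h : E.LengthBound l) (ht' : t' ≤ t + m * l) :
    (t' - a) / E.len v ≤ (t - a) / E.len v + 2 * m := by
  have h1 := h.le_two_mul_mul v m
  rw [← Nat.add_mul_div_right _ _ (h.pos v)]
  exact Nat.div_le_div_right (by omega)

theorem StoppedBy.mono (h : E.StoppedBy v t ω) (htt' : t ≤ t') : E.StoppedBy v t' ω := by
  obtain ⟨i, a, h1, h2, h3⟩ := h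
  exact ⟨i, a, h1, h2.trans htt', h3⟩

theorem not_exists_of_not_stoppedBy {i : ℕ} (hw : E.wake v ω = a)
    (hs : ¬ E.StoppedBy v t ω) (hi : a + i * E.len v ≤ t) :
    ¬ ∃ j < i, E.tx v j ω ∧ E.ack v j ω := by
  rintro ⟨j, hj, h⟩
  refine hs ⟨j, a, hw, ?_, h⟩
  have := Nat.mul_le_mul_right (E.len v) (Nat.succ_le_of_lt hj)
  rw [Nat.succ_eq_add_one] at this
  omega

-- At most 2m doublings take place. A node that wakes up in between enters with 1/(2n), which is
-- recorded separately because later arguments need the actual amount of newly started nodes.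
open scoped Classical in
theorem curProb_le (hn : 2 ≤ n) (h : E.LengthBound l) (htt' : t ≤ t') (ht' : t' ≤ t + m * l) :
    E.curProb n v t' ω ≤
      4 ^ m * (E.curProb n v t ω + if E.WokenBetween v t t' ω then 1 / (2 * (n : ℝ)) else 0) := by
  have e : (4 : ℝ) ^ m = 2 ^ (2 * m) := by rw [pow_mul]; norm_num
  have hc := curProb_nonneg (E := E) (v := v) (t := t) (ω := ω) hn
  by_cases hw : ∃ a : ℕ, E.wake v ω = a ∧ a ≤ t'
  · obtain ⟨a, hw, hat'⟩ := hw
    rw [curProb_eq (h.pos v) hw hat', e]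
    by_cases hat : a ≤ t
    · rw [curProb_eq (h.pos v) hw hat]
      refine (prob_le_of_le hn (i := (t - a) / E.len v) (Nat.div_le_div_right (by omega))
        (div_le_div_add h ht')).trans ?_
      refine mul_le_mul_of_nonneg_left (le_add_of_nonneg_right ?_) (by positivity)
      split_ifs <;> positivity
    · rw [if_pos ⟨a, hw, by omega, hat'⟩]
      have h1 := div_le_div_add (a := a) (v := v) h ht'
      rw [show t - a = 0 by omega, Nat.zero_div] at h1
      refine (prob_le_of_le hn (i := 0) (Nat.zero_le _) h1).trans ?_
      rw [prob_zero]
      exact mul_le_mul_of_nonneg_left (le_add_of_nonneg_left hc) (by positivity)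
  · rw [curProb_eq_zero fun a ha => lt_of_not_ge fun h' => hw ⟨a, ha, h'⟩]
    refine mul_nonneg (by positivity) (add_nonneg hc ?_)
    split_ifs <;> positivity

theorem curProb_le' (hn : 2 ≤ n) (h : E.LengthBound l) (htt' : t ≤ t') (ht' : t' ≤ t + m * l) :
    E.curProb n v t' ω ≤ 4 ^ m * (E.curProb n v t ω + 1 / (2 * n)) := by
  classical
  refine (curProb_le hn h htt' ht').trans (mul_le_mul_of_nonneg_left ?_ (by positivity))
  split_ifs
  · exact le_rfl
  · exact add_le_add_right (by positivity) _

theorem startProb_le_curProb (hn : 2 ≤ n) (hl : 0 < E.len v) :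
    E.startProb n v t ω ≤ E.curProb n v t ω := by
  by_cases h : ∃ i, E.Starts v i t ω
  · obtain ⟨i, hi⟩ := h
    rw [startProb_eq hl hi]
    obtain ⟨a, hw, ha⟩ := hi.exists_wake
    rw [curProb_eq hl hw (by omega)]
    rw [show t - a = i * E.len v by omega, Nat.mul_div_cancel _ hl]
  · rw [startProb_eq_zero (not_exists.mp h)]; exact curProb_nonneg hn

theorem sum_startProb_le (hn : 2 ≤ n) (h : E.LengthBound l) (ht' : t' ≤ t + m * l) :
    ∑ s ∈ Finset.Ico t t', E.startProb n v s ω ≤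
      (2 * m + 1) * 4 ^ m * (E.curProb n v t ω + 1 / (2 * n)) := by
  classical
  have hb0 : 0 ≤ 4 ^ m * (E.curProb n v t ω + 1 / (2 * n)) :=
    mul_nonneg (by positivity) (add_nonneg (curProb_nonneg hn) (by positivity))
  have h1 : ∀ s ∈ Finset.Ico t t', E.startProb n v s ω ≤
      if ∃ i, E.Starts v i s ω then 4 ^ m * (E.curProb n v t ω + 1 / (2 * n)) else 0 := by
    intro s hs
    rw [Finset.mem_Ico] at hs
    split_ifs with hi
    · exact (startProb_le_curProb hn (h.pos v)).trans (curProb_le' hn h hs.1 (by omega))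
    · rw [startProb_eq_zero (not_exists.mp hi)]
  refine (Finset.sum_le_sum h1).trans ?_
  rw [← Finset.sum_filter, Finset.sum_const, nsmul_eq_mul, mul_assoc]
  refine mul_le_mul_of_nonneg_right ?_ hb0
  -- Different starting ticks belong to different round indices, and these lie in a range of length
  -- 2m + 1.
  have h2 : (Finset.filter (fun s => ∃ i, E.Starts v i s ω) (Finset.Ico t t')).card ≤
      (Finset.Icc ((t - (E.wake v ω).toNat) / E.len v)
        ((t - (E.wake v ω).toNat) / E.len v + 2 * m)).card := by
    refine Finset.card_le_card_of_injOn (fun s => (s - (E.wake v ω).toNat) / E.len v) ?_ ?_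
    · intro s hs
      simp only [Finset.coe_filter, Finset.mem_Ico, Set.mem_ofPred_eq] at hs
      simp only [Finset.coe_Icc, Set.mem_Icc]
      exact ⟨Nat.div_le_div_right (by omega), div_le_div_add h (by omega)⟩
    · intro s hs s' hs' heq
      simp only [Finset.coe_filter, Finset.mem_Ico, Set.mem_ofPred_eq] at hs hs'
      obtain ⟨i, hi⟩ := hs.2
      obtain ⟨j, hj⟩ := hs'.2
      obtain ⟨a, hw, ha⟩ := hi.exists_wake
      rw [starts_iff hw] at hj
      simp only [hw, ENat.toNat_natCast] at heq
      rw [show s - a = i * E.len v by omega, show s' - a = j * E.len v by omega,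
        Nat.mul_div_cancel _ (h.pos v), Nat.mul_div_cancel _ (h.pos v)] at heq
      rw [← ha, ← hj, heq]
  rw [Nat.card_Icc] at h2
  have : (Finset.filter (fun s => ∃ i, E.Starts v i s ω) (Finset.Ico t t')).card ≤ 2 * m + 1 := by
    omega
  exact_mod_cast this

/-- The first round of `v` that starts at tick `t + l` or later, for a node that is awake at `t`. -/
theorem exists_first_round (h : E.LengthBound l) (hat : a ≤ t) :
    ∃ i, t + l ≤ a + i * E.len v ∧ a + i * E.len v < t + 2 * l ∧
      (t - a) / E.len v ≤ i ∧ i ≤ (t - a) / E.len v + 4 := by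
  have hp := h.pos v
  have hle := h.le v
  have h1 := Nat.div_add_mod (t + l - 1 - a) (E.len v)
  have h2 := Nat.mod_lt (t + l - 1 - a) hp
  rw [mul_comm] at h1
  refine ⟨(t + l - 1 - a) / E.len v + 1, ?_, ?_, ?_, ?_⟩
  · rw [add_mul]; omega
  · rw [add_mul]; omega
  · exact (Nat.div_le_div_right (by omega)).trans (Nat.le_succ _)
  · have := div_le_div_add (a := a) (v := v) (t := t) (t' := t + l) (m := 1) h (by omega)
    have h3 : (t + l - 1 - a) / E.len v ≤ (t + l - a) / E.len v := Nat.div_le_div_right (by omega)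
    omega

/-- A running node starts a round in the middle third of an interval of 3 l ticks, at most four
rounds later, hence the factor 2^4. The outer thirds contain the starts of all other rounds that can
overlap with this one. -/
theorem curProb_le_sum_startProb (hn : 2 ≤ n) (h : E.LengthBound l)
    (hs : ¬ E.StoppedBy v (t + 2 * l) ω) :
    E.curProb n v t ω / 16 ≤ ∑ s ∈ Finset.Ico (t + l) (t + 2 * l), E.startProb n v s ω := by
  have h0 : 0 ≤ ∑ s ∈ Finset.Ico (t + l) (t + 2 * l), E.startProb n v s ω :=
    Finset.sum_nonneg fun s _ => startProb_nonneg hn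
  by_cases hw : ∃ a : ℕ, E.wake v ω = a ∧ a ≤ t
  · obtain ⟨a, hw, hat⟩ := hw
    obtain ⟨i, h1, h2, h3, h4⟩ := exists_first_round (v := v) h hat
    refine le_trans ?_ (Finset.single_le_sum (fun s _ => startProb_nonneg hn)
      (Finset.mem_Ico.mpr ⟨h1, h2⟩))
    rw [startProb_eq (h.pos v) ((starts_iff hw i).mpr rfl), curProb_eq (h.pos v) hw hat]
    have := prob_div_le hn h3 h4 (not_exists_of_not_stoppedBy hw hs h2.le)
    norm_num at this ⊢
    exact this
  · rw [curProb_eq_zero fun a ha => lt_of_not_ge fun h' => hw ⟨a, ha, h'⟩]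
    simpa using h0

theorem exists_last_round (h : E.LengthBound l) {k i : ℕ}
    (h2 : a + i * E.len v < t + 2 * l) (hk : 2 ≤ k) :
    i + (k - 2) ≤ (t + k * l - a) / E.len v := by
  have hp := h.pos v
  have hle := h.le v
  rw [Nat.le_div_iff_mul_le hp, add_mul]
  have : (k - 2) * E.len v ≤ (k - 2) * l := Nat.mul_le_mul_left _ hle
  obtain ⟨k, rfl⟩ := Nat.exists_eq_add_of_le hk
  have e : (2 + k) * l = 2 * l + k * l := by ring
  simp only [Nat.add_sub_cancel_left] at this ⊢
  omega

/-- Up to four updates precede the first round that starts after t + l, whence the factor 16. At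
least k - 2 full rounds follow, each of which halves the probability up to the floor. -/
theorem curProb_le_of_busy (hn : 2 ≤ n) (h : E.LengthBound l) (hat : a ≤ t)
    (hw : E.wake v ω = a) {k : ℕ} (hk : 2 ≤ k)
    (hb : ∀ i, t + l ≤ a + i * E.len v → a + (i + 1) * E.len v ≤ t + k * l → E.busy v i ω) :
    E.curProb n v (t + k * l) ω ≤ 16 / 2 ^ (k - 2) * E.curProb n v t ω + 2 / n := by
  obtain ⟨i, h1, h2, h3, h4⟩ := exists_first_round (v := v) h hat
  have h5 := exists_last_round h h2 hk
  rw [curProb_eq (h.pos v) hw hat, curProb_eq (h.pos v) hw (by omega)]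
  obtain ⟨m, hm⟩ := Nat.exists_eq_add_of_le ((Nat.le_add_right _ _).trans h5)
  have hend : a + (i + m) * E.len v ≤ t + k * l := by
    rw [← hm]
    have := Nat.div_mul_le_self (t + k * l - a) (E.len v)
    omega
  have h6 : E.prob n v (i + m) ω ≤ E.prob n v i ω / 2 ^ m + 2 / n := by
    refine prob_add_le_of_busy hn i m fun j hj1 hj2 => hb j ?_ ?_
    · have := Nat.mul_le_mul_right (E.len v) hj1
      omega
    · have := Nat.mul_le_mul_right (E.len v) (Nat.succ_le_of_lt hj2)
      rw [Nat.succ_eq_add_one] at this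
      omega
  rw [hm]
  refine h6.trans (add_le_add_left ?_ _)
  have h7 : E.prob n v i ω ≤ 16 * E.prob n v ((t - a) / E.len v) ω := by
    have := prob_le_of_le (E := E) (v := v) (ω := ω) hn h3 h4
    norm_num at this
    exact this
  rw [div_mul_eq_mul_div]
  refine div_le_div₀ (mul_nonneg (by norm_num) (prob_nonneg hn _)) h7 (by positivity)
    (pow_le_pow_right₀ (by norm_num) (by omega))

/-- In a long interval in which `v` detects Idle in all rounds but the first ones, its transmission
probability grows, unless it gets close to `1/2`. -/
theorem le_curProb_of_idle (hn : 2 ≤ n) (h : E.LengthBound l) (hat : a ≤ t)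
    (hw : E.wake v ω = a) {k : ℕ} (hk : 2 ≤ k) (hs : ¬ E.StoppedBy v (t + k * l) ω)
    (hb : ∀ i, t + l ≤ a + i * E.len v → a + (i + 1) * E.len v ≤ t + k * l → ¬ E.busy v i ω)
    (hlt : ∀ s, t ≤ s → s ≤ t + k * l → E.curProb n v s ω < 1 / 2) :
    2 ^ (k - 2) / 16 * E.curProb n v t ω ≤ E.curProb n v (t + k * l) ω := by
  obtain ⟨i, h1, h2, h3, h4⟩ := exists_first_round (v := v) h hat
  have h5 := exists_last_round h h2 hk
  obtain ⟨m, hm⟩ := Nat.exists_eq_add_of_le ((Nat.le_add_right _ _).trans h5)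
  have hend : a + (i + m) * E.len v ≤ t + k * l := by
    rw [← hm]
    have := Nat.div_mul_le_self (t + k * l - a) (E.len v)
    omega
  have hns := not_exists_of_not_stoppedBy hw hs hend
  have hq : ∀ j ≤ i + m, E.prob n v j ω = tryAdjustProb 1 n (fun j => E.busy v j ω) j :=
    fun j hj => prob_eq fun ⟨j', hj', hh⟩ => hns ⟨j', by omega, hh⟩
  have h6 : E.prob n v (i + m) ω = 2 ^ m * E.prob n v i ω := by
    rw [hq _ le_rfl, hq _ (by omega)]
    refine tryAdjustProb_add_of_not_busy i m (fun j hj1 hj2 => hb j ?_ ?_) fun j hj1 hj2 => ?_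
    · have := Nat.mul_le_mul_right (E.len v) hj1
      omega
    · have := Nat.mul_le_mul_right (E.len v) (Nat.succ_le_of_lt hj2)
      rw [Nat.succ_eq_add_one] at this
      omega
    · have e1 := Nat.mul_le_mul_right (E.len v) hj1.le
      have e2 := Nat.mul_le_mul_right (E.len v) hj2
      have := hlt (a + j * E.len v) (by omega) (by omega)
      rw [curProb_eq (h.pos v) hw (by omega), Nat.add_sub_cancel_left,
        Nat.mul_div_cancel _ (h.pos v), hq j hj2] at this
      exact this
  rw [curProb_eq (h.pos v) hw hat, curProb_eq (h.pos v) hw (by omega), hm, h6]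
  have h7 : E.prob n v ((t - a) / E.len v) ω / 16 ≤ E.prob n v i ω := by
    have := prob_div_le hn h3 h4 (fun ⟨j', hj', hh⟩ => hns ⟨j', by omega, hh⟩)
    norm_num at this
    exact this
  have h8 : (2 : ℝ) ^ (k - 2) ≤ 2 ^ m := pow_le_pow_right₀ (by norm_num) (by omega)
  calc 2 ^ (k - 2) / 16 * E.prob n v ((t - a) / E.len v) ω
      = 2 ^ (k - 2) * (E.prob n v ((t - a) / E.len v) ω / 16) := by ring
    _ ≤ 2 ^ m * E.prob n v i ω :=
        mul_le_mul h8 h7 (div_nonneg (prob_nonneg hn _) (by norm_num)) (by positivity)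

theorem curProb_div_le (hn : 2 ≤ n) (h : E.LengthBound l) (hat : a ≤ t)
    (hw : E.wake v ω = a) (htt' : t ≤ t') (ht' : t' ≤ t + m * l) (hs : ¬ E.StoppedBy v t' ω) :
    E.curProb n v t ω / 4 ^ m ≤ E.curProb n v t' ω := by
  rw [curProb_eq (h.pos v) hw hat, curProb_eq (h.pos v) hw (by omega),
    show (4 : ℝ) ^ m = 2 ^ (2 * m) by rw [pow_mul]; norm_num]
  refine prob_div_le hn (Nat.div_le_div_right (by omega)) (div_le_div_add h ht')
    (not_exists_of_not_stoppedBy hw hs ?_)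
  have := Nat.div_mul_le_self (t' - a) (E.len v)
  omega

end growth

end Trace

/-! ### Measurability with respect to the history -/

namespace IsLocalBcast

open Trace

variable {V Ω : Type*} [mΩ : MeasurableSpace Ω] {μ : Measure Ω} {ℱ : Filtration ℕ mΩ} {n : ℕ}
  {E : Trace V Ω} (h : IsLocalBcast μ ℱ n E)
include h

theorem measurableSet_wake (v : V) {a t : ℕ} (hat : a ≤ t) :
    MeasurableSet[ℱ t] {ω | E.wake v ω = (a : ℕ∞)} :=
  ℱ.mono hat _ (h.wake_adapted v a)

omit mΩ h in
theorem setOf_wake_and_eq (v : V) (a j : ℕ) (p : Ω → Prop) :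
    {ω | E.wake v ω = (a : ℕ∞) ∧ p ω} = {ω | E.Starts v j (a + j * E.len v) ω ∧ p ω} := by
  ext ω
  refine and_congr_left fun _ => ⟨fun hw => (starts_iff hw j).mpr rfl, fun hs => ?_⟩
  obtain ⟨b, hb, hba⟩ := hs.exists_wake
  rw [hb, show b = a by omega]

theorem measurableSet_wake_tx (v : V) {a j t : ℕ} (hat : a + j * E.len v < t) :
    MeasurableSet[ℱ t] {ω | E.wake v ω = (a : ℕ∞) ∧ E.tx v j ω} := by
  rw [setOf_wake_and_eq v a j]
  exact ℱ.mono hat _ (h.tx_adapted v j _)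

theorem measurableSet_wake_busy (v : V) {a j t : ℕ} (hat : a + (j + 1) * E.len v ≤ t) :
    MeasurableSet[ℱ t] {ω | E.wake v ω = (a : ℕ∞) ∧ E.busy v j ω} := by
  rw [setOf_wake_and_eq v a j]
  exact ℱ.mono (by linarith) _ (h.busy_adapted v j _)

theorem measurableSet_wake_ack (v : V) {a j t : ℕ} (hat : a + (j + 1) * E.len v ≤ t) :
    MeasurableSet[ℱ t] {ω | E.wake v ω = (a : ℕ∞) ∧ E.ack v j ω} := by
  rw [setOf_wake_and_eq v a j]
  exact ℱ.mono (by linarith) _ (h.ack_adapted v j _)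

theorem measurableSet_wake_tx_ack (v : V) {a j t : ℕ} (hat : a + (j + 1) * E.len v ≤ t) :
    MeasurableSet[ℱ t] {ω | E.wake v ω = (a : ℕ∞) ∧ E.tx v j ω ∧ E.ack v j ω} := by
  have hp := h.len_pos v
  have h1 := h.measurableSet_wake_tx v (a := a) (j := j) (t := t) (by rw [add_mul] at hat; omega)
  have h2 := h.measurableSet_wake_ack v (a := a) (j := j) (t := t) hat
  convert h1.inter h2 using 1
  ext ω; simp only [Set.mem_ofPred_eq, Set.mem_inter_iff]; tauto

-- The tick at which round i begins is random. Restricting to a fixed starting tick fixes the clock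
-- of v, so that all earlier outcomes are known by a deterministic tick.
open scoped Classical in
theorem measurable_wake_prob (v : V) {a i t : ℕ} (hat : a + i * E.len v ≤ t) :
    Measurable[ℱ t] fun ω => if E.wake v ω = (a : ℕ∞) then E.prob n v i ω else 0 := by
  have hp := h.len_pos v
  have hj : ∀ j < i, a + (j + 1) * E.len v ≤ t := fun j hj =>
    (Nat.add_le_add_left (Nat.mul_le_mul_right _ hj) _).trans hat
  have hw : MeasurableSet[ℱ t] {ω | E.wake v ω = (a : ℕ∞)} :=
    h.measurableSet_wake v (by omega)
  have hs : MeasurableSet[ℱ t]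
      {ω | E.wake v ω = (a : ℕ∞) ∧ ∃ j < i, E.tx v j ω ∧ E.ack v j ω} := by
    have : {ω | E.wake v ω = (a : ℕ∞) ∧ ∃ j < i, E.tx v j ω ∧ E.ack v j ω} =
        ⋃ j ∈ Finset.range i, {ω | E.wake v ω = (a : ℕ∞) ∧ E.tx v j ω ∧ E.ack v j ω} := by
      ext ω
      simp only [Set.mem_ofPred_eq, Set.mem_iUnion, Finset.mem_range, exists_prop]
      tauto
    rw [this]
    exact Finset.measurableSet_biUnion _ fun j hji =>
      h.measurableSet_wake_tx_ack v (hj j (Finset.mem_range.mp hji))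
  have hq : ∀ m ≤ i, Measurable[ℱ t] fun ω => if E.wake v ω = (a : ℕ∞) then
      tryAdjustProb 1 n (fun j => E.busy v j ω) m else 0 := by
    intro m
    induction m with
    | zero =>
      intro _
      simp only [tryAdjustProb_zero]
      exact Measurable.ite hw measurable_const measurable_const
    | succ m ih =>
      intro hm
      have ih := ih (by omega)
      have hb := h.measurableSet_wake_busy v (hj m (by omega))
      have : (fun ω => if E.wake v ω = (a : ℕ∞) then
          tryAdjustProb 1 n (fun j => E.busy v j ω) (m + 1) else 0) =
        fun ω => if E.wake v ω = (a : ℕ∞) then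
          (if E.wake v ω = (a : ℕ∞) ∧ E.busy v m ω then
            max ((if E.wake v ω = (a : ℕ∞) then
              tryAdjustProb 1 n (fun j => E.busy v j ω) m else 0) / 2) (1 / n)
          else min (2 * (if E.wake v ω = (a : ℕ∞) then
              tryAdjustProb 1 n (fun j => E.busy v j ω) m else 0)) (1 / 2)) else 0 := by
        funext ω
        by_cases h1 : E.wake v ω = (a : ℕ∞)
        · by_cases h2 : E.busy v m ω
          · rw [if_pos h1, if_pos h1, if_pos ⟨h1, h2⟩, if_pos h1,
              tryAdjustProb_succ_of_busy h2]
          · rw [if_pos h1, if_pos h1, if_neg fun h => h2 h.2, if_pos h1,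
              tryAdjustProb_succ_of_not_busy h2]
        · rw [if_neg h1, if_neg h1]
      rw [this]
      exact Measurable.ite hw (Measurable.ite hb ((ih.div_const _).max measurable_const)
        ((measurable_const.mul ih).min measurable_const)) measurable_const
  have : (fun ω => if E.wake v ω = (a : ℕ∞) then E.prob n v i ω else 0) =
      fun ω => if E.wake v ω = (a : ℕ∞) ∧ ∃ j < i, E.tx v j ω ∧ E.ack v j ω then 0 else
        if E.wake v ω = (a : ℕ∞) then tryAdjustProb 1 n (fun j => E.busy v j ω) i else 0 := by
    funext ω
    by_cases h1 : E.wake v ω = (a : ℕ∞)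
    · by_cases h2 : ∃ j < i, E.tx v j ω ∧ E.ack v j ω
      · rw [if_pos h1, if_pos ⟨h1, h2⟩, prob_eq_zero h2]
      · rw [if_pos h1, if_neg fun h => h2 h.2, if_pos h1, prob_eq h2]
    · rw [if_neg h1, if_neg fun h => h1 h.1, if_neg h1]
  rw [this]
  exact Measurable.ite hs measurable_const (hq i le_rfl)

theorem measurable_curProb (v : V) (t : ℕ) : Measurable[ℱ t] (E.curProb n v t) := by
  classical
  have hp := h.len_pos v
  have : E.curProb n v t = fun ω => ∑ a ∈ Finset.range (t + 1),
      if E.wake v ω = (a : ℕ∞) then E.prob n v ((t - a) / E.len v) ω else 0 := by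
    funext ω
    by_cases hw : ∃ a : ℕ, E.wake v ω = a ∧ a ≤ t
    · obtain ⟨a, ha, hat⟩ := hw
      rw [curProb_eq hp ha hat, Finset.sum_eq_single a, if_pos ha]
      · intro b _ hb
        refine if_neg fun hb' => hb ?_
        rw [ha] at hb'; exact_mod_cast hb'.symm
      · intro h'; exact absurd (Finset.mem_range.mpr (by omega)) h'
    · rw [curProb_eq_zero fun a ha => lt_of_not_ge fun h' => hw ⟨a, ha, h'⟩]
      refine (Finset.sum_eq_zero fun a ha => if_neg fun h' => hw ⟨a, h', ?_⟩).symm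
      have := Finset.mem_range.mp ha; omega
  rw [this]
  refine Finset.measurable_fun_sum _ fun a ha => h.measurable_wake_prob v ?_
  have := Nat.div_mul_le_self (t - a) (E.len v)
  have := Finset.mem_range.mp ha
  omega

theorem measurable_startProb (v : V) (t : ℕ) : Measurable[ℱ t] (E.startProb n v t) := by
  classical
  have hp := h.len_pos v
  have : E.startProb n v t = fun ω => ∑ i ∈ Finset.range (t + 1),
      if i * E.len v ≤ t then
        (if E.wake v ω = ((t - i * E.len v : ℕ) : ℕ∞) then E.prob n v i ω else 0) else 0 := by
    funext ω
    rw [startProb]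
    refine Finset.sum_congr rfl fun i _ => ?_
    by_cases hi : i * E.len v ≤ t
    · rw [if_pos hi]
      congr 1
      refine propext ⟨fun hs => ?_, fun hw => (starts_iff hw i).mpr (by omega)⟩
      obtain ⟨a, ha, hat⟩ := hs.exists_wake
      rw [ha, show t - i * E.len v = a by omega]
    · rw [if_neg hi, if_neg]
      intro hs
      obtain ⟨a, ha, hat⟩ := hs.exists_wake
      omega
  rw [this]
  refine Finset.measurable_fun_sum _ fun i _ => ?_
  by_cases hi : i * E.len v ≤ t
  · simp only [if_pos hi]
    exact h.measurable_wake_prob v (by omega)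
  · simp only [if_neg hi]
    exact measurable_const

theorem measurableSet_txAt (v : V) (t : ℕ) : MeasurableSet[ℱ (t + 1)] {ω | E.TxAt v t ω} := by
  have : {ω | E.TxAt v t ω} = ⋃ i, {ω | E.Starts v i t ω ∧ E.tx v i ω} := by
    ext ω; simp [TxAt]
  rw [this]
  exact MeasurableSet.iUnion fun i => h.tx_adapted v i t

theorem measurableSet_wokenBetween (v : V) (t t' : ℕ) :
    MeasurableSet[ℱ t'] {ω | E.WokenBetween v t t' ω} := by
  have : {ω | E.WokenBetween v t t' ω} =
      ⋃ a ∈ Finset.Ioc t t', {ω | E.wake v ω = (a : ℕ∞)} := by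
    ext ω; simp [WokenBetween, and_comm]
  rw [this]
  exact Finset.measurableSet_biUnion _ fun a ha =>
    h.measurableSet_wake v (Finset.mem_Ioc.mp ha).2

theorem measurableSet_stoppedBy (v : V) (t : ℕ) :
    MeasurableSet[ℱ t] {ω | E.StoppedBy v t ω} := by
  classical
  have : {ω | E.StoppedBy v t ω} = ⋃ i : ℕ, ⋃ a : ℕ, if a + (i + 1) * E.len v ≤ t then
      {ω | E.wake v ω = (a : ℕ∞) ∧ E.tx v i ω ∧ E.ack v i ω} else ∅ := by
    ext ω
    simp only [StoppedBy, Set.mem_ofPred_eq, Set.mem_iUnion]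
    refine exists_congr fun i => exists_congr fun a => ?_
    split_ifs with hi <;> simp [hi]
  rw [this]
  refine MeasurableSet.iUnion fun i => MeasurableSet.iUnion fun a => ?_
  split_ifs with hi
  · exact h.measurableSet_wake_tx_ack v hi
  · exact @MeasurableSet.empty _ (_)

theorem measurable_contention (S : Finset V) (t : ℕ) : Measurable[ℱ t] (E.contention n S t) :=
  Finset.measurable_fun_sum _ fun v _ => h.measurable_curProb v t

theorem exists_lengthBound [Finite V] (v : V) : ∃ l, E.LengthBound l := by
  have := Fintype.ofFinite V
  obtain ⟨w, -, hw⟩ := Finset.exists_max_image Finset.univ E.len ⟨v, Finset.mem_univ v⟩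
  exact ⟨E.len w, h.len_pos, fun u => hw u (Finset.mem_univ u), fun u => h.len_ratio w u⟩

end IsLocalBcast

/-! ### Conditional bounds and exponential supermartingales -/

open scoped ENNReal

section weighted

variable {Ω : Type*} {m mΩ : MeasurableSpace Ω} {μ ν : Measure Ω}

/-- If `ν ≤ μ` on the events of `m`, the same holds for integrals of `m`-measurable functions. -/
theorem lintegral_le_of_forall_measurableSet (hm : m ≤ mΩ)
    (hle : ∀ A, MeasurableSet[m] A → ν A ≤ μ A) {g : Ω → ℝ≥0∞} (hg : Measurable[m] g) :
    ∫⁻ ω, g ω ∂ν ≤ ∫⁻ ω, g ω ∂μ := by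
  rw [← lintegral_trim hm hg, ← lintegral_trim hm hg]
  refine lintegral_mono' (Measure.le_iff.mpr fun A hA => ?_) le_rfl
  rw [trim_measurableSet_eq hm hA, trim_measurableSet_eq hm hA]
  exact hle A hA

/-- This replaces conditional expectations: a comparison that holds on all events of the history
persists under weights known from the history. The measures with densities f and f' are compared on
`m`. -/
theorem setLIntegral_mul_le_of_forall (hm : m ≤ mΩ) {f f' : Ω → ℝ≥0∞}
    (hf : Measurable f) (hf' : Measurable f')
    (hle : ∀ A, MeasurableSet[m] A → ∫⁻ ω in A, f ω ∂μ ≤ ∫⁻ ω in A, f' ω ∂μ)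
    {g : Ω → ℝ≥0∞} (hg : Measurable[m] g) {A : Set Ω} (hA : MeasurableSet[m] A) :
    ∫⁻ ω in A, g ω * f ω ∂μ ≤ ∫⁻ ω in A, g ω * f' ω ∂μ := by
  have hg' := hg.mono hm le_rfl
  have e : ∀ F : Ω → ℝ≥0∞, Measurable F → ∫⁻ ω in A, g ω * F ω ∂μ =
      ∫⁻ ω, g ω ∂((μ.restrict A).withDensity F) := fun F hF => by
    rw [lintegral_withDensity_eq_lintegral_mul _ hF hg']
    simp [mul_comm]
  rw [e f hf, e f' hf']
  refine lintegral_le_of_forall_measurableSet hm (fun B hB => ?_) hg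
  rw [withDensity_apply _ (hm _ hB), withDensity_apply _ (hm _ hB),
    Measure.restrict_restrict (hm _ hB)]
  exact hle _ (hB.inter hA)

/-- The product of successive factors of conditional mean at most one has mean at most one. -/
theorem setLIntegral_prod_le {𝒢 : ℕ → MeasurableSpace Ω} (hmono : Monotone 𝒢) (hle : ∀ j, 𝒢 j ≤ mΩ)
    {f : ℕ → Ω → ℝ≥0∞} (hf : ∀ j, Measurable[𝒢 (j + 1)] (f j)) {A : Set Ω}
    (hA : MeasurableSet[𝒢 0] A)
    (h : ∀ j B, MeasurableSet[𝒢 j] B → B ⊆ A → ∫⁻ ω in B, f j ω ∂μ ≤ μ B) (J : ℕ) :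
    ∫⁻ ω in A, ∏ j ∈ Finset.range J, f j ω ∂μ ≤ μ A := by
  induction J with
  | zero => simp
  | succ J ih =>
    refine le_trans ?_ ih
    simp only [Finset.prod_range_succ]
    have hA' : MeasurableSet[𝒢 J] A := hmono (Nat.zero_le J) _ hA
    have hAm := hle 0 _ hA
    have := setLIntegral_mul_le_of_forall (μ := μ.restrict A) (hle J) ((hf J).mono (hle _) le_rfl)
      (measurable_const (a := 1)) (fun B hB => by
        rw [Measure.restrict_restrict ((hle J) _ hB)]
        simpa [hle J _ hB] using h J _ (hB.inter hA') Set.inter_subset_right)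
      (g := fun ω => ∏ j ∈ Finset.range J, f j ω)
      (Finset.measurable_fun_prod _ fun j hj =>
        (hf j).mono (hmono (Finset.mem_range.mp hj)) le_rfl) (A := Set.univ) MeasurableSet.univ
    simpa using this

/-- A Chernoff bound for sums of successive terms with conditional exponential moments at most
one. -/
theorem measure_le_exp_neg {𝒢 : ℕ → MeasurableSpace Ω} (hmono : Monotone 𝒢) (hle : ∀ j, 𝒢 j ≤ mΩ)
    {x : ℕ → Ω → ℝ} (hx : ∀ j, Measurable[𝒢 (j + 1)] (x j)) {A : Set Ω}
    (hA : MeasurableSet[𝒢 0] A)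
    (h : ∀ j B, MeasurableSet[𝒢 j] B → B ⊆ A →
      ∫⁻ ω in B, ENNReal.ofReal (Real.exp (x j ω)) ∂μ ≤ μ B) (J : ℕ) (z : ℝ) :
    μ (A ∩ {ω | z ≤ ∑ j ∈ Finset.range J, x j ω}) ≤ ENNReal.ofReal (Real.exp (-z)) * μ A := by
  have hm : ∀ j, Measurable[𝒢 (j + 1)] fun ω => ENNReal.ofReal (Real.exp (x j ω)) := fun j =>
    ENNReal.measurable_ofReal.comp (Real.measurable_exp.comp (hx j))
  have h1 := setLIntegral_prod_le hmono hle hm hA h J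
  have e : ∀ ω, ∏ j ∈ Finset.range J, ENNReal.ofReal (Real.exp (x j ω)) =
      ENNReal.ofReal (Real.exp (∑ j ∈ Finset.range J, x j ω)) := fun ω => by
    rw [Real.exp_sum, ENNReal.ofReal_prod_of_nonneg fun j _ => (Real.exp_pos _).le]
  simp only [e] at h1
  have hz : 0 < Real.exp z := Real.exp_pos z
  have hAm := hle 0 _ hA
  -- Markov's inequality for the exponential of the sum.
  have h2 : ENNReal.ofReal (Real.exp z) * μ (A ∩ {ω | z ≤ ∑ j ∈ Finset.range J, x j ω}) ≤ μ A := by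
    refine le_trans ?_ h1
    have hs : Measurable fun ω => ∑ j ∈ Finset.range J, x j ω :=
      Finset.measurable_fun_sum _ fun j _ => (hx j).mono (hle _) le_rfl
    have := mul_meas_ge_le_lintegral (μ := μ.restrict A)
      (f := fun ω => ENNReal.ofReal (Real.exp (∑ j ∈ Finset.range J, x j ω)))
      (ENNReal.measurable_ofReal.comp (Real.measurable_exp.comp hs)) (ENNReal.ofReal (Real.exp z))
    refine le_trans (mul_le_mul_right ?_ _) this
    rw [Measure.restrict_apply' hAm, Set.inter_comm]
    refine measure_mono (Set.inter_subset_inter_left _ fun ω hω => ?_)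
    exact ENNReal.ofReal_le_ofReal (Real.exp_le_exp.mpr hω)
  rw [Real.exp_neg, ENNReal.ofReal_inv_of_pos hz]
  rw [← ENNReal.div_eq_inv_mul, ENNReal.le_div_iff_mul_le, mul_comm]
  · exact h2
  · left; simpa using hz
  · left; exact ENNReal.ofReal_ne_top

end weighted

section weighted

variable {Ω : Type*} {m mΩ : MeasurableSpace Ω} {μ : Measure Ω}

/-- A bound c on the conditional probability of `F` may be multiplied by a quantity already known.
In the application, `F` is a wrong Idle outcome and `g` the current transmission probability. -/
theorem setLIntegral_indicator_le (hm : m ≤ mΩ) {F : Set Ω} (hF : MeasurableSet F) {c : ℝ≥0∞}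
    {A : Set Ω} (hA : MeasurableSet[m] A)
    (hle : ∀ B, MeasurableSet[m] B → B ⊆ A → μ (B ∩ F) ≤ c * μ B) {g : Ω → ℝ≥0∞}
    (hg : Measurable[m] g) :
    ∫⁻ ω in A, F.indicator g ω ∂μ ≤ c * ∫⁻ ω in A, g ω ∂μ := by
  have h1 := setLIntegral_mul_le_of_forall (μ := μ.restrict A) hm
    (measurable_const.indicator hF : Measurable (F.indicator fun _ => (1 : ℝ≥0∞)))
    (measurable_const (a := c)) (fun B hB => by
      have hBm := hm _ hB
      have hAm := hm _ hA
      rw [Measure.restrict_restrict hBm, lintegral_indicator_const hF, one_mul, lintegral_const,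
        Measure.restrict_apply hF, Measure.restrict_apply MeasurableSet.univ, Set.univ_inter,
        Set.inter_comm F]
      exact hle _ (hB.inter hA) Set.inter_subset_right) hg MeasurableSet.univ
  rw [Measure.restrict_univ] at h1
  rw [← lintegral_const_mul _ (hg.mono hm le_rfl)]
  refine le_trans (le_of_eq ?_) (h1.trans (le_of_eq ?_))
  · refine lintegral_congr fun ω => ?_
    by_cases hω : ω ∈ F <;> simp [hω]
  · exact lintegral_congr fun ω => mul_comm _ _

end weighted

/-! ### Geometry: nets, packing bounds and interference from far away -/

namespace RadioParams

variable (M : RadioParams)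

theorem R_pos : 0 < M.R := by have := M.rmin_pos; have := M.rmin_le; linarith

theorem ζ_pos : 0 < M.ζ := by have := M.one_le_lam; have := M.lam_lt_ζ; linarith

/-- The number of nodes of a net in an in-ball of radius `(K + 1) R`. -/
noncomputable def nearBound (K : ℝ) : ℝ := M.Cind * (((K + 1) * M.R + M.rmin) / M.rmin) ^ M.lam

/-- The constant in the bound for `∑ d(s,v)^(-ζ)` over the far nodes `s` of a net. -/
noncomputable def farConst : ℝ :=
  M.Cind * (4 / M.rmin) ^ M.lam * M.R ^ (M.lam - M.ζ) * (1 - 2 ^ (M.lam - M.ζ))⁻¹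

theorem two_rpow_lt_one : (2 : ℝ) ^ (M.lam - M.ζ) < 1 :=
  Real.rpow_lt_one_of_one_lt_of_neg (by norm_num) (by linarith [M.lam_lt_ζ])

theorem farConst_pos : 0 < M.farConst := by
  have := M.Cind_pos; have := M.rmin_pos; have := M.R_pos; have := M.two_rpow_lt_one
  have : (0 : ℝ) < (1 - 2 ^ (M.lam - M.ζ))⁻¹ := inv_pos.mpr (by linarith)
  unfold farConst
  positivity

/-- A bound for the sum of `d(x,v)^(-ζ)` over the balls far from `v`. -/
noncomputable def farBound (K : ℝ) : ℝ := 2 ^ M.ζ * M.farConst * (K / 2) ^ (M.lam - M.ζ)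

theorem nearBound_pos {K : ℝ} (hK : 0 ≤ K) : 0 < M.nearBound K := by
  have := M.Cind_pos; have := M.rmin_pos; have := M.R_pos
  unfold nearBound
  positivity

theorem farBound_pos {K : ℝ} (hK : 0 < K) : 0 < M.farBound K := by
  have := M.farConst_pos
  unfold farBound
  positivity

/-- The only place where a strict gap λ < ζ yields smallness; it permits choosing first ρ and then K
so large that outside interference is negligible. -/
theorem tendsto_farBound : Filter.Tendsto M.farBound Filter.atTop (nhds 0) := by
  have h1 : Filter.Tendsto (fun K : ℝ => (K / 2) ^ (-(M.ζ - M.lam))) Filter.atTop (nhds 0) :=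
    (tendsto_rpow_neg_atTop (by linarith [M.lam_lt_ζ])).comp
      (Filter.tendsto_id.atTop_div_const (by norm_num))
  have h2 := h1.const_mul (2 ^ M.ζ * M.farConst)
  rw [mul_zero] at h2
  refine h2.congr fun K => ?_
  rw [farBound, neg_sub]

end RadioParams

namespace Network

variable {V : Type*} {G : Network V} {M : RadioParams}

theorem dist_self (u : V) : G.dist M u u = 0 := by rw [dist, if_pos rfl]

theorem dist_pos {u v : V} (h : u ≠ v) : 0 < G.dist M u v := by
  rw [dist, if_neg h]
  exact Real.rpow_pos_of_pos (G.pathLoss_pos u v h) _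

theorem dist_nonneg (u v : V) : 0 ≤ G.dist M u v := by
  by_cases h : u = v
  · rw [h, dist_self]
  · exact (dist_pos h).le

theorem signal_eq {u v : V} (h : u ≠ v) : G.signal M u v = M.P * (G.dist M u v) ^ (-M.ζ) := by
  have h0 := G.pathLoss_pos u v h
  rw [signal, dist, if_neg h, ← Real.rpow_mul h0.le]
  have : 1 / M.ζ * -M.ζ = -1 := by have := M.ζ_pos; field_simp
  rw [this, Real.rpow_neg_one, div_eq_mul_inv]

theorem signal_pos {u v : V} (h : u ≠ v) : 0 < G.signal M u v :=
  div_pos M.P_pos (G.pathLoss_pos u v h)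

variable [Fintype V]

theorem mem_inBall {u v : V} {r : ℝ} : v ∈ G.inBall M u r ↔ G.dist M v u < r := by
  simp [inBall]

theorem mem_ball {u v : V} {r : ℝ} :
    v ∈ G.ball M u r ↔ G.dist M v u < r ∧ G.dist M u v < r := by
  simp [ball]

theorem mem_neighbors {u v : V} : v ∈ G.neighbors M u ↔ G.dist M u v ≤ (1 - M.ε) * M.R := by
  simp [neighbors]

/-- A maximal set of nodes whose balls of radius `rmin` are disjoint. -/
structure IsNet (G : Network V) (M : RadioParams) (S : Finset V) : Prop where
  disjoint : ∀ s ∈ S, ∀ s' ∈ S, s ≠ s' → Disjoint (G.ball M s M.rmin) (G.ball M s' M.rmin)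
  cover : ∀ x, ∃ s ∈ S, x ∈ G.ball M s (2 * M.rmin)

/-- Take such a set of maximum cardinality. A node not covered by the balls of twice the radius
could be added to it, by the triangle inequality. -/
theorem Admissible.exists_isNet (hA : G.Admissible M) : ∃ S, G.IsNet M S := by
  classical
  obtain ⟨S, hS, hmax⟩ := Finset.exists_max_image
    (Finset.univ.filter fun S : Finset V =>
      ∀ s ∈ S, ∀ s' ∈ S, s ≠ s' → Disjoint (G.ball M s M.rmin) (G.ball M s' M.rmin))
    Finset.card ⟨∅, by simp⟩
  rw [Finset.mem_filter] at hS
  have hr := M.rmin_pos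
  refine ⟨S, hS.2, fun x => ?_⟩
  by_contra! hx
  -- A common point would put x within 2 rmin of s in both directions; the balls bound both
  -- directions since d need not be symmetric.
  have hd : ∀ s ∈ S, Disjoint (G.ball M x M.rmin) (G.ball M s M.rmin) := by
    intro s hs
    rw [Finset.disjoint_left]
    intro y hy hy'
    rw [mem_ball] at hy hy'
    refine hx s hs (mem_ball.mpr ⟨?_, ?_⟩)
    · have := hA.metricity x s y; linarith [hy.2, hy'.1]
    · have := hA.metricity s x y; linarith [hy.1, hy'.2]
  have hxS : x ∉ S := fun h => hx x h (mem_ball.mpr (by rw [dist_self]; constructor <;> linarith))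
  have := hmax (insert x S) (Finset.mem_filter.mpr ⟨Finset.mem_univ _, ?_⟩)
  · rw [Finset.card_insert_of_notMem hxS] at this; omega
  · intro s hs s' hs' hne
    rcases Finset.mem_insert.mp hs with h1 | h1 <;> rcases Finset.mem_insert.mp hs' with h2 | h2
    · exact absurd (h1.trans h2.symm) hne
    · rw [h1]; exact hd s' h2
    · rw [h2]; exact (hd s h1).symm
    · exact hS.2 s h1 s' h2 hne

namespace IsNet

variable {S : Finset V} (hS : G.IsNet M S) (hA : G.Admissible M)
include hS hA

-- The disjoint balls around these nodes lie in the in-ball of radius y + rmin.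
open scoped Classical in
theorem card_le (v : V) {y : ℝ} (hy : 0 ≤ y) :
    ((S.filter fun s => G.dist M s v < y).card : ℝ) ≤
      M.Cind * ((y + M.rmin) / M.rmin) ^ M.lam := by
  have hr := M.rmin_pos
  refine hA.boundedIndependence v _ ?_ _ ⟨fun s hs x hx => ?_, fun s hs s' hs' => ?_⟩
  · rw [le_div_iff₀ hr]; linarith
  · rw [div_mul_cancel₀ _ hr.ne', mem_inBall]
    have := (Finset.mem_filter.mp hs).2
    have := (mem_ball.mp hx).1
    have := hA.metricity x v s
    linarith
  · exact hS.disjoint s (Finset.mem_filter.mp hs).1 s' (Finset.mem_filter.mp hs').1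

-- Sort the nodes into dyadic shells. The shell at distance X = 2^i K R has O(X^λ) nodes of the net,
-- each contributing at most X^(-ζ), so the shells form a geometric series with ratio 2^(λ-ζ) < 1.
open scoped Classical in
theorem sum_far_le (v : V) {K : ℝ} (hK : 1 ≤ K) :
    ∑ s ∈ S.filter (fun s => K * M.R ≤ G.dist M s v), (G.dist M s v) ^ (-M.ζ) ≤
      M.farConst * K ^ (M.lam - M.ζ) := by
  have hr := M.rmin_pos
  have hR := M.R_pos
  have hζ := M.ζ_pos
  have hKR : 0 < K * M.R := by positivity
  have hex : ∀ s : V, ∃ j : ℕ, K * M.R ≤ G.dist M s v →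
      2 ^ j * (K * M.R) ≤ G.dist M s v ∧ G.dist M s v < 2 ^ (j + 1) * (K * M.R) := by
    intro s
    by_cases h : K * M.R ≤ G.dist M s v
    · obtain ⟨j, h1, h2⟩ := exists_nat_pow_near (x := G.dist M s v / (K * M.R)) (y := 2)
        ((one_le_div hKR).mpr h) (by norm_num)
      exact ⟨j, fun _ => ⟨(le_div_iff₀ hKR).mp h1, (div_lt_iff₀ hKR).mp h2⟩⟩
    · exact ⟨0, fun h' => absurd h' h⟩
  choose j hj using hex
  set J := S.sup j + 1
  calc ∑ s ∈ S.filter (fun s => K * M.R ≤ G.dist M s v), (G.dist M s v) ^ (-M.ζ)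
      ≤ ∑ s ∈ S.filter (fun s => K * M.R ≤ G.dist M s v), ∑ i ∈ Finset.range J,
          if G.dist M s v < 2 ^ (i + 1) * (K * M.R) then
            if j s = i then (2 ^ i * (K * M.R)) ^ (-M.ζ) else 0 else 0 := by
        refine Finset.sum_le_sum fun s hs => ?_
        rw [Finset.mem_filter] at hs
        obtain ⟨h1, h2⟩ := hj s hs.2
        rw [Finset.sum_eq_single (j s), if_pos h2, if_pos rfl]
        · exact Real.rpow_le_rpow_of_nonpos (by positivity) h1 (by linarith)
        · intro i _ hi
          simp [hi.symm]
        · intro h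
          exact absurd (Finset.mem_range.mpr (Nat.lt_succ_of_le (Finset.le_sup hs.1))) h
    _ ≤ ∑ i ∈ Finset.range J, ∑ s ∈ S, if G.dist M s v < 2 ^ (i + 1) * (K * M.R) then
            (2 ^ i * (K * M.R)) ^ (-M.ζ) else 0 := by
        rw [Finset.sum_comm]
        refine Finset.sum_le_sum fun i _ => ?_
        refine (Finset.sum_le_sum fun s _ => ?_).trans
          (Finset.sum_le_sum_of_subset_of_nonneg (Finset.filter_subset _ _) fun s _ _ => ?_)
        · split_ifs <;> first | exact le_rfl | positivity
        · split_ifs <;> positivity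
    _ ≤ ∑ i ∈ Finset.range J, M.Cind * (4 / M.rmin) ^ M.lam * M.R ^ (M.lam - M.ζ) *
          K ^ (M.lam - M.ζ) * (2 ^ (M.lam - M.ζ)) ^ i := by
        refine Finset.sum_le_sum fun i _ => ?_
        rw [← Finset.sum_filter, Finset.sum_const, nsmul_eq_mul]
        set X : ℝ := 2 ^ i * (K * M.R) with hX
        have h2i : (1 : ℝ) ≤ 2 ^ i := one_le_pow₀ (by norm_num)
        have hXR : M.R ≤ X := by
          rw [hX]
          have : 1 * M.R ≤ K * M.R := mul_le_mul_of_nonneg_right hK hR.le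
          nlinarith
        have hXpos : 0 < X := by linarith
        have hXX : 2 ^ (i + 1) * (K * M.R) = 2 * X := by rw [hX, pow_succ]; ring
        rw [hXX]
        have h1 := hS.card_le hA v (y := 2 * X) (by linarith)
        -- Here rmin ≤ R/4 ≤ X is absorbed into 2X.
        have h2 : ((2 * X + M.rmin) / M.rmin) ^ M.lam ≤ (4 / M.rmin * X) ^ M.lam := by
          refine Real.rpow_le_rpow (by positivity) ?_ (by linarith [M.one_le_lam])
          rw [div_mul_eq_mul_div]
          gcongr
          linarith [M.rmin_le]
        have hC := M.Cind_pos
        calc _ ≤ M.Cind * (4 / M.rmin * X) ^ M.lam * X ^ (-M.ζ) := by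
              refine mul_le_mul_of_nonneg_right (h1.trans ?_) (by positivity)
              exact mul_le_mul_of_nonneg_left h2 hC.le
          _ = M.Cind * (4 / M.rmin) ^ M.lam * X ^ (M.lam - M.ζ) := by
              rw [Real.mul_rpow (by positivity) hXpos.le, sub_eq_add_neg, Real.rpow_add hXpos]
              ring
          _ = _ := by
              rw [hX, Real.mul_rpow (by positivity) hKR.le, Real.mul_rpow (by positivity) hR.le,
                ← Real.rpow_natCast, ← Real.rpow_mul (by norm_num), mul_comm (i : ℝ),
                Real.rpow_mul (by norm_num), Real.rpow_natCast]
              ring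
    _ ≤ M.farConst * K ^ (M.lam - M.ζ) := by
        have h2 := M.two_rpow_lt_one
        have hC := M.Cind_pos
        rw [← Finset.mul_sum, RadioParams.farConst]
        have h3 : ∑ i ∈ Finset.range J, ((2 : ℝ) ^ (M.lam - M.ζ)) ^ i ≤
            (1 - 2 ^ (M.lam - M.ζ))⁻¹ := by
          rw [← tsum_geometric_of_lt_one (by positivity) h2]
          exact (summable_geometric_of_lt_one (by positivity) h2).sum_le_tsum _
            fun i _ => by positivity
        calc _ ≤ M.Cind * (4 / M.rmin) ^ M.lam * M.R ^ (M.lam - M.ζ) * K ^ (M.lam - M.ζ) *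
              (1 - 2 ^ (M.lam - M.ζ))⁻¹ := mul_le_mul_of_nonneg_left h3 (by positivity)
          _ = _ := by ring

open scoped Classical in
/-- The in-ball of radius `K R` is covered by few balls of radius `R / 2`. -/
theorem exists_near_weights (v : V) {K : ℝ} (hK : 0 ≤ K) :
    ∃ a : V → ℝ, (∀ s, 0 ≤ a s) ∧ ∑ s ∈ S, a s ≤ M.nearBound K ∧
      ∀ x ∈ G.inBall M v (K * M.R), 1 ≤ ∑ s ∈ S, if x ∈ G.ball M s (M.R / 2) then a s else 0 := by
  have hr := M.rmin_le
  have hR := M.R_pos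
  -- A covering center is within 2 rmin ≤ R/2 of x, so its distance to v is below (K + 1) R.
  refine ⟨fun s => if G.dist M s v < (K + 1) * M.R then 1 else 0, fun s => ?_, ?_, fun x hx => ?_⟩
  · dsimp only; split_ifs <;> norm_num
  · rw [Finset.sum_boole]
    exact hS.card_le hA v (by positivity)
  · obtain ⟨s, hs, hxs⟩ := hS.cover x
    rw [mem_ball] at hxs
    rw [mem_inBall] at hx
    have h1 : G.dist M s v < (K + 1) * M.R := by
      have := hA.metricity s v x
      linarith [hxs.2]
    refine le_trans ?_ (Finset.single_le_sum (fun s _ => ?_) hs)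
    · rw [if_pos (mem_ball.mpr ⟨by linarith [hxs.1], by linarith [hxs.2]⟩)]
      exact (if_pos h1).ge
    · dsimp only; split_ifs <;> norm_num

-- The center s of a ball containing x satisfies d(s,v) ≤ 2 d(x,v), which costs 2^ζ, and d(s,v) ≥
-- (K/2) R, so only far nodes of the net carry weight.
open scoped Classical in
theorem exists_far_weights (v : V) {K : ℝ} (hK : 2 ≤ K) :
    ∃ a : V → ℝ, (∀ s, 0 ≤ a s) ∧ ∑ s ∈ S, a s ≤ M.farBound K ∧
      ∀ x, x ∉ G.inBall M v (K * M.R) →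
        (G.dist M x v) ^ (-M.ζ) ≤ ∑ s ∈ S, if x ∈ G.ball M s (M.R / 2) then a s else 0 := by
  have hr := M.rmin_le
  have hR := M.R_pos
  have hζ := M.ζ_pos
  have h0 : ∀ s, (0 : ℝ) ≤ 2 ^ M.ζ * (G.dist M s v) ^ (-M.ζ) := fun s =>
    mul_nonneg (by positivity) (Real.rpow_nonneg (dist_nonneg s v) _)
  refine ⟨fun s => if K / 2 * M.R ≤ G.dist M s v then 2 ^ M.ζ * (G.dist M s v) ^ (-M.ζ) else 0,
    fun s => ?_, ?_, fun x hx => ?_⟩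
  · dsimp only; split_ifs
    exacts [h0 s, le_rfl]
  · rw [← Finset.sum_filter, ← Finset.mul_sum, RadioParams.farBound, mul_assoc]
    exact mul_le_mul_of_nonneg_left (hS.sum_far_le hA v (by linarith)) (by positivity)
  · obtain ⟨s, hs, hxs⟩ := hS.cover x
    rw [mem_ball] at hxs
    rw [mem_inBall, not_lt] at hx
    have h1 := hA.metricity x v s
    have h2 := hA.metricity s v x
    have hKR : 2 * M.R ≤ K * M.R := mul_le_mul_of_nonneg_right hK hR.le
    have h3 : K / 2 * M.R ≤ G.dist M s v := by linarith [hxs.1]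
    have h4 : G.dist M s v / 2 ≤ G.dist M x v := by linarith [hxs.2]
    have h5 : 0 < G.dist M s v := by linarith
    refine le_trans ?_ (Finset.single_le_sum (fun s _ => ?_) hs)
    · rw [if_pos (mem_ball.mpr ⟨by linarith [hxs.1], by linarith [hxs.2]⟩)]
      dsimp only
      rw [if_pos h3]
      calc (G.dist M x v) ^ (-M.ζ) ≤ (G.dist M s v / 2) ^ (-M.ζ) :=
            Real.rpow_le_rpow_of_nonpos (by positivity) h4 (by linarith)
        _ = _ := by
            rw [Real.div_rpow h5.le (by norm_num), Real.rpow_neg (by norm_num : (0 : ℝ) ≤ 2),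
              div_inv_eq_mul, mul_comm]
    · dsimp only; split_ifs
      exacts [h0 s, le_rfl, le_rfl]

-- The in-ball is covered by the balls of radius 2 rmin around boundedly many nodes of a net, and
-- each of these balls lies in the neighborhood of its center.
omit hS in
theorem _root_.Network.card_inBall_le (v : V) {K : ℝ} (hK : 0 ≤ K)
    (h2 : 2 * M.rmin ≤ (1 - M.ε) * M.R) :
    ((G.inBall M v (K * M.R)).card : ℝ) ≤ M.nearBound K * G.maxDegree M := by
  classical
  obtain ⟨S, hS⟩ := hA.exists_isNet
  have hr := M.rmin_le
  have hR := M.R_pos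
  have hsub : G.inBall M v (K * M.R) ⊆
      (S.filter fun s => G.dist M s v < (K + 1) * M.R).biUnion fun s => G.neighbors M s := by
    intro x hx
    obtain ⟨s, hs, hxs⟩ := hS.cover x
    rw [mem_ball] at hxs
    rw [mem_inBall] at hx
    have := hA.metricity s v x
    exact Finset.mem_biUnion.mpr ⟨s, Finset.mem_filter.mpr ⟨hs, by linarith [hxs.2]⟩,
      mem_neighbors.mpr (by linarith [hxs.2])⟩
  have h1 := (Finset.card_le_card hsub).trans (Finset.card_biUnion_le_card_mul _ _ (G.maxDegree M)
    fun s _ => Finset.le_sup (f := fun u => (G.neighbors M u).card) (Finset.mem_univ s))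
  refine le_trans (Nat.cast_le.mpr h1) ?_
  rw [Nat.cast_mul]
  exact mul_le_mul_of_nonneg_right (hS.card_le hA v (by positivity)) (by positivity)

omit hS hA in
open scoped Classical in
/-- Weighted sums of a nonnegative function are controlled by its sums over the balls of a net. -/
theorem _root_.Network.sum_mul_le_of_cover {a g p : V → ℝ} (hp : ∀ x, 0 ≤ p x) (T S : Finset V)
    (ha : ∀ s, 0 ≤ a s)
    (hg : ∀ x ∈ T, g x ≤ ∑ s ∈ S, if x ∈ G.ball M s (M.R / 2) then a s else 0) :
    ∑ x ∈ T, g x * p x ≤ ∑ s ∈ S, a s * ∑ x ∈ G.ball M s (M.R / 2), p x := by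
  calc ∑ x ∈ T, g x * p x
      ≤ ∑ x ∈ T, (∑ s ∈ S, if x ∈ G.ball M s (M.R / 2) then a s else 0) * p x :=
        Finset.sum_le_sum fun x hx => mul_le_mul_of_nonneg_right (hg x hx) (hp x)
    _ ≤ ∑ x, (∑ s ∈ S, if x ∈ G.ball M s (M.R / 2) then a s else 0) * p x := by
        refine Finset.sum_le_sum_of_subset_of_nonneg (Finset.subset_univ _) fun x _ _ => ?_
        refine mul_nonneg (Finset.sum_nonneg fun s _ => ?_) (hp x)
        split_ifs
        exacts [ha s, le_rfl]
    _ = _ := by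
        simp only [Finset.sum_mul]
        rw [Finset.sum_comm]
        refine Finset.sum_congr rfl fun s _ => ?_
        rw [Finset.mul_sum, ← Finset.sum_filter_add_sum_filter_not Finset.univ
          (fun x => x ∈ G.ball M s (M.R / 2))]
        rw [Finset.sum_eq_zero (s := Finset.univ.filter fun x => ¬ x ∈ G.ball M s (M.R / 2))
          fun x hx => by rw [if_neg (Finset.mem_filter.mp hx).2, zero_mul], add_zero]
        rw [show (Finset.univ.filter fun x => x ∈ G.ball M s (M.R / 2)) = G.ball M s (M.R / 2) by
          ext x; simp]
        exact Finset.sum_congr rfl fun x hx => by rw [if_pos hx]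

end IsNet

end Network

/-! ### Drift of the contention in a ball -/

theorem SenseParams.exists_threshold (Q : SenseParams) :
    ∃ φ : ℝ, Q.φ₀ < φ ∧ 33 * Q.h₁ ^ (-φ) * 4 ^ 16 ≤ 1 / 4 := by
  have h1 : Filter.Tendsto (fun φ : ℝ => 33 * Q.h₁ ^ (-φ) * 4 ^ 16) Filter.atTop (nhds 0) := by
    have := ((tendsto_rpow_atBot_of_base_gt_one _ Q.one_lt_h₁).comp
      Filter.tendsto_neg_atTop_atBot).const_mul (33 : ℝ)
    simpa using this.mul_const ((4 : ℝ) ^ 16)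
  obtain ⟨φ, h2, h3⟩ := ((h1.eventually_le_const (by norm_num : (0 : ℝ) < 1 / 4)).and
    (Filter.eventually_gt_atTop Q.φ₀)).exists
  exact ⟨φ, h3, h2⟩

/-- A contention above which detecting Idle is very unlikely. -/
noncomputable def SenseParams.threshold (Q : SenseParams) : ℝ := Q.exists_threshold.choose

/-- The additive constant in the drift of the contention. -/
noncomputable def SenseParams.driftConst (Q : SenseParams) : ℝ := 4 ^ 16 * (Q.threshold + 1) + 2

/-- A block has at most 33 relevant rounds of a node, and its probability grows by at most about
4^16 in the block. So the wrong Idle outcomes add at most a quarter of the contention in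
expectation. -/
theorem SenseParams.threshold_spec (Q : SenseParams) :
    Q.φ₀ < Q.threshold ∧ 33 * Q.h₁ ^ (-Q.threshold) * 4 ^ 16 ≤ 1 / 4 :=
  Q.exists_threshold.choose_spec

theorem SenseParams.one_lt_threshold (Q : SenseParams) : 1 < Q.threshold :=
  Q.one_le_φ₀.trans_lt Q.threshold_spec.1

theorem SenseParams.one_le_driftConst (Q : SenseParams) : 1 ≤ Q.driftConst := by
  have := Q.one_lt_threshold
  unfold driftConst
  nlinarith

namespace Trace

variable {V Ω : Type*} {E : Trace V Ω} {n l t t' m : ℕ} {ω : Ω}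

theorem contention_nonneg (hn : 2 ≤ n) (S : Finset V) : 0 ≤ E.contention n S t ω :=
  Finset.sum_nonneg fun _ _ => curProb_nonneg hn

/-- The initial probability 1/(2n) is so small that all the nodes starting together add at most 1/2
to the contention. -/
theorem card_div_le_half [Fintype V] (hn : 2 ≤ n) (hV : Fintype.card V ≤ n) (S : Finset V) :
    ∑ _w ∈ S, (1 : ℝ) / (2 * n) ≤ 1 / 2 := by
  have h2 : (2 : ℝ) ≤ n := by exact_mod_cast hn
  rw [Finset.sum_const, nsmul_eq_mul, mul_one_div, div_le_iff₀ (by positivity)]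
  have : (S.card : ℝ) ≤ n := by exact_mod_cast (Finset.card_le_univ S).trans hV
  linarith

theorem contention_le [Fintype V] (hn : 2 ≤ n) (hV : Fintype.card V ≤ n) (h : E.LengthBound l)
    (S : Finset V) (htt' : t ≤ t') (ht' : t' ≤ t + m * l) :
    E.contention n S t' ω ≤ 4 ^ m * (E.contention n S t ω + 1 / 2) := by
  calc E.contention n S t' ω ≤ ∑ w ∈ S, 4 ^ m * (E.curProb n w t ω + 1 / (2 * n)) :=
        Finset.sum_le_sum fun w _ => curProb_le' hn h htt' ht'
    _ = 4 ^ m * (E.contention n S t ω + ∑ _w ∈ S, (1 : ℝ) / (2 * n)) := by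
        rw [← Finset.mul_sum, Finset.sum_add_distrib, contention]
    _ ≤ _ := mul_le_mul_of_nonneg_left ((add_le_add_iff_left _).mpr (card_div_le_half hn hV S))
        (by positivity)

theorem contention_le_half_card (hn : 2 ≤ n) (hl : ∀ v, 0 < E.len v) (S : Finset V) :
    E.contention n S t ω ≤ S.card / 2 := by
  calc E.contention n S t ω ≤ ∑ w ∈ S, (1 : ℝ) / 2 :=
        Finset.sum_le_sum fun w _ => curProb_le_half hn (hl w)
    _ = _ := by rw [Finset.sum_const, nsmul_eq_mul, mul_one_div]

/-- The rounds of a node started at tick `a` that lie in the interval from `t + l` to `t + 16 l`. -/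
def innerRounds (E : Trace V Ω) (l : ℕ) (w : V) (t a : ℕ) : Finset ℕ :=
  (Finset.range (t + 16 * l + 1)).filter fun i =>
    t + l ≤ a + i * E.len w ∧ a + (i + 1) * E.len w ≤ t + 16 * l

theorem mem_innerRounds (h : E.LengthBound l) {w : V} {a i : ℕ} :
    i ∈ E.innerRounds l w t a ↔
      t + l ≤ a + i * E.len w ∧ a + (i + 1) * E.len w ≤ t + 16 * l := by
  rw [innerRounds, Finset.mem_filter, and_iff_right_of_imp]
  rintro ⟨-, h2⟩
  have := Nat.le_mul_of_pos_right (i + 1) (h.pos w)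
  exact Finset.mem_range.mpr (by omega)

theorem card_innerRounds_le (h : E.LengthBound l) (w : V) (a : ℕ) :
    (E.innerRounds l w t a).card ≤ 33 := by
  have hp := h.pos w
  have : E.innerRounds l w t a ⊆
      Finset.Icc ((t - a) / E.len w) ((t - a) / E.len w + 32) := by
    intro i hi
    rw [mem_innerRounds h] at hi
    rw [Finset.mem_Icc]
    have h1 := div_le_div_add (a := a) (v := w) (t := t) (t' := t + 16 * l) h le_rfl
    constructor
    · rw [← Nat.mul_div_cancel i hp]
      exact Nat.div_le_div_right (by omega)
    · refine le_trans ?_ h1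
      rw [Nat.le_div_iff_mul_le hp]
      have := hi.2
      rw [add_mul] at this
      omega
  refine (Finset.card_le_card this).trans ?_
  rw [Nat.card_Icc]; omega

/-- Node `w`, which is awake at tick `t`, detects Idle in a round from `t + l` to `t + 16 l` in
which the contention of `S` is above `φ` throughout. -/
def missedSet (E : Trace V Ω) (n l : ℕ) (w : V) (S : Finset V) (φ : ℝ) (t : ℕ) : Set Ω :=
  ⋃ a ∈ Finset.range (t + 1), ⋃ i ∈ E.innerRounds l w t a,
    ({ω | E.wake w ω = (a : ℕ∞)} ∩
      ⋂ s ∈ Finset.Ico (a + i * E.len w) (a + (i + 1) * E.len w),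
        {ω | φ < E.contention n S s ω}) \ {ω | E.wake w ω = (a : ℕ∞) ∧ E.busy w i ω}

/-- In a crowded ball, a node without wrong outcomes detects Busy in all inner rounds and shrinks by
2^10 up to 2/n. A node with a wrong outcome, or one that was still asleep, is bounded by the trivial
growth estimate. -/
theorem curProb_le_of_missedSet [Fintype V] (hn : 2 ≤ n) (h : E.LengthBound l) (w : V)
    (S : Finset V) {φ : ℝ} (hφ : ∀ s, t ≤ s → s ≤ t + 16 * l → φ < E.contention n S s ω) :
    E.curProb n w (t + 16 * l) ω ≤ E.curProb n w t ω / 4 + 2 / n + 4 ^ 16 * (1 / (2 * n)) +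
      4 ^ 16 * (E.missedSet n l w S φ t).indicator (E.curProb n w t) ω := by
  have hc := curProb_nonneg (E := E) (v := w) (t := t) (ω := ω) hn
  have h0 : (0 : ℝ) ≤ 1 / (2 * n) := by positivity
  have h0' : (0 : ℝ) ≤ 2 / n := by positivity
  have hi : 0 ≤ (E.missedSet n l w S φ t).indicator (E.curProb n w t) ω :=
    Set.indicator_nonneg (fun ω _ => curProb_nonneg hn) ω
  by_cases hw : ∃ a : ℕ, E.wake w ω = a ∧ a ≤ t
  · obtain ⟨a, ha, hat⟩ := hw
    by_cases hF : ω ∈ E.missedSet n l w S φ t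
    · rw [Set.indicator_of_mem hF]
      have := curProb_le' (E := E) (v := w) (ω := ω) hn h (Nat.le_add_right t (16 * l)) le_rfl
      linarith
    · have hb : ∀ i, t + l ≤ a + i * E.len w → a + (i + 1) * E.len w ≤ t + 16 * l →
          E.busy w i ω := by
        intro i h1 h2
        by_contra hbusy
        refine hF ?_
        simp only [missedSet, Set.mem_iUnion]
        refine ⟨a, Finset.mem_range.mpr (by omega), i, (mem_innerRounds h).mpr ⟨h1, h2⟩,
          ⟨ha, ?_⟩, fun h => hbusy h.2⟩
        simp only [Set.mem_iInter, Finset.mem_Ico]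
        exact fun s hs => hφ s (by omega) (by omega)
      -- Blocks of 16 l ticks give a factor 1/1024, well below the 1/4 that is needed.
      have := curProb_le_of_busy hn h hat ha (k := 16) (by norm_num) hb
      have e : (16 : ℝ) / 2 ^ (16 - 2) = 1 / 1024 := by norm_num
      rw [e] at this
      have h1 := mul_nonneg (by positivity : (0 : ℝ) ≤ 4 ^ 16) hi
      have h2 := mul_nonneg (by positivity : (0 : ℝ) ≤ 4 ^ 16) h0
      linarith
  · have := curProb_le' (E := E) (v := w) (ω := ω) hn h (Nat.le_add_right t (16 * l)) le_rfl
    have h0 := curProb_eq_zero (E := E) (n := n) (v := w) (t := t) (ω := ω) fun a ha =>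
      lt_of_not_ge fun h' => hw ⟨a, ha, h'⟩
    rw [h0] at this ⊢
    linarith

/-- Either the contention is at most φ at some tick of the block, and then it is bounded by a
constant at the end because it grows slowly, or it is above φ throughout and the nodes are treated
one by one. -/
theorem contention_le_of_missedSet [Fintype V] (hn : 2 ≤ n) (hV : Fintype.card V ≤ n)
    (h : E.LengthBound l) (S : Finset V) {φ : ℝ} (hφ : 0 < φ) :
    E.contention n S (t + 16 * l) ω ≤ 1 / 4 * E.contention n S t ω + (4 ^ 16 * (φ + 1) + 2) +
      ∑ w ∈ S, 4 ^ 16 * (E.missedSet n l w S φ t).indicator (E.curProb n w t) ω := by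
  have hc := contention_nonneg (E := E) (t := t) (ω := ω) hn S
  have hi : 0 ≤ ∑ w ∈ S, (4 : ℝ) ^ 16 * (E.missedSet n l w S φ t).indicator (E.curProb n w t) ω :=
    Finset.sum_nonneg fun w _ => mul_nonneg (by positivity)
      (Set.indicator_nonneg (fun ω _ => curProb_nonneg hn) ω)
  by_cases hs : ∀ s, t ≤ s → s ≤ t + 16 * l → φ < E.contention n S s ω
  · refine (Finset.sum_le_sum fun w _ => curProb_le_of_missedSet hn h w S hs).trans ?_
    have e : ∀ w ∈ S, E.curProb n w t ω / 4 + 2 / n + 4 ^ 16 * (1 / (2 * n)) =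
        1 / 4 * E.curProb n w t ω + (4 + 4 ^ 16) * (1 / (2 * (n : ℝ))) := fun w _ => by
      have : (n : ℝ) ≠ 0 := by positivity
      field_simp
      ring
    rw [Finset.sum_add_distrib, Finset.sum_congr rfl e, Finset.sum_add_distrib, ← Finset.mul_sum,
      ← Finset.mul_sum, ← contention]
    have := card_div_le_half hn hV S
    linarith
  · push Not at hs
    obtain ⟨s, h1, h2, h3⟩ := hs
    have := contention_le (ω := ω) hn hV h S (t := s) (t' := t + 16 * l) (m := 16) h2 (by omega)
    refine this.trans ?_
    have : (4 : ℝ) ^ 16 * (E.contention n S s ω + 1 / 2) ≤ 4 ^ 16 * (φ + 1) :=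
      mul_le_mul_of_nonneg_left (by linarith) (by positivity)
    exact le_add_of_le_of_nonneg (by linarith) hi

end Trace

open Trace

section drift

variable {V Ω : Type*} [Fintype V] [mΩ : MeasurableSpace Ω] {μ : Measure Ω}
  {ℱ : Filtration ℕ mΩ} {n l : ℕ} {E : Trace V Ω} {M : RadioParams} {Q : SenseParams} {ρ : ℝ}
  {G : Network V}

omit [Fintype V] in
theorem measurableSet_missedSet (h : IsLocalBcast μ ℱ n E) (w : V) (S : Finset V) (φ : ℝ) (t : ℕ) :
    MeasurableSet (E.missedSet n l w S φ t) := by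
  refine Finset.measurableSet_biUnion _ fun a _ => Finset.measurableSet_biUnion _ fun i _ => ?_
  refine MeasurableSet.diff (MeasurableSet.inter ?_ (Finset.measurableSet_biInter _ fun s _ => ?_)) ?_
  · exact ℱ.le a _ (h.measurableSet_wake w le_rfl)
  · exact measurableSet_lt measurable_const ((h.measurable_contention S s).mono (ℱ.le s) le_rfl)
  · exact ℱ.le _ _ (h.measurableSet_wake_busy w le_rfl)

/-- Union bound over the at most 33 inner rounds, separately for each starting tick of w. An inner
round starts at t + l or later, so all rounds in progress at that moment began at t or later, as
`CDSpec` demands for r = t. -/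
theorem measure_inter_missedSet_le (h : IsLocalBcast μ ℱ n E) (hl : E.LengthBound l)
    (hcd : CDSpec M Q ρ G μ ℱ n E) {u w : V} (hw : w ∈ G.ball M u (M.R / 2)) {φ : ℝ}
    (hφ : Q.φ₀ < φ) {t : ℕ} {A : Set Ω} (hA : MeasurableSet[ℱ t] A) :
    μ (A ∩ E.missedSet n l w (G.ball M u (M.R / 2)) φ t) ≤
      33 * ENNReal.ofReal (Q.h₁ ^ (-φ)) * μ A := by
  have hmw : ∀ a ∈ Finset.range (t + 1), MeasurableSet[ℱ t] {ω | E.wake w ω = (a : ℕ∞)} :=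
    fun a ha => h.measurableSet_wake w (by have := Finset.mem_range.mp ha; omega)
  calc μ (A ∩ E.missedSet n l w (G.ball M u (M.R / 2)) φ t)
      ≤ ∑ a ∈ Finset.range (t + 1), ∑ i ∈ E.innerRounds l w t a,
          ENNReal.ofReal (Q.h₁ ^ (-φ)) * μ (A ∩ {ω | E.wake w ω = (a : ℕ∞)}) := by
        rw [missedSet, Set.inter_iUnion₂]
        refine (measure_biUnion_finset_le _ _).trans (Finset.sum_le_sum fun a ha => ?_)
        rw [Set.inter_iUnion₂]
        refine (measure_biUnion_finset_le _ _).trans (Finset.sum_le_sum fun i hi => ?_)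
        rw [mem_innerRounds hl] at hi
        refine le_trans (measure_mono ?_) (hcd.high u w hw φ hφ i t (a + i * E.len w)
          (fun v => by have := hl.le v; omega) _ (hA.inter (hmw a ha)))
        rintro ω ⟨hωA, ⟨hωw, hωs⟩, hωb⟩
        simp only [Set.mem_iInter, Finset.mem_Ico] at hωs
        refine ⟨⟨hωA, hωw⟩, (starts_iff hωw i).mpr rfl, fun s hs => ?_, fun hb => hωb ⟨hωw, hb⟩⟩
        exact hωs s ((inRound_iff hωw i).mp hs)
    _ ≤ ∑ a ∈ Finset.range (t + 1), 33 * ENNReal.ofReal (Q.h₁ ^ (-φ)) *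
          μ (A ∩ {ω | E.wake w ω = (a : ℕ∞)}) := by
        refine Finset.sum_le_sum fun a _ => ?_
        rw [Finset.sum_const, nsmul_eq_mul, ← mul_assoc]
        gcongr
        exact_mod_cast card_innerRounds_le hl w a
    _ ≤ _ := by
        rw [← Finset.mul_sum]
        gcongr
        rw [← measure_biUnion_finset]
        · exact measure_mono (Set.iUnion₂_subset fun a _ => Set.inter_subset_left)
        · intro a _ b _ hab
          refine Set.disjoint_left.mpr fun ω h1 h2 => hab ?_
          have := h1.2.symm.trans h2.2
          exact_mod_cast this
        · exact fun a ha => (ℱ.le t _ hA).inter (ℱ.le t _ (hmw a ha))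

omit [Fintype V] mΩ in
theorem ofReal_sum_indicator (hn : 2 ≤ n) (S : Finset V) (F : V → Set Ω) (c : ℝ) (hc : 0 ≤ c)
    (t : ℕ) (ω : Ω) :
    ENNReal.ofReal (∑ w ∈ S, c * (F w).indicator (E.curProb n w t) ω) =
      ∑ w ∈ S, ENNReal.ofReal c *
        (F w).indicator (fun ω => ENNReal.ofReal (E.curProb n w t ω)) ω := by
  rw [ENNReal.ofReal_sum_of_nonneg fun w _ => mul_nonneg hc
    (Set.indicator_nonneg (fun ω _ => curProb_nonneg hn) ω)]
  refine Finset.sum_congr rfl fun w _ => ?_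
  rw [ENNReal.ofReal_mul hc]
  by_cases hω : ω ∈ F w <;> simp [hω]

/-- The contention in a ball of radius `R / 2` has a drift towards a constant. -/
theorem setLIntegral_contention_le (h : IsLocalBcast μ ℱ n E) (hn : 2 ≤ n)
    (hV : Fintype.card V ≤ n) (hl : E.LengthBound l) (hcd : CDSpec M Q ρ G μ ℱ n E) (u : V) (t : ℕ)
    {A : Set Ω} (hA : MeasurableSet[ℱ t] A) :
    ∫⁻ ω in A, ENNReal.ofReal (E.contention n (G.ball M u (M.R / 2)) (t + 16 * l) ω) ∂μ ≤
      ∫⁻ ω in A, ENNReal.ofReal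
        (1 / 2 * E.contention n (G.ball M u (M.R / 2)) t ω + Q.driftConst) ∂μ := by
  set S := G.ball M u (M.R / 2)
  set φ := Q.threshold
  have hφ := Q.threshold_spec
  have hφ0 : 0 < φ := by linarith [Q.one_lt_threshold]
  have hmc := fun w => (h.measurable_curProb w t).mono (ℱ.le t) le_rfl
  have hmS := (h.measurable_contention S t).mono (ℱ.le t) le_rfl
  have hmF := fun w => measurableSet_missedSet (l := l) h w S φ t
  have hD := Q.one_le_driftConst
  calc ∫⁻ ω in A, ENNReal.ofReal (E.contention n S (t + 16 * l) ω) ∂μ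
      ≤ ∫⁻ ω in A, (ENNReal.ofReal (1 / 4 * E.contention n S t ω + Q.driftConst) +
          ∑ w ∈ S, ENNReal.ofReal (4 ^ 16) *
            (E.missedSet n l w S φ t).indicator (fun ω => ENNReal.ofReal (E.curProb n w t ω)) ω)
          ∂μ := by
        refine lintegral_mono fun ω => ?_
        rw [← ofReal_sum_indicator hn S _ _ (by positivity)]
        have hc := contention_nonneg (E := E) (t := t) (ω := ω) hn S
        rw [← ENNReal.ofReal_add (by linarith) (Finset.sum_nonneg fun w _ => mul_nonneg
          (by positivity) (Set.indicator_nonneg (fun ω _ => curProb_nonneg hn) ω))]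
        exact ENNReal.ofReal_le_ofReal (contention_le_of_missedSet hn hV hl S hφ0)
    _ = ∫⁻ ω in A, ENNReal.ofReal (1 / 4 * E.contention n S t ω + Q.driftConst) ∂μ +
          ∑ w ∈ S, ENNReal.ofReal (4 ^ 16) * ∫⁻ ω in A,
            (E.missedSet n l w S φ t).indicator (fun ω => ENNReal.ofReal (E.curProb n w t ω)) ω
          ∂μ := by
        have hm : ∀ w, Measurable ((E.missedSet n l w S φ t).indicator
            (fun ω => ENNReal.ofReal (E.curProb n w t ω))) :=
          fun w => (ENNReal.measurable_ofReal.comp (hmc w)).indicator (hmF w)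
        rw [lintegral_add_left ((hmS.const_mul _).add_const _).ennreal_ofReal,
          lintegral_finsetSum _ fun w _ => (hm w).const_mul _]
        congr 1
        exact Finset.sum_congr rfl fun w _ => lintegral_const_mul _ (hm w)
    _ ≤ ∫⁻ ω in A, ENNReal.ofReal (1 / 4 * E.contention n S t ω + Q.driftConst) ∂μ +
          ∑ w ∈ S, ENNReal.ofReal (1 / 4) * ∫⁻ ω in A, ENNReal.ofReal (E.curProb n w t ω) ∂μ := by
        refine add_le_add le_rfl (Finset.sum_le_sum fun w hw => ?_)
        -- The probability of w at t is known at t, so the conditional bound on wrong outcomes can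
        -- be multiplied by it.
        have := setLIntegral_indicator_le (ℱ.le t) (hmF w) hA (fun B hB _ =>
          measure_inter_missedSet_le h hl hcd hw hφ.1 hB)
          (ENNReal.measurable_ofReal.comp (h.measurable_curProb w t))
        refine (mul_le_mul_right this _).trans ?_
        rw [← mul_assoc]
        refine mul_le_mul_left ?_ _
        have h33 : (33 : ℝ≥0∞) = ENNReal.ofReal 33 := by norm_num
        have hh := Q.one_lt_h₁
        rw [h33, ← ENNReal.ofReal_mul (by norm_num), ← ENNReal.ofReal_mul (by positivity)]
        exact ENNReal.ofReal_le_ofReal (by linarith [hφ.2])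
    _ = ∫⁻ ω in A, ENNReal.ofReal
        (1 / 2 * E.contention n S t ω + Q.driftConst) ∂μ := by
        have hm : ∀ w ∈ S, Measurable fun ω =>
            ENNReal.ofReal (1 / 4) * ENNReal.ofReal (E.curProb n w t ω) :=
          fun w _ => ((hmc w).ennreal_ofReal).const_mul _
        rw [Finset.sum_congr rfl fun w _ =>
          (lintegral_const_mul (ENNReal.ofReal (1 / 4)) (hmc w).ennreal_ofReal).symm,
          ← lintegral_finsetSum _ hm,
          ← lintegral_add_left ((hmS.const_mul _).add_const _).ennreal_ofReal]
        refine lintegral_congr fun ω => ?_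
        have hc := contention_nonneg (E := E) (t := t) (ω := ω) hn S
        rw [← Finset.mul_sum, ← ENNReal.ofReal_sum_of_nonneg fun w _ => curProb_nonneg hn,
          ← ENNReal.ofReal_mul (by norm_num), ← contention, ← ENNReal.ofReal_add (by linarith)
          (by linarith)]
        congr 1
        ring

end drift

/-! ### Change of measure: forcing silence against an adaptive adversary -/

theorem exp_neg_two_mul_le {p : ℝ} (h0 : 0 ≤ p) (h1 : p ≤ 1 / 2) : Real.exp (-(2 * p)) ≤ 1 - p := by
  rw [Real.exp_neg, inv_le_comm₀ (Real.exp_pos _) (by linarith)]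
  refine le_trans ?_ (Real.add_one_le_exp _)
  rw [inv_le_iff_one_le_mul₀ (by linarith)]
  nlinarith

theorem setLIntegral_mul_eq_of_forall {Ω : Type*} {m mΩ : MeasurableSpace Ω} {μ : Measure Ω}
    (hm : m ≤ mΩ) {f f' : Ω → ℝ≥0∞} (hf : Measurable f) (hf' : Measurable f')
    (he : ∀ A, MeasurableSet[m] A → ∫⁻ ω in A, f ω ∂μ = ∫⁻ ω in A, f' ω ∂μ)
    {g : Ω → ℝ≥0∞} (hg : Measurable[m] g) {A : Set Ω} (hA : MeasurableSet[m] A) :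
    ∫⁻ ω in A, g ω * f ω ∂μ = ∫⁻ ω in A, g ω * f' ω ∂μ :=
  le_antisymm (setLIntegral_mul_le_of_forall hm hf hf' (fun A hA => (he A hA).le) hg hA)
    (setLIntegral_mul_le_of_forall hm hf' hf (fun A hA => (he A hA).ge) hg hA)

theorem lintegral_mul_sum_mul {Ω ι : Type*} {mΩ : MeasurableSpace Ω} {ν : Measure Ω} (s : Finset ι)
    {N : Ω → ℝ≥0∞} (hN : Measurable N) (c : ι → ℝ≥0∞) {f : ι → Ω → ℝ≥0∞}
    (hf : ∀ i, Measurable (f i)) :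
    ∫⁻ ω, N ω * ∑ i ∈ s, c i * f i ω ∂ν = ∑ i ∈ s, c i * ∫⁻ ω, N ω * f i ω ∂ν := by
  have hm : ∀ i, Measurable fun ω => N ω * f i ω := fun i => hN.mul (hf i)
  have e : ∀ ω, N ω * ∑ i ∈ s, c i * f i ω = ∑ i ∈ s, c i * (N ω * f i ω) := fun ω => by
    rw [Finset.mul_sum]
    exact Finset.sum_congr rfl fun i _ => mul_left_comm _ _ _
  simp only [e]
  rw [lintegral_finsetSum _ fun i _ => (hm i).const_mul _]
  exact Finset.sum_congr rfl fun i _ => lintegral_const_mul _ (hm i)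

/-- Markov's inequality: at least half of the mass of `N` lies where `L` is at most twice its
mean. -/
theorem half_lintegral_le {Ω : Type*} {mΩ : MeasurableSpace Ω} {ν : Measure Ω} {N L : Ω → ℝ≥0∞}
    (hN : Measurable N) (hL : Measurable L) {c θ : ℝ≥0∞} (hcθ : 2 * c ≤ θ) (hθ0 : θ ≠ 0)
    (hθ : θ ≠ ⊤) (hfin : ∫⁻ ω, N ω ∂ν ≠ ⊤) (h : ∫⁻ ω, N ω * L ω ∂ν ≤ c * ∫⁻ ω, N ω ∂ν) :
    (∫⁻ ω, N ω ∂ν) / 2 ≤ ∫⁻ ω, N ω * {ω | L ω ≤ θ}.indicator 1 ω ∂ν := by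
  have hLs : MeasurableSet {ω | L ω ≤ θ} := measurableSet_le hL measurable_const
  have hNL : Measurable fun ω => N ω * {ω | L ω ≤ θ}.indicator 1 ω :=
    hN.mul (measurable_one.indicator hLs)
  have hNLc : Measurable fun ω => N ω * {ω | L ω ≤ θ}ᶜ.indicator 1 ω :=
    hN.mul (measurable_one.indicator hLs.compl)
  set I := ∫⁻ ω, N ω ∂ν
  have h3 : θ * ∫⁻ ω, N ω * {ω | L ω ≤ θ}ᶜ.indicator 1 ω ∂ν ≤ c * I := by
    rw [← lintegral_const_mul _ hNLc]
    refine le_trans (lintegral_mono fun ω => ?_) h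
    by_cases hω : L ω ≤ θ
    · simp [hω]
    · rw [Set.indicator_of_mem (by simpa using hω), mul_comm]
      simpa using mul_le_mul_right (not_le.mp hω).le _
  have h4 : I ≤ ∫⁻ ω, N ω * {ω | L ω ≤ θ}.indicator 1 ω ∂ν +
      ∫⁻ ω, N ω * {ω | L ω ≤ θ}ᶜ.indicator 1 ω ∂ν := by
    rw [← lintegral_add_left hNL]
    refine lintegral_mono fun ω => ?_
    by_cases hω : L ω ≤ θ <;> simp [hω]
  have h5 : ∫⁻ ω, N ω * {ω | L ω ≤ θ}ᶜ.indicator 1 ω ∂ν ≤ I / 2 := by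
    rw [ENNReal.le_div_iff_mul_le (by simp) (by simp), mul_comm]
    have : θ * (2 * ∫⁻ ω, N ω * {ω | L ω ≤ θ}ᶜ.indicator 1 ω ∂ν) ≤ θ * I :=
      calc _ = 2 * (θ * ∫⁻ ω, N ω * {ω | L ω ≤ θ}ᶜ.indicator 1 ω ∂ν) := by ring
        _ ≤ 2 * (c * I) := mul_le_mul_right h3 _
        _ = 2 * c * I := by ring
        _ ≤ _ := mul_le_mul_left hcθ _
    exact (ENNReal.mul_le_mul_iff_right hθ0 hθ).mp this
  have h7 := h4.trans (add_le_add le_rfl h5)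
  nth_rewrite 1 [← ENNReal.add_halves I] at h7
  exact (ENNReal.add_le_add_iff_right (ENNReal.div_lt_top hfin (by simp)).ne).mp h7

namespace IsLocalBcast

variable {V Ω : Type*} [Fintype V] [mΩ : MeasurableSpace Ω] {μ : Measure Ω}
  [IsProbabilityMeasure μ] {ℱ : Filtration ℕ mΩ} {n : ℕ} {E : Trace V Ω}

-- The field `coins` only speaks of nodes that transmit. Induction on `W` adds silent nodes:
-- splitting by the coin of x, the case where x transmits is subtracted, which is legitimate as
-- measures are finite.
omit [Fintype V] in
theorem measure_inter_txAt_inter (h : IsLocalBcast μ ℱ n E) (hn : 2 ≤ n) {t : ℕ} {A : Set Ω}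
    (hA : MeasurableSet[ℱ t] A) (U W : Finset V) (hUW : Disjoint U W) :
    μ (A ∩ {ω | (∀ w ∈ U, E.TxAt w t ω) ∧ ∀ w ∈ W, ¬ E.TxAt w t ω}) =
      ∫⁻ ω in A, (∏ w ∈ U, ENNReal.ofReal (E.startProb n w t ω)) *
        ∏ w ∈ W, ENNReal.ofReal (1 - E.startProb n w t ω) ∂μ := by
  classical
  have hmp : ∀ w, Measurable (E.startProb n w t) :=
    fun w => (h.measurable_startProb w t).mono (ℱ.le t) le_rfl
  induction W using Finset.induction_on generalizing U with
  | empty =>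
    have h1 := h.coins t A hA U
    have h2 : {ω | (∀ w ∈ U, E.TxAt w t ω) ∧ ∀ w ∈ (∅ : Finset V), ¬ E.TxAt w t ω} =
        {ω | ∀ w ∈ U, ∃ i, E.Starts w i t ω ∧ E.tx w i ω} := by
      ext ω; simp [TxAt]
    simp only [h2, Finset.prod_empty, mul_one]
    exact h1
  | insert x W hx ih =>
    rw [Finset.disjoint_insert_right] at hUW
    have h1 := ih U hUW.2
    have h2 := ih (insert x U) (by
      rw [Finset.disjoint_insert_left]; exact ⟨hx, hUW.2⟩)
    have hsplit : μ (A ∩ {ω | (∀ w ∈ U, E.TxAt w t ω) ∧ ∀ w ∈ W, ¬ E.TxAt w t ω}) =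
        μ (A ∩ {ω | (∀ w ∈ insert x U, E.TxAt w t ω) ∧ ∀ w ∈ W, ¬ E.TxAt w t ω}) +
        μ (A ∩ {ω | (∀ w ∈ U, E.TxAt w t ω) ∧ ∀ w ∈ insert x W, ¬ E.TxAt w t ω}) := by
      rw [← measure_inter_add_sdiff _ (ℱ.le _ _ (h.measurableSet_txAt x t))]
      congr 2
      · ext ω
        simp only [Set.mem_inter_iff, Set.mem_ofPred_eq, Finset.forall_mem_insert]
        tauto
      · ext ω
        simp only [Set.mem_inter_iff, Set.mem_ofPred_eq, Finset.forall_mem_insert, Set.mem_sdiff]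
        tauto
    have hsum : ∫⁻ ω in A, (∏ w ∈ U, ENNReal.ofReal (E.startProb n w t ω)) *
          ∏ w ∈ W, ENNReal.ofReal (1 - E.startProb n w t ω) ∂μ =
        ∫⁻ ω in A, (∏ w ∈ insert x U, ENNReal.ofReal (E.startProb n w t ω)) *
          ∏ w ∈ W, ENNReal.ofReal (1 - E.startProb n w t ω) ∂μ +
        ∫⁻ ω in A, (∏ w ∈ U, ENNReal.ofReal (E.startProb n w t ω)) *
          ∏ w ∈ insert x W, ENNReal.ofReal (1 - E.startProb n w t ω) ∂μ := by
      rw [← lintegral_add_left]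
      · refine lintegral_congr fun ω => ?_
        rw [Finset.prod_insert hUW.1, Finset.prod_insert hx]
        have hp0 := startProb_nonneg (E := E) (v := x) (t := t) (ω := ω) hn
        have hp1 := startProb_le_half (E := E) (v := x) (t := t) (ω := ω) hn (h.len_pos x)
        have : ENNReal.ofReal (E.startProb n x t ω) + ENNReal.ofReal (1 - E.startProb n x t ω) =
            1 := by
          rw [← ENNReal.ofReal_add hp0 (by linarith)]; simp
        calc _ = (∏ w ∈ U, ENNReal.ofReal (E.startProb n w t ω)) *
              (∏ w ∈ W, ENNReal.ofReal (1 - E.startProb n w t ω)) *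
              (ENNReal.ofReal (E.startProb n x t ω) + ENNReal.ofReal (1 - E.startProb n x t ω)) := by
              rw [this, mul_one]
          _ = _ := by ring
      · exact (Finset.measurable_fun_prod _ fun w _ => (hmp w).ennreal_ofReal).mul
          (Finset.measurable_fun_prod _ fun w _ => ((hmp w).const_sub 1).ennreal_ofReal)
    rw [hsplit, hsum, h2] at h1
    exact (ENNReal.add_right_inj (by rw [← h2]; exact measure_ne_top μ _)).mp h1

omit [Fintype V] [IsProbabilityMeasure μ] in
theorem measurableSet_txAt_inter (h : IsLocalBcast μ ℱ n E) (t : ℕ) (U W : Finset V) :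
    MeasurableSet[ℱ (t + 1)] {ω | (∀ w ∈ U, E.TxAt w t ω) ∧ ∀ w ∈ W, ¬ E.TxAt w t ω} := by
  have : {ω | (∀ w ∈ U, E.TxAt w t ω) ∧ ∀ w ∈ W, ¬ E.TxAt w t ω} =
      (⋂ w ∈ U, {ω | E.TxAt w t ω}) ∩ ⋂ w ∈ W, {ω | E.TxAt w t ω}ᶜ := by
    ext ω; simp
  rw [this]
  exact (Finset.measurableSet_biInter _ fun w _ => h.measurableSet_txAt w t).inter
    (Finset.measurableSet_biInter _ fun w _ => (h.measurableSet_txAt w t).compl)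

end IsLocalBcast

namespace Trace

variable {V Ω : Type*} {E : Trace V Ω} {n : ℕ}

/-- No node of `D` transmits in a round that starts in the interval from `a` to `b`. -/
def quiet (E : Trace V Ω) (D : Finset V) (a b : ℕ) : Set Ω :=
  {ω | ∀ t ∈ Finset.Ico a b, ∀ x ∈ D, ¬ E.TxAt x t ω}

/-- The probability that no node of `D` transmits in a round that starts at tick `t`. -/
noncomputable def quietProb (E : Trace V Ω) (n : ℕ) (D : Finset V) (t : ℕ) (ω : Ω) : ℝ≥0∞ :=
  ∏ x ∈ D, ENNReal.ofReal (1 - E.startProb n x t ω)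

/-- The density that makes the nodes of `D` silent in the interval from `a` to `b`. -/
noncomputable def quietDensity (E : Trace V Ω) (n : ℕ) (D : Finset V) (a b : ℕ) (ω : Ω) : ℝ≥0∞ :=
  (E.quiet D a b).indicator 1 ω * ∏ t ∈ Finset.Ico a b, (E.quietProb n D t ω)⁻¹

/-- The weighted number of transmissions of nodes of `T` in rounds that start in the interval. -/
noncomputable def load (E : Trace V Ω) (T : Finset V) (g : V → ℝ≥0∞) (a b : ℕ) (ω : Ω) : ℝ≥0∞ :=
  ∑ t ∈ Finset.Ico a b, ∑ x ∈ T, g x * {ω | E.TxAt x t ω}.indicator 1 ω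

theorem quietDensity_self (D : Finset V) (a : ℕ) (ω : Ω) : E.quietDensity n D a a ω = 1 := by
  simp [quietDensity, quiet]

theorem quietDensity_succ (D : Finset V) {a b : ℕ} (hab : a ≤ b) (ω : Ω) :
    E.quietDensity n D a (b + 1) ω = E.quietDensity n D a b ω * (E.quietProb n D b ω)⁻¹ *
      {ω | (∀ w ∈ (∅ : Finset V), E.TxAt w b ω) ∧ ∀ w ∈ D, ¬ E.TxAt w b ω}.indicator 1 ω := by
  rw [quietDensity, quietDensity, Finset.prod_Ico_succ_top hab]
  have : E.quiet D a (b + 1) = E.quiet D a b ∩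
      {ω | (∀ w ∈ (∅ : Finset V), E.TxAt w b ω) ∧ ∀ w ∈ D, ¬ E.TxAt w b ω} := by
    ext ω
    simp only [quiet, Finset.mem_Ico, Set.mem_ofPred_eq, Set.mem_inter_iff, Finset.notMem_empty,
      false_implies, implies_true, true_and]
    constructor
    · exact fun h => ⟨fun t ht => h t ⟨ht.1, by omega⟩, h b ⟨hab, by omega⟩⟩
    · rintro ⟨h1, h2⟩ t ht
      rcases eq_or_ne t b with rfl | hne
      · exact h2
      · exact h1 t ⟨ht.1, by omega⟩
  rw [this, Set.inter_indicator_one, Pi.mul_apply]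
  ring

/-- Transmission probabilities are at most 1/2, so each factor 1 - p is at least exp (-2p). -/
theorem exp_le_quietProb (hn : 2 ≤ n) (hl : ∀ v, 0 < E.len v) (D : Finset V) (t : ℕ) (ω : Ω) :
    ENNReal.ofReal (Real.exp (-(2 * ∑ x ∈ D, E.startProb n x t ω))) ≤ E.quietProb n D t ω := by
  rw [quietProb, Finset.mul_sum, ← Finset.sum_neg_distrib, Real.exp_sum,
    ENNReal.ofReal_prod_of_nonneg fun _ _ => (Real.exp_pos _).le]
  exact Finset.prod_le_prod' fun x _ => ENNReal.ofReal_le_ofReal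
    (exp_neg_two_mul_le (startProb_nonneg hn) (startProb_le_half hn (hl x)))

theorem quietProb_ne_zero (hn : 2 ≤ n) (hl : ∀ v, 0 < E.len v) (D : Finset V) (t : ℕ) (ω : Ω) :
    E.quietProb n D t ω ≠ 0 :=
  ((ENNReal.ofReal_pos.mpr (Real.exp_pos _)).trans_le (exp_le_quietProb hn hl D t ω)).ne'

theorem quietProb_ne_top (D : Finset V) (t : ℕ) (ω : Ω) : E.quietProb n D t ω ≠ ⊤ :=
  ENNReal.prod_ne_top fun _ _ => ENNReal.ofReal_ne_top

/-- Bounded contention bounds the density, so a lower bound under the tilted measure gives one under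
`μ`. -/
theorem quietDensity_le (hn : 2 ≤ n) (hl : ∀ v, 0 < E.len v) (D : Finset V) (a b : ℕ) {ω : Ω}
    {q : ℝ} (hq : ∑ t ∈ Finset.Ico a b, ∑ x ∈ D, E.startProb n x t ω ≤ q) :
    E.quietDensity n D a b ω ≤
      ENNReal.ofReal (Real.exp (2 * q)) * (E.quiet D a b).indicator 1 ω := by
  rw [quietDensity, mul_comm]
  refine mul_le_mul_left ?_ _
  calc ∏ t ∈ Finset.Ico a b, (E.quietProb n D t ω)⁻¹
      ≤ ∏ t ∈ Finset.Ico a b, ENNReal.ofReal (Real.exp (2 * ∑ x ∈ D, E.startProb n x t ω)) := by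
        refine Finset.prod_le_prod' fun t _ => ?_
        rw [ENNReal.inv_le_iff_inv_le, ← ENNReal.ofReal_inv_of_pos (Real.exp_pos _), ← Real.exp_neg]
        exact exp_le_quietProb hn hl D t ω
    _ = ENNReal.ofReal (Real.exp (2 * ∑ t ∈ Finset.Ico a b, ∑ x ∈ D, E.startProb n x t ω)) := by
        rw [← ENNReal.ofReal_prod_of_nonneg fun _ _ => (Real.exp_pos _).le, ← Real.exp_sum,
          Finset.mul_sum]
    _ ≤ _ := ENNReal.ofReal_le_ofReal (Real.exp_le_exp.mpr (by linarith))

end Trace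

namespace IsLocalBcast

variable {V Ω : Type*} [mΩ : MeasurableSpace Ω] {μ : Measure Ω}
  [IsProbabilityMeasure μ] {ℱ : Filtration ℕ mΩ} {n : ℕ} {E : Trace V Ω}

omit [IsProbabilityMeasure μ] in
theorem measurableSet_quiet (h : IsLocalBcast μ ℱ n E) (D : Finset V) (a b : ℕ) :
    MeasurableSet[ℱ b] (E.quiet D a b) := by
  have : E.quiet D a b = ⋂ t ∈ Finset.Ico a b, ⋂ x ∈ D, {ω | E.TxAt x t ω}ᶜ := by
    ext ω; simp [quiet]
  rw [this]
  exact Finset.measurableSet_biInter _ fun t ht => Finset.measurableSet_biInter _ fun x _ =>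
    (ℱ.mono (Finset.mem_Ico.mp ht).2 _ (h.measurableSet_txAt x t)).compl

omit [IsProbabilityMeasure μ] in
theorem measurable_quietProb (h : IsLocalBcast μ ℱ n E) (D : Finset V) (t : ℕ) :
    Measurable[ℱ t] (E.quietProb n D t) :=
  Finset.measurable_fun_prod _ fun x _ =>
    (measurable_const.sub (h.measurable_startProb x t)).ennreal_ofReal

omit [IsProbabilityMeasure μ] in
theorem measurable_quietDensity (h : IsLocalBcast μ ℱ n E) (D : Finset V) (a b : ℕ) :
    Measurable[ℱ b] (E.quietDensity n D a b) := by
  refine Measurable.mul ?_ (Finset.measurable_fun_prod _ fun t ht => ?_)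
  · exact measurable_const.indicator (h.measurableSet_quiet D a b)
  · exact ((h.measurable_quietProb D t).mono (ℱ.mono (Finset.mem_Ico.mp ht).2.le) le_rfl).inv

omit [IsProbabilityMeasure μ] in
theorem measurable_load (h : IsLocalBcast μ ℱ n E) (T : Finset V) (g : V → ℝ≥0∞) (a b : ℕ) :
    Measurable[ℱ b] (E.load T g a b) :=
  Finset.measurable_fun_sum _ fun t ht => Finset.measurable_fun_sum _ fun x _ =>
    (measurable_const.indicator
      (ℱ.mono (Finset.mem_Ico.mp ht).2 _ (h.measurableSet_txAt x t))).const_mul _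

/-- Given the history, the coins of a tick are independent. Dividing by the probability that `D` is
silent cancels this event and leaves the coins of `U` with their original probabilities. -/
theorem setLIntegral_quietDensity_succ (h : IsLocalBcast μ ℱ n E) (hn : 2 ≤ n) (D U : Finset V)
    (hU : Disjoint U D) {a b : ℕ} (hab : a ≤ b) {A : Set Ω} (hA : MeasurableSet[ℱ a] A)
    {f : Ω → ℝ≥0∞} (hf : Measurable[ℱ b] f) :
    ∫⁻ ω in A, E.quietDensity n D a (b + 1) ω *
        (f ω * {ω | ∀ w ∈ U, E.TxAt w b ω}.indicator 1 ω) ∂μ =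
      ∫⁻ ω in A, E.quietDensity n D a b ω *
        (f ω * ∏ w ∈ U, ENNReal.ofReal (E.startProb n w b ω)) ∂μ := by
  have hmp : ∀ w, Measurable (E.startProb n w b) :=
    fun w => (h.measurable_startProb w b).mono (ℱ.le b) le_rfl
  have key := setLIntegral_mul_eq_of_forall (μ := μ) (ℱ.le b)
    (f := {ω | (∀ w ∈ U, E.TxAt w b ω) ∧ ∀ w ∈ D, ¬ E.TxAt w b ω}.indicator 1)
    (f' := fun ω => (∏ w ∈ U, ENNReal.ofReal (E.startProb n w b ω)) * E.quietProb n D b ω)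
    (measurable_const.indicator (ℱ.le _ _ (h.measurableSet_txAt_inter b U D)))
    ((Finset.measurable_fun_prod _ fun w _ => (hmp w).ennreal_ofReal).mul
      ((h.measurable_quietProb D b).mono (ℱ.le b) le_rfl))
    (fun B hB => by
      have hm := ℱ.le _ _ (h.measurableSet_txAt_inter b U D)
      rw [lintegral_indicator_one hm, Measure.restrict_apply hm, Set.inter_comm]
      exact h.measure_inter_txAt_inter hn hB U D hU)
    (g := fun ω => E.quietDensity n D a b ω * (E.quietProb n D b ω)⁻¹ * f ω)
    ((((h.measurable_quietDensity D a b)).mul (h.measurable_quietProb D b).inv).mul hf)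
    (ℱ.mono hab _ hA)
  refine Eq.trans (lintegral_congr fun ω => ?_) (key.trans (lintegral_congr fun ω => ?_))
  · rw [quietDensity_succ D hab]
    have : {ω | (∀ w ∈ U, E.TxAt w b ω) ∧ ∀ w ∈ D, ¬ E.TxAt w b ω} =
        {ω | (∀ w ∈ (∅ : Finset V), E.TxAt w b ω) ∧ ∀ w ∈ D, ¬ E.TxAt w b ω} ∩
          {ω | ∀ w ∈ U, E.TxAt w b ω} := by
      ext ω; simp [and_comm]
    rw [this, Set.inter_indicator_one, Pi.mul_apply]
    ring
  · have h1 := ENNReal.inv_mul_cancel (quietProb_ne_zero hn h.len_pos D b ω)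
      (quietProb_ne_top D b ω)
    calc _ = E.quietDensity n D a b ω * (f ω * ∏ w ∈ U, ENNReal.ofReal (E.startProb n w b ω)) *
          ((E.quietProb n D b ω)⁻¹ * E.quietProb n D b ω) := by ring
      _ = _ := by rw [h1, mul_one]

/-- The density is a martingale of mean one, by the previous identity for empty `U`. -/
theorem setLIntegral_quietDensity (h : IsLocalBcast μ ℱ n E) (hn : 2 ≤ n) (D : Finset V)
    {a t b : ℕ} (hat : a ≤ t) (htb : t ≤ b) {A : Set Ω} (hA : MeasurableSet[ℱ a] A)
    {f : Ω → ℝ≥0∞} (hf : Measurable[ℱ t] f) :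
    ∫⁻ ω in A, E.quietDensity n D a b ω * f ω ∂μ =
      ∫⁻ ω in A, E.quietDensity n D a t ω * f ω ∂μ := by
  induction b, htb using Nat.le_induction with
  | base => rfl
  | succ b htb ih =>
    rw [← ih]
    have := h.setLIntegral_quietDensity_succ hn D ∅ (Finset.disjoint_empty_left _)
      (hat.trans htb) hA (hf.mono (ℱ.mono htb) le_rfl)
    simpa using this

theorem setLIntegral_quietDensity_txAt (h : IsLocalBcast μ ℱ n E) (hn : 2 ≤ n) (D : Finset V)
    {x : V} (hx : x ∉ D) {a t b : ℕ} (hat : a ≤ t) (htb : t < b) {A : Set Ω}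
    (hA : MeasurableSet[ℱ a] A) :
    ∫⁻ ω in A, E.quietDensity n D a b ω * {ω | E.TxAt x t ω}.indicator 1 ω ∂μ =
      ∫⁻ ω in A, E.quietDensity n D a b ω * ENNReal.ofReal (E.startProb n x t ω) ∂μ := by
  rw [h.setLIntegral_quietDensity hn D (hat.trans (Nat.le_succ t)) htb hA
    (f := {ω | E.TxAt x t ω}.indicator 1)
    (measurable_const.indicator (h.measurableSet_txAt x t)),
    h.setLIntegral_quietDensity hn D hat htb.le hA (h.measurable_startProb x t).ennreal_ofReal]
  have := h.setLIntegral_quietDensity_succ hn D {x} (Finset.disjoint_singleton_left.mpr hx) hat hA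
    (f := 1) measurable_const
  simpa using this

/-- Under the tilted measure the nodes of `T` transmit with their usual conditional probabilities,
so by linearity the mean load is the mean of the sum of weighted probabilities. -/
theorem setLIntegral_quietDensity_load_le (h : IsLocalBcast μ ℱ n E) (hn : 2 ≤ n) {D T : Finset V}
    (hDT : Disjoint T D) {g : V → ℝ≥0∞} {a b : ℕ} {A : Set Ω}
    (hA : MeasurableSet[ℱ a] A) {c : ℝ≥0∞}
    (hc : ∀ ω ∈ A, ∑ t ∈ Finset.Ico a b, ∑ x ∈ T, g x * ENNReal.ofReal (E.startProb n x t ω) ≤ c) :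
    ∫⁻ ω in A, E.quietDensity n D a b ω * E.load T g a b ω ∂μ ≤
      c * ∫⁻ ω in A, E.quietDensity n D a b ω ∂μ := by
  have hAm := ℱ.le _ _ hA
  have hNm := (h.measurable_quietDensity D a b).mono (ℱ.le b) le_rfl
  have hpm : ∀ i : ℕ × V, Measurable fun ω => ENNReal.ofReal (E.startProb n i.2 i.1 ω) :=
    fun i => ((h.measurable_startProb i.2 i.1).mono (ℱ.le i.1) le_rfl).ennreal_ofReal
  have htm : ∀ i : ℕ × V, Measurable ({ω | E.TxAt i.2 i.1 ω}.indicator (1 : Ω → ℝ≥0∞)) := fun i =>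
    measurable_const.indicator (ℱ.le _ _ (h.measurableSet_txAt i.2 i.1))
  have e1 := lintegral_mul_sum_mul (ν := μ.restrict A) (Finset.Ico a b ×ˢ T) hNm (fun i => g i.2)
    htm
  have e2 := lintegral_mul_sum_mul (ν := μ.restrict A) (Finset.Ico a b ×ˢ T) hNm (fun i => g i.2)
    hpm
  have e3 : ∀ ω, E.load T g a b ω = ∑ i ∈ Finset.Ico a b ×ˢ T,
      g i.2 * {ω | E.TxAt i.2 i.1 ω}.indicator 1 ω := fun ω => by
    rw [Finset.sum_product]; rfl
  have e4 : ∀ ω, ∑ i ∈ Finset.Ico a b ×ˢ T, g i.2 * ENNReal.ofReal (E.startProb n i.2 i.1 ω) =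
      ∑ t ∈ Finset.Ico a b, ∑ x ∈ T, g x * ENNReal.ofReal (E.startProb n x t ω) := fun ω => by
    rw [Finset.sum_product]
  have e5 : ∀ i ∈ Finset.Ico a b ×ˢ T, g i.2 *
        ∫⁻ ω in A, E.quietDensity n D a b ω * {ω | E.TxAt i.2 i.1 ω}.indicator 1 ω ∂μ =
      g i.2 * ∫⁻ ω in A, E.quietDensity n D a b ω * ENNReal.ofReal (E.startProb n i.2 i.1 ω) ∂μ :=
    fun i hi => by
      rw [Finset.mem_product, Finset.mem_Ico] at hi
      rw [h.setLIntegral_quietDensity_txAt hn D (Finset.disjoint_left.mp hDT hi.2) hi.1.1 hi.1.2 hA]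
  rw [lintegral_congr fun ω => by rw [e3 ω], e1, Finset.sum_congr rfl e5, ← e2, mul_comm c,
    ← lintegral_mul_const _ hNm]
  refine setLIntegral_mono' hAm fun ω hω => mul_le_mul_right ?_ _
  rw [e4]
  exact hc ω hω

/-- With positive probability the nodes of `D` remain silent in an interval and the nodes of `T`
transmit not much more than expected. -/
theorem le_measure_quiet_inter (h : IsLocalBcast μ ℱ n E) (hn : 2 ≤ n) {D T : Finset V}
    (hDT : Disjoint T D) {g : V → ℝ≥0∞} {a b : ℕ} (hab : a ≤ b) {A : Set Ω}
    (hA : MeasurableSet[ℱ a] A) {q : ℝ} {c θ : ℝ≥0∞} (hcθ : 2 * c ≤ θ) (hθ0 : θ ≠ 0) (hθ : θ ≠ ⊤)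
    (hq : ∀ ω ∈ A, ∑ t ∈ Finset.Ico a b, ∑ x ∈ D, E.startProb n x t ω ≤ q)
    (hc : ∀ ω ∈ A, ∑ t ∈ Finset.Ico a b, ∑ x ∈ T, g x * ENNReal.ofReal (E.startProb n x t ω) ≤ c) :
    ENNReal.ofReal (Real.exp (-(2 * q))) / 2 * μ A ≤
      μ (A ∩ (E.quiet D a b ∩ {ω | E.load T g a b ω ≤ θ})) := by
  have hAm := ℱ.le _ _ hA
  have hNm := (h.measurable_quietDensity D a b).mono (ℱ.le b) le_rfl
  have hLm := (h.measurable_load T g a b).mono (ℱ.le b) le_rfl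
  have h1 : ∫⁻ ω in A, E.quietDensity n D a b ω ∂μ = μ A := by
    have := h.setLIntegral_quietDensity hn D le_rfl hab hA (f := 1) measurable_const
    simpa [quietDensity_self] using this
  -- Markov's inequality under the tilted measure: the load is at most twice its mean on half of the
  -- mass.
  have h6 := half_lintegral_le hNm hLm hcθ hθ0 hθ (by rw [h1]; exact measure_ne_top μ A)
    (h.setLIntegral_quietDensity_load_le hn hDT hA hc)
  rw [h1] at h6
  have hLs : MeasurableSet {ω | E.load T g a b ω ≤ θ} := measurableSet_le hLm measurable_const
  have hQm := ℱ.le _ _ (h.measurableSet_quiet D a b)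
  have h7 : ∫⁻ ω in A, E.quietDensity n D a b ω * {ω | E.load T g a b ω ≤ θ}.indicator 1 ω ∂μ ≤
      ENNReal.ofReal (Real.exp (2 * q)) *
        μ (A ∩ (E.quiet D a b ∩ {ω | E.load T g a b ω ≤ θ})) := by
    rw [Set.inter_comm A, ← Measure.restrict_apply (hQm.inter hLs),
      ← lintegral_indicator_one (hQm.inter hLs),
      ← lintegral_const_mul _ (measurable_one.indicator (hQm.inter hLs))]
    refine setLIntegral_mono' hAm fun ω hω => ?_
    rw [Set.inter_indicator_one, Pi.mul_apply, ← mul_assoc]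
    exact mul_le_mul_left (quietDensity_le hn h.len_pos D a b (hq ω hω)) _
  calc ENNReal.ofReal (Real.exp (-(2 * q))) / 2 * μ A
      = ENNReal.ofReal (Real.exp (-(2 * q))) * (μ A / 2) := by
        simp only [ENNReal.div_eq_inv_mul]; ring
    _ ≤ ENNReal.ofReal (Real.exp (-(2 * q))) * (ENNReal.ofReal (Real.exp (2 * q)) *
        μ (A ∩ (E.quiet D a b ∩ {ω | E.load T g a b ω ≤ θ}))) := mul_le_mul_right (h6.trans h7) _
    _ = _ := by
        rw [← mul_assoc, ← ENNReal.ofReal_mul (Real.exp_pos _).le, ← Real.exp_add]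
        simp

/-- With positive conditional probability, `w` is the only node of `D` that transmits in a round
starting at tick `t`, and the nodes of `T` transmit not much more than expected. -/
theorem le_measure_single_inter [DecidableEq V] (h : IsLocalBcast μ ℱ n E) (hn : 2 ≤ n)
    {D T : Finset V} (hDT : Disjoint T D) {g : V → ℝ≥0∞} {t : ℕ} {w : V} (hw : w ∈ D) {A : Set Ω}
    (hA : MeasurableSet[ℱ t] A) {q : ℝ} {c θ : ℝ≥0∞} (hcθ : 2 * c ≤ θ) (hθ0 : θ ≠ 0) (hθ : θ ≠ ⊤)
    (hq : ∀ ω ∈ A, ∑ x ∈ D, E.startProb n x t ω ≤ q)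
    (hc : ∀ ω ∈ A, ∑ x ∈ T, g x * ENNReal.ofReal (E.startProb n x t ω) ≤ c) :
    ENNReal.ofReal (Real.exp (-(2 * q))) / 2 * ∫⁻ ω in A, ENNReal.ofReal (E.startProb n w t ω) ∂μ ≤
      μ (A ∩ ({ω | (∀ x ∈ ({w} : Finset V), E.TxAt x t ω) ∧ ∀ x ∈ D.erase w, ¬ E.TxAt x t ω} ∩
        {ω | E.load T g t (t + 1) ω ≤ θ})) := by
  have hAm := ℱ.le _ _ hA
  have hLm := (h.measurable_load T g t (t + 1)).mono (ℱ.le _) le_rfl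
  have hpm : ∀ x, Measurable (E.startProb n x t) :=
    fun x => (h.measurable_startProb x t).mono (ℱ.le t) le_rfl
  set B := {ω | (∀ x ∈ ({w} : Finset V), E.TxAt x t ω) ∧ ∀ x ∈ D.erase w, ¬ E.TxAt x t ω} with hB
  have hBm : MeasurableSet B := ℱ.le _ _ (h.measurableSet_txAt_inter t _ _)
  set ψ : Ω → ℝ≥0∞ := fun ω => ENNReal.ofReal (E.startProb n w t ω) *
    E.quietProb n (D.erase w) t ω with hψ
  have hψm : Measurable ψ := (hpm w).ennreal_ofReal.mul
    ((h.measurable_quietProb (D.erase w) t).mono (ℱ.le t) le_rfl)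
  have h1 : μ (A ∩ B) = ∫⁻ ω in A, ψ ω ∂μ := by
    rw [hB, h.measure_inter_txAt_inter hn hA {w} (D.erase w) (by simp)]
    simp [hψ, quietProb]
  -- Conditioning on the lone transmission of w does not affect the coins of `T` at the same tick.
  have hLB : ∫⁻ ω in A ∩ B, E.load T g t (t + 1) ω ∂μ ≤ c * μ (A ∩ B) := by
    have h2 : ∀ x ∈ T, ∫⁻ ω in A ∩ B, {ω | E.TxAt x t ω}.indicator 1 ω ∂μ =
        ∫⁻ ω in A, ψ ω * ENNReal.ofReal (E.startProb n x t ω) ∂μ := by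
      intro x hx
      have hxD := Finset.disjoint_left.mp hDT hx
      have hxw : x ≠ w := fun e => hxD (e ▸ hw)
      have hxm := ℱ.le _ _ (h.measurableSet_txAt x t)
      rw [lintegral_indicator_one hxm, Measure.restrict_apply hxm]
      have := h.measure_inter_txAt_inter hn hA {x, w} (D.erase w) (by
        rw [Finset.disjoint_insert_left]
        exact ⟨fun h' => hxD (Finset.mem_of_mem_erase h'), by simp⟩)
      simp only [Finset.prod_pair hxw] at this
      refine Eq.trans (congrArg μ ?_) (this.trans (lintegral_congr fun ω => ?_))
      · ext ω
        simp only [hB, Set.mem_inter_iff, Set.mem_ofPred_eq, Finset.mem_singleton, forall_eq,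
          Finset.mem_insert, forall_eq_or_imp]
        tauto
      · simp only [hψ, quietProb]; ring
    simp only [load, Nat.Ico_succ_singleton, Finset.sum_singleton]
    rw [lintegral_finsetSum _ fun x _ => (measurable_one.indicator
      (ℱ.le _ _ (h.measurableSet_txAt x t))).const_mul _]
    calc _ = ∑ x ∈ T, g x * ∫⁻ ω in A, ψ ω * ENNReal.ofReal (E.startProb n x t ω) ∂μ := by
          refine Finset.sum_congr rfl fun x hx => ?_
          rw [lintegral_const_mul _ (measurable_one.indicator
            (ℱ.le _ _ (h.measurableSet_txAt x t))), h2 x hx]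
      _ = ∫⁻ ω in A, ψ ω * ∑ x ∈ T, g x * ENNReal.ofReal (E.startProb n x t ω) ∂μ := by
          exact (lintegral_mul_sum_mul _ hψm _ fun x => (hpm x).ennreal_ofReal).symm
      _ ≤ ∫⁻ ω in A, ψ ω * c ∂μ :=
          setLIntegral_mono' hAm fun ω hω => mul_le_mul_right (hc ω hω) _
      _ = _ := by rw [lintegral_mul_const _ hψm, h1, mul_comm]
  have hLs : MeasurableSet {ω | E.load T g t (t + 1) ω ≤ θ} := measurableSet_le hLm measurable_const
  have h5 : μ (A ∩ B) / 2 ≤ μ (A ∩ B ∩ {ω | E.load T g t (t + 1) ω ≤ θ}) := by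
    have h6 := half_lintegral_le (ν := μ.restrict (A ∩ B)) (N := 1) measurable_one hLm hcθ hθ0 hθ
      (by simp) (by simpa using hLB)
    have h8 : ∫⁻ ω in A ∩ B, (1 : Ω → ℝ≥0∞) ω *
        {ω | E.load T g t (t + 1) ω ≤ θ}.indicator 1 ω ∂μ =
        μ (A ∩ B ∩ {ω | E.load T g t (t + 1) ω ≤ θ}) := by
      simp only [Pi.one_apply, one_mul]
      rw [lintegral_indicator_one hLs, Measure.restrict_apply hLs, Set.inter_comm]
    rw [h8] at h6
    simpa using h6
  rw [← Set.inter_assoc]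
  refine le_trans ?_ h5
  rw [h1, ENNReal.div_eq_inv_mul, ENNReal.div_eq_inv_mul, mul_assoc]
  refine mul_le_mul_right ?_ _
  rw [← lintegral_const_mul _ (hpm w).ennreal_ofReal]
  refine setLIntegral_mono' hAm fun ω hω => ?_
  rw [mul_comm]
  refine mul_le_mul_right (le_trans (ENNReal.ofReal_le_ofReal (Real.exp_le_exp.mpr ?_))
    (exp_le_quietProb hn h.len_pos (D.erase w) t ω)) _
  have := Finset.sum_le_sum_of_subset_of_nonneg (Finset.erase_subset w D)
    (fun x _ _ => startProb_nonneg (E := E) (v := x) (t := t) (ω := ω) hn)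
  have := hq ω hω
  linarith

end IsLocalBcast

/-! ### Successful transmissions in a crowded but bounded vicinity -/

namespace Trace

variable {V Ω : Type*} {E : Trace V Ω} {n l t t' : ℕ} {ω : Ω} {v : V}

theorem curProb_eq_zero_of_stoppedBy (hl : E.LengthBound l) (hs : E.StoppedBy v t ω) :
    E.curProb n v t ω = 0 := by
  obtain ⟨i, a, hw, hi, h⟩ := hs
  have : i + 1 ≤ (t - a) / E.len v := by
    rw [Nat.le_div_iff_mul_le (hl.pos v)]; omega
  rw [curProb_eq (hl.pos v) hw (by omega), prob_eq_zero ⟨i, this, h⟩]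

theorem startProb_eq_zero_of_stoppedBy (hn : 2 ≤ n) (hl : E.LengthBound l)
    (hs : E.StoppedBy v t ω) : E.startProb n v t ω = 0 := by
  refine le_antisymm ?_ (startProb_nonneg hn)
  rw [← curProb_eq_zero_of_stoppedBy (n := n) hl hs]
  exact startProb_le_curProb hn (hl.pos v)

/-- A round that overlaps with the given one started less than l ticks before it. Thus silence and
load in terms of starting ticks control all interference. -/
theorem exists_txAt_of_mem_concurrent (hl : E.LengthBound l) {i s : ℕ} {x : V}
    (hs : E.Starts v i s ω) (hts : t + l ≤ s + 1) (hst : s + E.len v ≤ t')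
    (hx : x ∈ E.concurrent v i ω) : ∃ s' ∈ Finset.Ico t t', E.TxAt x s' ω := by
  obtain ⟨-, t₀, hv, j, hxj, htx⟩ := hx
  obtain ⟨a, hw, ha⟩ := hs.exists_wake
  obtain ⟨b, hb, h1, h2⟩ := hxj.exists_wake
  rw [inRound_iff hw, add_mul] at hv
  rw [add_mul] at h2
  have := hl.le x
  exact ⟨b + j * E.len x, Finset.mem_Ico.mpr ⟨by omega, by omega⟩, j,
    (starts_iff hb j).mpr rfl, htx⟩

theorem load_mono {T : Finset V} {g g' : V → ℝ≥0∞} (h : ∀ x ∈ T, g x ≤ g' x) :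
    E.load T g t t' ω ≤ E.load T g' t t' ω :=
  Finset.sum_le_sum fun _ _ => Finset.sum_le_sum fun x hx => mul_le_mul_left (h x hx) _

variable [Fintype V] {G : Network V} {M : RadioParams}

/-- An interfering node counts once in the interference and at least once in the load. -/
theorem ofReal_interferenceOutside_le [inst : DecidableEq V] (hl : E.LengthBound l)
    {D : Finset V} {i s : ℕ} (hs : E.Starts v i s ω) (hts : t + l ≤ s + 1) (hst : s + E.len v ≤ t') :
    ENNReal.ofReal (E.interferenceOutside G M D v i ω) ≤
      E.load (Finset.univ \ D) (fun x => ENNReal.ofReal (G.signal M x v)) t t' ω := by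
  obtain rfl : inst = fun a b => Classical.propDecidable (a = b) := Subsingleton.elim _ _
  classical
  rw [interferenceOutside, ENNReal.ofReal_sum_of_nonneg fun x hx =>
    (G.signal_pos (M := M) (Finset.mem_filter.mp hx).2.1.1).le, load, Finset.sum_comm]
  calc _ ≤ ∑ x ∈ Finset.univ.filter (fun w => w ∈ E.concurrent v i ω ∧ w ∉ D),
        ∑ s' ∈ Finset.Ico t t',
          ENNReal.ofReal (G.signal M x v) * {ω | E.TxAt x s' ω}.indicator 1 ω := by
        refine Finset.sum_le_sum fun x hx => ?_
        obtain ⟨s', hs', htx⟩ := exists_txAt_of_mem_concurrent hl hs hts hst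
          (Finset.mem_filter.mp hx).2.1
        refine le_trans ?_ (Finset.single_le_sum (fun _ _ => zero_le) hs')
        rw [Set.indicator_of_mem (by exact htx), Pi.one_apply, mul_one]
    _ ≤ _ := Finset.sum_le_sum_of_subset fun x hx => by
        simpa using (Finset.mem_filter.mp hx).2.2

/-- A node whose surroundings are quiet during its transmission stops after it. -/
theorem stoppedBy_of_quiet [DecidableEq V] (hl : E.LengthBound l) {ρc Ic Iack θ : ℝ}
    (hsc : E.SuccClear G M ρc Ic) (hack : E.AckSpec G M Iack) {D₃ : Finset V} {g : V → ℝ≥0∞}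
    {w : V} (hDc : G.inBall M w (ρc * M.R) ⊆ D₃)
    (hg : ∀ x ∉ D₃, ENNReal.ofReal (G.signal M x w) ≤ g x) (hθ : 0 ≤ θ) (hI : 3 * θ ≤ Ic)
    (hIa : 3 * θ ≤ Iack) {s : ℕ} (hts : t + l ≤ s) (hst : s < t + 2 * l) (htx : E.TxAt w s ω)
    (hne : ∀ x ∈ D₃.erase w, ¬ E.TxAt x s ω) (hq₁ : ω ∈ E.quiet D₃ t s)
    (hq₂ : ω ∈ E.quiet D₃ (s + 1) (t + 3 * l))
    (h₁ : E.load (Finset.univ \ D₃) g t s ω ≤ ENNReal.ofReal θ)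
    (h₂ : E.load (Finset.univ \ D₃) g s (s + 1) ω ≤ ENNReal.ofReal θ)
    (h₃ : E.load (Finset.univ \ D₃) g (s + 1) (t + 3 * l) ω ≤ ENNReal.ofReal θ) :
    E.StoppedBy w (t + 3 * l) ω := by
  obtain ⟨i, hs, htx⟩ := htx
  have hle := hl.le w
  have hc : ∀ x ∈ E.concurrent w i ω, x ∉ D₃ := by
    intro x hx hxD
    obtain ⟨s', hs', htx'⟩ := exists_txAt_of_mem_concurrent (t := t) (t' := t + 3 * l) hl hs
      (by omega) (by omega) hx
    rw [Finset.mem_Ico] at hs'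
    rcases lt_trichotomy s' s with h | h | h
    · exact hq₁ s' (Finset.mem_Ico.mpr ⟨hs'.1, h⟩) x hxD htx'
    · exact hne x (Finset.mem_erase.mpr ⟨hx.1, hxD⟩) (h ▸ htx')
    · exact hq₂ s' (Finset.mem_Ico.mpr ⟨h, hs'.2⟩) x hxD htx'
  have hI' : E.interference G M w i ω ≤ 3 * θ := by
    have e : E.interference G M w i ω = E.interferenceOutside G M D₃ w i ω := by
      classical
      rw [interference, interferenceOutside, interferenceOutside]
      congr 1
      ext x
      simp only [Finset.mem_filter, Finset.notMem_empty, not_false_eq_true, and_true]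
      exact ⟨fun h => ⟨h.1, h.2, hc x h.2⟩, fun h => ⟨h.1, h.2.1⟩⟩
    rw [e, ← ENNReal.ofReal_le_ofReal_iff (by linarith)]
    have h4 := ofReal_interferenceOutside_le (G := G) (M := M) (D := D₃) (t := t)
      (t' := t + 3 * l) hl hs (by omega) (by omega)
    refine h4.trans ((load_mono (g' := g) fun x hx => hg x (by simpa using hx)).trans ?_)
    -- The load is split into the ticks before s, the tick s itself and those after it, each with
    -- its own share θ, because the three events are obtained by separate conditionings.
    have e2 : E.load (Finset.univ \ D₃) g t (t + 3 * l) ω =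
        E.load (Finset.univ \ D₃) g t s ω + E.load (Finset.univ \ D₃) g s (s + 1) ω +
          E.load (Finset.univ \ D₃) g (s + 1) (t + 3 * l) ω := by
      unfold load
      rw [Finset.sum_Ico_consecutive _ (by omega) (by omega),
        Finset.sum_Ico_consecutive _ (by omega) (by omega)]
    rw [e2, show 3 * θ = θ + θ + θ by ring, ENNReal.ofReal_add (by linarith) hθ,
      ENNReal.ofReal_add hθ hθ]
    gcongr
  have hmd : E.MassDelivers G M w i ω :=
    ⟨htx, hsc w i ω htx (fun x hx h => hc x hx (hDc h)) (hI'.trans hI)⟩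
  have ha := hack.positive w i ω hmd (hI'.trans hIa)
  obtain ⟨a, hw, has⟩ := hs.exists_wake
  exact ⟨i, a, hw, by rw [add_mul]; omega, htx, ha⟩

end Trace

namespace IsLocalBcast

variable {V Ω : Type*} [Fintype V] [mΩ : MeasurableSpace Ω] {μ : Measure Ω}
  [IsProbabilityMeasure μ] {ℱ : Filtration ℕ mΩ} {n l : ℕ} {E : Trace V Ω}
  {G : Network V} {M : RadioParams}

/-- If the contention in `D₁` is not small, and the contention in `D₃` and the expected interference
from outside are bounded, then with positive probability a node of `D₁` stops. -/
theorem le_measure_inter_stopped [DecidableEq V] (h : IsLocalBcast μ ℱ n E) (hn : 2 ≤ n)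
    (hl : E.LengthBound l) {ρc Ic Iack θ : ℝ} (hsc : E.SuccClear G M ρc Ic)
    (hack : E.AckSpec G M Iack) {D₁ D₃ : Finset V} (hD : D₁ ⊆ D₃) {g : V → ℝ≥0∞}
    (hDc : ∀ w ∈ D₁, G.inBall M w (ρc * M.R) ⊆ D₃)
    (hg : ∀ w ∈ D₁, ∀ x ∉ D₃, ENNReal.ofReal (G.signal M x w) ≤ g x)
    (hθ : 0 < θ) (hI : 3 * θ ≤ Ic) (hIa : 3 * θ ≤ Iack) {t : ℕ} {A : Set Ω}
    (hA : MeasurableSet[ℱ t] A) {q η : ℝ} (hη : 0 ≤ η) (hη1 : η ≤ 1) (hq0 : 0 ≤ q)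
    (hq : ∀ ω ∈ A, ∑ s ∈ Finset.Ico t (t + 3 * l), ∑ x ∈ D₃, E.startProb n x s ω ≤ q)
    (hc : ∀ ω ∈ A, ∑ s ∈ Finset.Ico t (t + 3 * l), ∑ x ∈ Finset.univ \ D₃,
      g x * ENNReal.ofReal (E.startProb n x s ω) ≤ ENNReal.ofReal (θ / 2))
    (hηA : ∀ ω ∈ A, η ≤ E.contention n D₁ t ω) :
    ENNReal.ofReal (Real.exp (-(6 * q)) * η / 256) * μ A ≤
      μ (A ∩ {ω | ∃ w ∈ D₁, ¬ E.StoppedBy w t ω ∧ E.StoppedBy w (t + 16 * l) ω}) := by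
  set T := Finset.univ \ D₃ with hT
  have hDT : Disjoint T D₃ := Finset.sdiff_disjoint
  set P := {ω | ∃ w ∈ D₁, ¬ E.StoppedBy w t ω ∧ E.StoppedBy w (t + 16 * l) ω} with hP
  have hAm := ℱ.le _ _ hA
  have hPm : MeasurableSet P := by
    have : P = ⋃ w ∈ D₁, {ω | E.StoppedBy w t ω}ᶜ ∩ {ω | E.StoppedBy w (t + 16 * l) ω} := by
      ext ω
      simp only [hP, Set.mem_ofPred_eq, Set.mem_iUnion, Set.mem_inter_iff, Set.mem_compl_iff,
        exists_prop]
    rw [this]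
    exact Finset.measurableSet_biUnion _ fun w _ =>
      (ℱ.le _ _ (h.measurableSet_stoppedBy w t)).compl.inter
        (ℱ.le _ _ (h.measurableSet_stoppedBy w _))
  have hθ2 : 2 * ENNReal.ofReal (θ / 2) ≤ ENNReal.ofReal θ := by
    rw [← ENNReal.ofReal_ofNat 2, ← ENNReal.ofReal_mul (by norm_num)]
    exact ENNReal.ofReal_le_ofReal (by linarith)
  have hθ0 : ENNReal.ofReal θ ≠ 0 := by simpa using hθ
  set κ := ENNReal.ofReal (Real.exp (-(2 * q))) / 2 with hκ
  have hqsub : ∀ ω ∈ A, ∀ I ⊆ Finset.Ico t (t + 3 * l),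
      ∑ s ∈ I, ∑ x ∈ D₃, E.startProb n x s ω ≤ q := fun ω hω I hI =>
    (Finset.sum_le_sum_of_subset_of_nonneg hI fun _ _ _ => Finset.sum_nonneg fun _ _ =>
      startProb_nonneg hn).trans (hq ω hω)
  have hcsub : ∀ ω ∈ A, ∀ I ⊆ Finset.Ico t (t + 3 * l), ∑ s ∈ I, ∑ x ∈ T,
      g x * ENNReal.ofReal (E.startProb n x s ω) ≤ ENNReal.ofReal (θ / 2) := fun ω hω I hI =>
    (Finset.sum_le_sum_of_subset hI).trans (hc ω hω)
  -- the event that the beginning of the interval is quiet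
  set A₁ : ℕ → Set Ω := fun s =>
    A ∩ (E.quiet D₃ t s ∩ {ω | E.load T g t s ω ≤ ENNReal.ofReal θ}) with hA₁
  have hA₁m : ∀ s, t ≤ s → MeasurableSet[ℱ s] (A₁ s) := fun s hs =>
    (ℱ.mono hs _ hA).inter ((h.measurableSet_quiet D₃ t s).inter
      (measurableSet_le (h.measurable_load T g t s) measurable_const))
  set A₂ : V → ℕ → Set Ω := fun w s => A₁ s \ {ω | E.StoppedBy w s ω} with hA₂
  have hA₂m : ∀ w s, t ≤ s → MeasurableSet[ℱ s] (A₂ w s) := fun w s hs =>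
    (hA₁m s hs).diff (h.measurableSet_stoppedBy w s)
  set A₃ : V → ℕ → Set Ω := fun w s => A₂ w s ∩
    ({ω | (∀ x ∈ ({w} : Finset V), E.TxAt x s ω) ∧ ∀ x ∈ D₃.erase w, ¬ E.TxAt x s ω} ∩
        {ω | E.load T g s (s + 1) ω ≤ ENNReal.ofReal θ}) with hA₃
  have hA₃m : ∀ w s, t ≤ s → MeasurableSet[ℱ (s + 1)] (A₃ w s) := fun w s hs =>
    (ℱ.mono (Nat.le_succ s) _ (hA₂m w s hs)).inter ((h.measurableSet_txAt_inter s _ _).inter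
      (measurableSet_le (h.measurable_load T g s (s + 1)) measurable_const))
  set A₄ : V → ℕ → Set Ω := fun w s => A₃ w s ∩ (E.quiet D₃ (s + 1) (t + 3 * l) ∩
    {ω | E.load T g (s + 1) (t + 3 * l) ω ≤ ENNReal.ofReal θ}) with hA₄
  set I := Finset.Ico (t + l) (t + 2 * l) with hIdef
  have hl0 : ∀ w : V, 0 < l := fun w => hl.l_pos w
  -- One factor κ pays for the others being silent at tick s, another for the silence afterwards.
  -- `A₁` to `A₄` add the requirements in chronological order.
  have hstep : ∀ w ∈ D₁, ∀ s ∈ I,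
      κ * (κ * ∫⁻ ω in A₂ w s, ENNReal.ofReal (E.startProb n w s ω) ∂μ) ≤ μ (A₄ w s) := by
    intro w hw s hs
    rw [hIdef, Finset.mem_Ico] at hs
    have hl0 := hl0 w
    have hsub : A₂ w s ⊆ A := fun ω hω => hω.1.1
    have h1 := h.le_measure_single_inter hn hDT (g := g) (hD hw) (hA₂m w s (by omega)) hθ2 hθ0
      ENNReal.ofReal_ne_top (q := q)
      (fun ω hω => by
        simpa using hqsub ω (hsub hω) {s} (by simp; omega))
      (fun ω hω => by
        simpa using hcsub ω (hsub hω) {s} (by simp; omega))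
    have h2 := h.le_measure_quiet_inter hn hDT (g := g) (a := s + 1) (b := t + 3 * l) (by omega)
      (hA₃m w s (by omega)) hθ2 hθ0 ENNReal.ofReal_ne_top (q := q)
      (fun ω hω => hqsub ω (hsub hω.1) _ (Finset.Ico_subset_Ico (by omega) le_rfl))
      (fun ω hω => hcsub ω (hsub hω.1) _ (Finset.Ico_subset_Ico (by omega) le_rfl))
    exact (mul_le_mul_right h1 _).trans h2
  have hA₄P : ∀ w ∈ D₁, ∀ s ∈ I, A₄ w s ⊆ A ∩ P := by
    rintro w hw s hs ω ⟨⟨⟨⟨hωA, hω1, hω2⟩, hωs⟩, ⟨hω3, hω4⟩, hω5⟩, hω6, hω7⟩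
    rw [hIdef, Finset.mem_Ico] at hs
    refine ⟨hωA, w, hw, fun h' => hωs (h'.mono (by omega)), ?_⟩
    exact (stoppedBy_of_quiet hl hsc hack (hDc w hw) (hg w hw) hθ.le hI hIa hs.1 hs.2
      (hω3 w (by simp)) hω4 hω1 hω6 hω2 hω5 hω7).mono (by omega)
  -- The transmission of w at tick s is the first one of `D₃` since t and the only one at s, so it
  -- determines the pair.
  have hdisj : Set.PairwiseDisjoint (↑(D₁ ×ˢ I)) fun i : V × ℕ => A₄ i.1 i.2 := by
    have key : ∀ w ∈ D₁, ∀ s ∈ I, ∀ w' s', s < s' → Disjoint (A₄ w s) (A₄ w' s') := by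
      intro w hw s hs w' s' hss
      rw [hIdef, Finset.mem_Ico] at hs
      refine Set.disjoint_left.mpr fun ω h1 h2 => ?_
      exact h2.1.1.1.2.1 s (Finset.mem_Ico.mpr ⟨by omega, hss⟩) w (hD hw) (h1.1.2.1.1 w (by simp))
    rintro ⟨w, s⟩ h1 ⟨w', s'⟩ h2 hne
    simp only [Finset.coe_product, Set.mem_prod, Finset.mem_coe] at h1 h2
    rcases lt_trichotomy s s' with hss | rfl | hss
    · exact key w h1.1 s h1.2 w' s' hss
    · refine Set.disjoint_left.mpr fun ω h3 h4 => ?_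
      have hww : w ≠ w' := fun e => hne (by rw [e])
      exact h4.1.2.1.2 w (Finset.mem_erase.mpr ⟨hww, hD h1.1⟩) (h3.1.2.1.1 w (by simp))
    · exact (key w' h2.1 s' h2.2 w s hss).symm
  have hA₄m : ∀ i ∈ D₁ ×ˢ I, MeasurableSet (A₄ i.1 i.2) := by
    rintro ⟨w, s⟩ hi
    have hs := (Finset.mem_product.mp hi).2
    rw [hIdef, Finset.mem_Ico] at hs
    exact (ℱ.le _ _ (hA₃m w s (by omega))).inter
      ((ℱ.le _ _ (h.measurableSet_quiet D₃ _ _)).inter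
        (ℱ.le _ _ (measurableSet_le (h.measurable_load T g _ _) measurable_const)))
  -- Where nobody in `D₁` stops, the running nodes keep their probabilities up to the factor 16, so
  -- the probabilities of the rounds starting in `I` still add up to η/16.
  set F := A₁ (t + 2 * l) \ P with hF
  have hFm : MeasurableSet F := (ℱ.le _ _ (hA₁m _ (by omega))).diff hPm
  have hFsum : ∀ ω ∈ F, ENNReal.ofReal (η / 16) ≤
      ∑ i ∈ D₁ ×ˢ I, ENNReal.ofReal (E.startProb n i.1 i.2 ω) := by
    intro ω hω
    rw [← ENNReal.ofReal_sum_of_nonneg fun _ _ => startProb_nonneg hn, Finset.sum_product]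
    refine ENNReal.ofReal_le_ofReal ?_
    refine (div_le_div_of_nonneg_right (hηA ω hω.1.1) (by norm_num)).trans ?_
    rw [contention, Finset.sum_div]
    refine Finset.sum_le_sum fun w hw => ?_
    by_cases hs : E.StoppedBy w (t + 2 * l) ω
    · have : E.StoppedBy w t ω := by
        by_contra h'
        exact hω.2 ⟨w, hw, h', hs.mono (by omega)⟩
      rw [curProb_eq_zero_of_stoppedBy hl this, zero_div]
      exact Finset.sum_nonneg fun _ _ => startProb_nonneg hn
    · exact curProb_le_sum_startProb hn hl hs
  have hint : ∀ w, ∀ s ∈ I, ∫⁻ ω in F, ENNReal.ofReal (E.startProb n w s ω) ∂μ ≤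
      ∫⁻ ω in A₂ w s, ENNReal.ofReal (E.startProb n w s ω) ∂μ := by
    intro w s hs
    rw [hIdef, Finset.mem_Ico] at hs
    rw [← lintegral_indicator hFm, ← lintegral_indicator (ℱ.le _ _ (hA₂m w s (by omega)))]
    refine lintegral_mono fun ω => ?_
    by_cases hω : ω ∈ F
    · by_cases hst : E.StoppedBy w s ω
      · rw [Set.indicator_of_mem hω, startProb_eq_zero_of_stoppedBy hn hl hst]; simp
      · have : ω ∈ A₂ w s := by
          refine ⟨⟨hω.1.1, fun t' ht' => hω.1.2.1 t' ?_, ?_⟩, hst⟩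
          · rw [Finset.mem_Ico] at ht' ⊢; omega
          · refine le_trans ?_ (Set.mem_ofPred_eq.mp hω.1.2.2)
            exact Finset.sum_le_sum_of_subset (Finset.Ico_subset_Ico le_rfl (by omega))
        rw [Set.indicator_of_mem hω, Set.indicator_of_mem this]
    · rw [Set.indicator_of_notMem hω]; exact zero_le
  have hmain : κ * κ * ENNReal.ofReal (η / 16) * μ F ≤ μ (A ∩ P) := by
    calc κ * κ * ENNReal.ofReal (η / 16) * μ F
        = κ * κ * ∫⁻ _ in F, ENNReal.ofReal (η / 16) ∂μ := by
          rw [setLIntegral_const, mul_assoc]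
      _ ≤ κ * κ * ∫⁻ ω in F, ∑ i ∈ D₁ ×ˢ I, ENNReal.ofReal (E.startProb n i.1 i.2 ω) ∂μ :=
          mul_le_mul_right (setLIntegral_mono' hFm hFsum) _
      _ = ∑ i ∈ D₁ ×ˢ I, κ * (κ * ∫⁻ ω in F, ENNReal.ofReal (E.startProb n i.1 i.2 ω) ∂μ) := by
          rw [lintegral_finsetSum _ fun i _ =>
            ((h.measurable_startProb i.1 i.2).mono (ℱ.le _) le_rfl).ennreal_ofReal, Finset.mul_sum]
          exact Finset.sum_congr rfl fun _ _ => mul_assoc _ _ _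
      _ ≤ ∑ i ∈ D₁ ×ˢ I, μ (A₄ i.1 i.2) := by
          refine Finset.sum_le_sum fun i hi => ?_
          obtain ⟨hw, hs⟩ := Finset.mem_product.mp hi
          exact (mul_le_mul_right (mul_le_mul_right (hint i.1 i.2 hs) _) _).trans
            (hstep i.1 hw i.2 hs)
      _ = μ (⋃ i ∈ D₁ ×ˢ I, A₄ i.1 i.2) := (measure_biUnion_finset hdisj hA₄m).symm
      _ ≤ μ (A ∩ P) := measure_mono (Set.iUnion₂_subset fun i hi =>
          hA₄P i.1 (Finset.mem_product.mp hi).1 i.2 (Finset.mem_product.mp hi).2)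
  have hA₁le : κ * μ A ≤ μ (A₁ (t + 2 * l)) :=
    h.le_measure_quiet_inter hn hDT (g := g) (by omega) hA hθ2 hθ0 ENNReal.ofReal_ne_top
      (fun ω hω => hqsub ω hω _ (Finset.Ico_subset_Ico le_rfl (by omega)))
      (fun ω hω => hcsub ω hω _ (Finset.Ico_subset_Ico le_rfl (by omega)))
  -- A third factor κ gives silence up to t + 2 l; the part outside `F` already lies in the desired
  -- event.
  have hFle : κ * μ A ≤ μ F + μ (A ∩ P) := by
    refine hA₁le.trans ?_
    rw [← measure_inter_add_sdiff (A₁ (t + 2 * l)) hPm, add_comm]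
    exact add_le_add le_rfl (measure_mono (Set.inter_subset_inter_left _ Set.inter_subset_left))
  -- conclusion in terms of real numbers
  have hκr : κ = ENNReal.ofReal (Real.exp (-(2 * q)) / 2) := by
    rw [hκ, ENNReal.ofReal_div_of_pos (by norm_num)]; simp
  have hexp := Real.exp_pos (-(2 * q))
  have hexp1 : Real.exp (-(2 * q)) ≤ 1 := Real.exp_le_one_iff.mpr (by linarith)
  have hreal : ∀ S : Set Ω, μ S = ENNReal.ofReal (μ.real S) := fun S =>
    (ENNReal.ofReal_toReal (measure_ne_top μ S)).symm
  rw [hκr, hreal A, hreal F, hreal (A ∩ P), ← ENNReal.ofReal_mul (by positivity),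
    ← ENNReal.ofReal_add measureReal_nonneg measureReal_nonneg,
    ENNReal.ofReal_le_ofReal_iff (add_nonneg measureReal_nonneg measureReal_nonneg)] at hFle
  rw [hκr, hreal F, hreal (A ∩ P), ← ENNReal.ofReal_mul (by positivity),
    ← ENNReal.ofReal_mul (by positivity), ← ENNReal.ofReal_mul (by positivity),
    ENNReal.ofReal_le_ofReal_iff measureReal_nonneg] at hmain
  rw [hreal A, hreal (A ∩ P), ← ENNReal.ofReal_mul (by positivity),
    ENNReal.ofReal_le_ofReal_iff measureReal_nonneg]
  have e6 : Real.exp (-(6 * q)) = Real.exp (-(2 * q)) ^ 3 := by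
    rw [← Real.exp_nat_mul]; congr 1; push_cast; ring
  rw [e6]
  generalize Real.exp (-(2 * q)) = k at *
  have hp : 0 ≤ μ.real (A ∩ P) := measureReal_nonneg
  have hc0 : 0 ≤ k / 2 * (k / 2) * (η / 16) := by positivity
  have hc1 : k / 2 * (k / 2) * (η / 16) ≤ 1 := by
    have : k / 2 * (k / 2) ≤ 1 := by nlinarith
    nlinarith [mul_nonneg hexp.le hexp.le]
  -- Eliminating `F` gives κ³ (η/16) μ(A) ≤ 2 μ(A ∩ P), and 8 · 16 · 2 = 256.
  nlinarith [mul_le_mul_of_nonneg_left hFle hc0, mul_le_of_le_one_left hp hc1]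

end IsLocalBcast

/-! ### Idle channels at low contention -/

namespace Trace

variable {V Ω : Type*} {E : Trace V Ω} {n l t t' : ℕ} {ω : Ω} {v : V}

open scoped Classical in
/-- The contention that is due to nodes of `D` starting the algorithm between `t` and `t'`. -/
noncomputable def wokenMass (E : Trace V Ω) (n : ℕ) (D : Finset V) (t t' : ℕ) (ω : Ω) : ℝ :=
  ∑ x ∈ D, if E.WokenBetween x t t' ω then 1 / (2 * (n : ℝ)) else 0

/-- Unlike in `contention_le`, only the nodes that do start are charged. A fixed additive 1/2 would
be useless where the contention has to remain small. -/
theorem contention_le_of_wokenMass (hn : 2 ≤ n) (hl : E.LengthBound l) (D : Finset V) {m s : ℕ}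
    (hts : t ≤ s) (hst : s ≤ t + m * l) :
    E.contention n D s ω ≤
      4 ^ m * (E.contention n D t ω + E.wokenMass n D t (t + m * l) ω) := by
  classical
  rw [contention, contention, wokenMass, ← Finset.sum_add_distrib, Finset.mul_sum]
  refine Finset.sum_le_sum fun x _ => (curProb_le hn hl hts hst).trans ?_
  refine mul_le_mul_of_nonneg_left ((add_le_add_iff_left _).mpr ?_) (by positivity)
  by_cases h1 : E.WokenBetween x t s ω
  · obtain ⟨a, ha, h2, h3⟩ := h1
    rw [if_pos ⟨a, ha, h2, h3⟩, if_pos ⟨a, ha, h2, by omega⟩]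
  · rw [if_neg h1]
    split_ifs <;> positivity

end Trace

namespace IsLocalBcast

variable {V Ω : Type*} [Fintype V] [mΩ : MeasurableSpace Ω] {μ : Measure Ω}
  [IsProbabilityMeasure μ] {ℱ : Filtration ℕ mΩ} {n l : ℕ} {E : Trace V Ω}
  {G : Network V} {M : RadioParams} {Q : SenseParams} {ρ : ℝ}

omit [Fintype V] [IsProbabilityMeasure μ] in
theorem measurable_wokenMass (h : IsLocalBcast μ ℱ n E) (D : Finset V) (t t' : ℕ) :
    Measurable[ℱ t'] (E.wokenMass n D t t') := by
  classical
  exact Finset.measurable_fun_sum _ fun x _ =>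
    Measurable.ite (h.measurableSet_wokenBetween x t t') measurable_const measurable_const

-- Markov's inequality; for an empty silent set the density is 1, so the load estimate holds under
-- `μ` itself.
omit [Fintype V] in
theorem measure_inter_load_ge_le (h : IsLocalBcast μ ℱ n E) (hn : 2 ≤ n) {T : Finset V}
    {g : V → ℝ≥0∞} {t t' : ℕ} {A : Set Ω} (hA : MeasurableSet[ℱ t] A) {c I : ℝ}
    (hI : 0 < I)
    (hc : ∀ ω ∈ A, ∑ s ∈ Finset.Ico t t', ∑ x ∈ T,
      g x * ENNReal.ofReal (E.startProb n x s ω) ≤ ENNReal.ofReal c) :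
    μ (A ∩ {ω | ENNReal.ofReal I ≤ E.load T g t t' ω}) ≤ ENNReal.ofReal (c / I) * μ A := by
  have hLm := (h.measurable_load T g t t').mono (ℱ.le _) le_rfl
  have h1 := h.setLIntegral_quietDensity_load_le hn (D := ∅) (Finset.disjoint_empty_right _) hA hc
  have e : ∀ ω, E.quietDensity n ∅ t t' ω = 1 := fun ω => by
    simp [quietDensity, quiet, quietProb]
  simp only [e, one_mul, lintegral_one, Measure.restrict_apply MeasurableSet.univ,
    Set.univ_inter] at h1
  have h2 := (mul_meas_ge_le_lintegral (μ := μ.restrict A) hLm (ENNReal.ofReal I)).trans h1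
  rw [Measure.restrict_apply (measurableSet_le measurable_const hLm), Set.inter_comm] at h2
  rw [ENNReal.ofReal_div_of_pos hI, ENNReal.div_eq_inv_mul, mul_assoc, ← ENNReal.div_eq_inv_mul,
    ENNReal.le_div_iff_mul_le (by simp [hI]) (by simp), mul_comm]
  exact h2

/-- If the contention around `v` and the expected interference from outside are small, then `v`
rarely detects Busy, unless many nodes around it start the algorithm. -/
theorem measure_inter_busy_le [DecidableEq V] (h : IsLocalBcast μ ℱ n E) (hn : 2 ≤ n)
    (hl : E.LengthBound l) (hcd : CDSpec M Q ρ G μ ℱ n E) (v : V) {a t : ℕ} {A : Set Ω}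
    (hA : MeasurableSet[ℱ t] A) (hAw : ∀ ω ∈ A, E.wake v ω = (a : ℕ∞)) {η c : ℝ} (hη : 0 < η)
    (hc0 : 0 ≤ c)
    (hηA : ∀ ω ∈ A, E.contention n (G.inBall M v (ρ * M.R)) t ω ≤ η)
    (hc : ∀ ω ∈ A, ∑ s ∈ Finset.Ico t (t + 16 * l),
      ∑ x ∈ Finset.univ \ G.inBall M v (ρ * M.R), ENNReal.ofReal (G.signal M x v) *
        ENNReal.ofReal (E.startProb n x s ω) ≤ ENNReal.ofReal c) :
    μ (A ∩ {ω | E.wokenMass n (G.inBall M v (ρ * M.R)) t (t + 16 * l) ω ≤ η ∧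
        ∃ i ∈ E.innerRounds l v t a, E.busy v i ω}) ≤
      ENNReal.ofReal (33 * (1 - Q.h₂ ^ (-(4 ^ 16 * (2 * η)))) + c / Q.Icd) * μ A := by
  set D := G.inBall M v (ρ * M.R)
  -- Contention η at the beginning plus at most η from starting nodes, multiplied by the largest
  -- growth within a block.
  set η₁ : ℝ := 4 ^ 16 * (2 * η) with hη₁
  have hη₁0 : 0 < η₁ := by positivity
  have hI := Q.Icd_pos
  have hh : Q.h₂ ^ (-η₁) ≤ 1 :=
    Real.rpow_le_one_of_one_le_of_nonpos Q.one_lt_h₂.le (by linarith)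
  calc _ ≤ μ ((⋃ i ∈ E.innerRounds l v t a, A ∩ {ω | E.Starts v i (a + i * E.len v) ω ∧
          (∀ s, E.InRound v i s ω → E.contention n D s ω ≤ η₁) ∧
          E.interferenceOutside G M D v i ω < Q.Icd ∧ E.busy v i ω}) ∪
        (A ∩ {ω | ENNReal.ofReal Q.Icd ≤
          E.load (Finset.univ \ D) (fun x => ENNReal.ofReal (G.signal M x v)) t (t + 16 * l) ω}))
          := by
        refine measure_mono ?_
        rintro ω ⟨hωA, hωw, i, hi, hb⟩
        have hw := hAw ω hωA
        have hi' := (mem_innerRounds hl).mp hi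
        have hs := (starts_iff hw i).mpr rfl
        have hle := ofReal_interferenceOutside_le (G := G) (M := M) (D := D) (t := t)
          (t' := t + 16 * l) hl hs (by omega) (by have := hi'.2; rw [add_mul] at this; omega)
        by_cases hint : E.interferenceOutside G M D v i ω < Q.Icd
        · refine Or.inl ?_
          simp only [Set.mem_iUnion]
          refine ⟨i, hi, hωA, hs, fun s hsr => ?_, hint, hb⟩
          rw [inRound_iff hw] at hsr
          refine (contention_le_of_wokenMass hn hl D (t := t) (m := 16) (by omega)
            (by omega)).trans ?_
          rw [hη₁]
          have := hηA ω hωA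
          exact mul_le_mul_of_nonneg_left (by linarith) (by positivity)
        · exact Or.inr ⟨hωA, (ENNReal.ofReal_le_ofReal (not_lt.mp hint)).trans hle⟩
    _ ≤ (∑ i ∈ E.innerRounds l v t a, ENNReal.ofReal (1 - Q.h₂ ^ (-η₁)) * μ A) +
          ENNReal.ofReal (c / Q.Icd) * μ A := by
        refine (measure_union_le _ _).trans (add_le_add ?_ ?_)
        · refine (measure_biUnion_finset_le _ _).trans (Finset.sum_le_sum fun i hi => ?_)
          have hi' := (mem_innerRounds hl).mp hi
          exact hcd.low v η₁ hη₁0 i t _ (fun u => by have := hl.le u; omega) A hA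
        · exact h.measure_inter_load_ge_le hn hA hI hc
    _ ≤ _ := by
        rw [Finset.sum_const, nsmul_eq_mul, ← mul_assoc, ← add_mul,
          ENNReal.ofReal_add (by linarith) (by positivity), ENNReal.ofReal_mul (by norm_num)]
        gcongr
        have := card_innerRounds_le (t := t) hl v a
        rw [ENNReal.ofReal_ofNat]
        exact_mod_cast this

end IsLocalBcast

/-! ### Counting rare events, successes and excursions -/

section counting

variable {Ω : Type*} {mΩ : MeasurableSpace Ω} {μ : Measure Ω} [IsFiniteMeasure μ]
  {𝒢 : ℕ → MeasurableSpace Ω} {A : Set Ω}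

open scoped Classical in
/-- The number of indices below `J` for which `ω` lies in the set. -/
noncomputable def countMem (B : ℕ → Set Ω) (J : ℕ) (ω : Ω) : ℕ :=
  ((Finset.range J).filter fun j => ω ∈ B j).card

theorem exp_le_inv_one_sub {x : ℝ} (hx : x < 1) : Real.exp x ≤ (1 - x)⁻¹ := by
  rw [← neg_neg x, Real.exp_neg, neg_neg]
  exact inv_anti₀ (by linarith) (by linarith [Real.add_one_le_exp (-x)])

theorem ofReal_measureReal (S : Set Ω) : ENNReal.ofReal (μ.real S) = μ S :=
  ENNReal.ofReal_toReal (measure_ne_top μ S)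

/-- Events of small conditional probability rarely occur often. -/
theorem measure_countMem_ge_le (hmono : Monotone 𝒢) (hle : ∀ j, 𝒢 j ≤ mΩ)
    (hA : MeasurableSet[𝒢 0] A) {F : ℕ → Set Ω} (hF : ∀ j, MeasurableSet[𝒢 (j + 1)] (F j)) {δ : ℝ}
    (hδ : 0 ≤ δ) (h : ∀ j B, MeasurableSet[𝒢 j] B → B ⊆ A → μ (B ∩ F j) ≤ ENNReal.ofReal δ * μ B)
    (J : ℕ) (N : ℝ) :
    μ (A ∩ {ω | N ≤ countMem F J ω}) ≤ ENNReal.ofReal (Real.exp (-(N - 2 * δ * J))) * μ A := by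
  classical
  have := measure_le_exp_neg hmono hle (μ := μ)
    -- The compensator 2δ suffices because e - 1 < 2 and 1 + 2δ ≤ exp (2δ).
    (x := fun j ω => (if ω ∈ F j then 1 else 0) - 2 * δ)
    (fun j => (Measurable.ite (hF j) measurable_const measurable_const).sub_const _) hA
    (fun j B hB hBA => ?_) J (N - 2 * δ * J)
  · refine le_trans (measure_mono (Set.inter_subset_inter_right _ fun ω hω => ?_)) this
    simp only [Set.mem_ofPred_eq, Finset.sum_sub_distrib, Finset.sum_boole, Finset.sum_const,
      Finset.card_range, nsmul_eq_mul] at hω ⊢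
    rw [countMem] at hω
    linarith
  · have hFm := hle _ _ (hF j)
    have hBm := hle _ _ hB
    rw [← lintegral_inter_add_sdiff _ _ hFm]
    have e1 : ∫⁻ ω in B ∩ F j, ENNReal.ofReal (Real.exp ((if ω ∈ F j then 1 else 0) - 2 * δ)) ∂μ =
        ENNReal.ofReal (Real.exp (1 - 2 * δ)) * μ (B ∩ F j) := by
      rw [← setLIntegral_const]
      exact setLIntegral_congr_fun (hBm.inter hFm) fun ω hω => by simp only [if_pos hω.2]
    have e2 : ∫⁻ ω in B \ F j, ENNReal.ofReal (Real.exp ((if ω ∈ F j then 1 else 0) - 2 * δ)) ∂μ =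
        ENNReal.ofReal (Real.exp (-(2 * δ))) * μ (B \ F j) := by
      rw [← setLIntegral_const]
      exact setLIntegral_congr_fun (hBm.diff hFm) fun ω hω => by simp only [if_neg hω.2, zero_sub]
    have hs := measureReal_inter_add_sdiff (μ := μ) (s := B) hFm
    have hd := h j B hB hBA
    rw [e1, e2]
    rw [← ofReal_measureReal (μ := μ) (B ∩ F j), ← ofReal_measureReal (μ := μ) B,
      ← ENNReal.ofReal_mul (by positivity), ENNReal.ofReal_le_ofReal_iff (by positivity)] at hd
    rw [← ofReal_measureReal (μ := μ) (B ∩ F j), ← ofReal_measureReal (μ := μ) B,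
      ← ofReal_measureReal (μ := μ) (B \ F j), ← ENNReal.ofReal_mul (by positivity),
      ← ENNReal.ofReal_mul (by positivity), ← ENNReal.ofReal_add (by positivity) (by positivity)]
    refine ENNReal.ofReal_le_ofReal ?_
    have h1 : Real.exp (1 - 2 * δ) = Real.exp 1 * Real.exp (-(2 * δ)) := by
      rw [← Real.exp_add]; ring_nf
    have h2 := Real.exp_one_lt_d9
    have h3 : Real.exp (-(2 * δ)) * (1 + 2 * δ) ≤ 1 := by
      rw [Real.exp_neg, inv_mul_le_iff₀ (Real.exp_pos _), mul_one]
      linarith [Real.add_one_le_exp (2 * δ)]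
    have hp := Real.exp_pos (-(2 * δ))
    have hB0 : 0 ≤ μ.real (B ∩ F j) := measureReal_nonneg
    have hB1 : 0 ≤ μ.real B := measureReal_nonneg
    rw [h1]
    have h4 : Real.exp 1 * μ.real (B ∩ F j) + μ.real (B \ F j) ≤ (1 + 2 * δ) * μ.real B := by
      nlinarith
    calc _ = Real.exp (-(2 * δ)) * (Real.exp 1 * μ.real (B ∩ F j) + μ.real (B \ F j)) := by ring
      _ ≤ Real.exp (-(2 * δ)) * ((1 + 2 * δ) * μ.real B) := mul_le_mul_of_nonneg_left h4 hp.le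
      _ ≤ _ := by nlinarith

/-- If a success has conditional probability at least `c` in each trial, then many trials with few
successes are unlikely. -/
theorem measure_countMem_ge_and_le (hmono : Monotone 𝒢) (hle : ∀ j, 𝒢 j ≤ mΩ)
    (hA : MeasurableSet[𝒢 0] A) {T S : ℕ → Set Ω} (hT : ∀ j, MeasurableSet[𝒢 j] (T j))
    (hS : ∀ j, MeasurableSet[𝒢 (j + 1)] (S j)) {c : ℝ} (hc : 0 ≤ c) (hc1 : c ≤ 1)
    (h : ∀ j B, MeasurableSet[𝒢 j] B → B ⊆ A → B ⊆ T j →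
      ENNReal.ofReal c * μ B ≤ μ (B ∩ S j)) (J : ℕ) (N d : ℝ) :
    μ (A ∩ {ω | N ≤ countMem T J ω ∧ countMem S J ω ≤ d}) ≤
      ENNReal.ofReal (Real.exp (-(c / 2 * N - Real.log 2 * d))) * μ A := by
  classical
  have hlog : 0 < Real.log 2 := Real.log_pos (by norm_num)
  have := measure_le_exp_neg hmono hle (μ := μ)
    -- A trial adds c/2 and a success subtracts log 2, that is, halves the exponential. The
    -- conditional mean in a trial is at most exp (c/2) (1 - c/2) ≤ 1.
    (x := fun j ω => if ω ∈ T j then (c / 2 - if ω ∈ S j then Real.log 2 else 0) else 0)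
    (fun j => (Measurable.ite (hmono (Nat.le_succ j) _ (hT j)) ((Measurable.ite (hS j)
      measurable_const measurable_const).const_sub _) measurable_const)) hA
    (fun j B hB hBA => ?_) J (c / 2 * N - Real.log 2 * d)
  · refine le_trans (measure_mono (Set.inter_subset_inter_right _ ?_)) this
    rintro ω ⟨hω1, hω2⟩
    have e : ∀ j ∈ Finset.range J, c / 2 * (if ω ∈ T j then 1 else 0) -
        Real.log 2 * (if ω ∈ S j then 1 else 0) ≤
        if ω ∈ T j then (c / 2 - if ω ∈ S j then Real.log 2 else 0) else 0 := by
      intro j _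
      split_ifs <;> linarith
    refine le_trans ?_ (Finset.sum_le_sum e)
    rw [Finset.sum_sub_distrib, ← Finset.mul_sum, ← Finset.mul_sum, Finset.sum_boole,
      Finset.sum_boole]
    change c / 2 * N - Real.log 2 * d ≤ c / 2 * (countMem T J ω) - Real.log 2 * (countMem S J ω)
    have := mul_le_mul_of_nonneg_left hω1 (by linarith : 0 ≤ c / 2)
    have := mul_le_mul_of_nonneg_left hω2 hlog.le
    linarith
  · have hTm := hle _ _ (hT j)
    have hSm := hle _ _ (hS j)
    have hBm := hle _ _ hB
    rw [← lintegral_inter_add_sdiff _ _ hTm, ← lintegral_inter_add_sdiff _ (B ∩ T j) hSm]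
    have e1 : ∫⁻ ω in B ∩ T j ∩ S j, ENNReal.ofReal (Real.exp
        (if ω ∈ T j then (c / 2 - if ω ∈ S j then Real.log 2 else 0) else 0)) ∂μ =
        ENNReal.ofReal (Real.exp (c / 2 - Real.log 2)) * μ (B ∩ T j ∩ S j) := by
      rw [← setLIntegral_const]
      exact setLIntegral_congr_fun ((hBm.inter hTm).inter hSm) fun ω hω => by
        simp only [if_pos hω.2, if_pos hω.1.2]
    have e2 : ∫⁻ ω in (B ∩ T j) \ S j, ENNReal.ofReal (Real.exp
        (if ω ∈ T j then (c / 2 - if ω ∈ S j then Real.log 2 else 0) else 0)) ∂μ =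
        ENNReal.ofReal (Real.exp (c / 2)) * μ ((B ∩ T j) \ S j) := by
      rw [← setLIntegral_const]
      exact setLIntegral_congr_fun ((hBm.inter hTm).diff hSm) fun ω hω => by
        simp only [if_neg hω.2, if_pos hω.1.2, sub_zero]
    have e3 : ∫⁻ ω in B \ T j, ENNReal.ofReal (Real.exp
        (if ω ∈ T j then (c / 2 - if ω ∈ S j then Real.log 2 else 0) else 0)) ∂μ =
        μ (B \ T j) := by
      rw [← setLIntegral_one]
      exact setLIntegral_congr_fun (hBm.diff hTm) fun ω hω => by
        simp only [if_neg hω.2, Real.exp_zero, ENNReal.ofReal_one]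
    have hd := h j (B ∩ T j) (hB.inter (hT j)) (Set.inter_subset_left.trans hBA)
      Set.inter_subset_right
    have hs := measureReal_inter_add_sdiff (μ := μ) (s := B ∩ T j) hSm
    have ht := measureReal_inter_add_sdiff (μ := μ) (s := B) hTm
    rw [e1, e2, e3]
    rw [← ofReal_measureReal (μ := μ) (B ∩ T j ∩ S j), ← ofReal_measureReal (μ := μ) (B ∩ T j),
      ← ENNReal.ofReal_mul (by positivity), ENNReal.ofReal_le_ofReal_iff (by positivity)] at hd
    rw [← ofReal_measureReal (μ := μ) (B ∩ T j ∩ S j), ← ofReal_measureReal (μ := μ) (B \ T j),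
      ← ofReal_measureReal (μ := μ) ((B ∩ T j) \ S j), ← ofReal_measureReal (μ := μ) B,
      ← ENNReal.ofReal_mul (by positivity),
      ← ENNReal.ofReal_mul (by positivity), ← ENNReal.ofReal_add (by positivity) (by positivity),
      ← ENNReal.ofReal_add (by positivity) (by positivity)]
    refine ENNReal.ofReal_le_ofReal ?_
    rw [Real.exp_sub, Real.exp_log (by norm_num)]
    have h3 : Real.exp (c / 2) * (1 - c / 2) ≤ 1 := by
      have := exp_le_inv_one_sub (x := c / 2) (by linarith)
      have hp : 0 < 1 - c / 2 := by linarith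
      have h6 := mul_le_mul_of_nonneg_right this hp.le
      rwa [inv_mul_cancel₀ hp.ne'] at h6
    have hp := Real.exp_pos (c / 2)
    have hB0 : 0 ≤ μ.real (B ∩ T j) := measureReal_nonneg
    have h4 : μ.real (B ∩ T j ∩ S j) / 2 + μ.real ((B ∩ T j) \ S j) ≤
        (1 - c / 2) * μ.real (B ∩ T j) := by nlinarith
    calc _ = Real.exp (c / 2) * (μ.real (B ∩ T j ∩ S j) / 2 + μ.real ((B ∩ T j) \ S j)) +
          μ.real (B \ T j) := by ring
      _ ≤ Real.exp (c / 2) * ((1 - c / 2) * μ.real (B ∩ T j)) + μ.real (B \ T j) :=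
          (add_le_add_iff_right _).mpr (mul_le_mul_of_nonneg_left h4 hp.le)
      _ ≤ _ := by nlinarith

omit [IsFiniteMeasure μ] in
/-- A process with a drift towards a constant is rarely large often. -/
theorem measure_countMem_lt_le (hmono : Monotone 𝒢) (hle : ∀ j, 𝒢 j ≤ mΩ)
    (hA : MeasurableSet[𝒢 0] A) {Y : ℕ → Ω → ℝ} (hY : ∀ j, Measurable[𝒢 j] (Y j))
    (hY0 : ∀ j ω, 0 ≤ Y j ω) {C : ℝ} (hC : 0 < C)
    (h : ∀ j B, MeasurableSet[𝒢 j] B → ∫⁻ ω in B, ENNReal.ofReal (Y (j + 1) ω) ∂μ ≤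
      ∫⁻ ω in B, ENNReal.ofReal (1 / 2 * Y j ω + C) ∂μ) {y : ℝ} (hy : 0 < y)
    (hyA : ∀ ω ∈ A, Y 0 ω + 400 * C ≤ y * (400 * C)) (J : ℕ) :
    μ (A ∩ {ω | (J : ℝ) / 40 ≤ countMem (fun j => {ω | 400 * C < Y j ω}) J ω}) ≤
      ENNReal.ofReal (Real.exp (-(J / 400 - Real.log y))) * μ A := by
  classical
  set L := 400 * C with hL
  have hL0 : 0 < L := by positivity
  have hpos : ∀ j ω, 0 < Y j ω + L := fun j ω => by linarith [hY0 j ω]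
  have hYm : ∀ j, Measurable (Y j) := fun j => (hY j).mono (hle j) le_rfl
  -- The increments of log (Y + L) are compensated by r. The mean ratio (Y/2 + C + L)/(Y + L) is
  -- below exp (-1/5) for Y > L and at most 1 + 1/400 otherwise, as C = L/400.
  set r : ℕ → Ω → ℝ := fun j ω => if L < Y j ω then 1 / 5 else -(1 / 400) with hr
  have hrm : ∀ j, Measurable[𝒢 j] (r j) := fun j =>
    Measurable.ite (measurableSet_lt measurable_const (hY j)) measurable_const measurable_const
  have := measure_le_exp_neg hmono hle (μ := μ)
    (x := fun j ω => Real.log (Y (j + 1) ω + L) - Real.log (Y j ω + L) + r j ω)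
    (fun j => (((Real.measurable_log.comp ((hY (j + 1)).add_const L)).sub
      ((Real.measurable_log.comp ((hY j).add_const L)).mono (hmono (Nat.le_succ j)) le_rfl)).add
      ((hrm j).mono (hmono (Nat.le_succ j)) le_rfl))) hA
    (fun j B hB hBA => ?_) J (J / 400 - Real.log y)
  · refine le_trans (measure_mono ?_) this
    rintro ω ⟨hωA, hω⟩
    refine ⟨hωA, ?_⟩
    simp only [Set.mem_ofPred_eq] at hω ⊢
    rw [Finset.sum_add_distrib, Finset.sum_range_sub (fun j => Real.log (Y j ω + L))]
    -- With J/40 excursions, the sum of r is at least (81/400)(J/40) - J/400, which exceeds J/400.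
    -- The logarithms telescope and cost at most log y.
    have e : ∀ j ∈ Finset.range J, r j ω =
        (1 / 5 + 1 / 400) * (if ω ∈ {ω | L < Y j ω} then 1 else 0) - 1 / 400 := by
      intro j _
      simp only [hr, Set.mem_ofPred_eq]
      split_ifs <;> norm_num
    rw [Finset.sum_congr rfl e, Finset.sum_sub_distrib, ← Finset.mul_sum, Finset.sum_boole,
      Finset.sum_const, Finset.card_range, nsmul_eq_mul]
    rw [countMem] at hω
    have h1 : Real.log L ≤ Real.log (Y J ω + L) := Real.log_le_log hL0 (by linarith [hY0 J ω])
    have h2 : Real.log (Y 0 ω + L) ≤ Real.log y + Real.log L := by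
      rw [← Real.log_mul hy.ne' hL0.ne']
      exact Real.log_le_log (hpos 0 ω) (hyA ω hωA)
    linarith
  · have hBm := hle _ _ hB
    have key := setLIntegral_mul_le_of_forall (μ := μ) (hle j)
      (f := fun ω => ENNReal.ofReal (Y (j + 1) ω + L))
      (f' := fun ω => ENNReal.ofReal (1 / 2 * Y j ω + C + L))
      ((hYm (j + 1)).add_const L).ennreal_ofReal
      ((((hYm j).const_mul _).add_const C).add_const L).ennreal_ofReal
      (fun B hB => by
        have e1 : ∀ ω, ENNReal.ofReal (Y (j + 1) ω + L) =
            ENNReal.ofReal (Y (j + 1) ω) + ENNReal.ofReal L := fun ω =>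
          ENNReal.ofReal_add (hY0 _ ω) hL0.le
        have e2 : ∀ ω, ENNReal.ofReal (1 / 2 * Y j ω + C + L) =
            ENNReal.ofReal (1 / 2 * Y j ω + C) + ENNReal.ofReal L := fun ω =>
          ENNReal.ofReal_add (by linarith [hY0 j ω]) hL0.le
        simp only [e1, e2]
        rw [lintegral_add_right _ measurable_const, lintegral_add_right _ measurable_const]
        exact add_le_add (h j B hB) le_rfl)
      (g := fun ω => ENNReal.ofReal (Real.exp (r j ω) / (Y j ω + L)))
      ((Real.measurable_exp.comp (hrm j)).div ((hY j).add_const L)).ennreal_ofReal hB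
    refine le_trans (le_of_eq (lintegral_congr fun ω => ?_)) (key.trans ?_)
    · rw [← ENNReal.ofReal_mul (by have := hpos j ω; positivity), Real.exp_add, Real.exp_sub,
        Real.exp_log (hpos _ ω), Real.exp_log (hpos _ ω)]
      congr 1
      ring
    · rw [← setLIntegral_one]
      refine lintegral_mono fun ω => ?_
      have hp := hpos j ω
      rw [← ENNReal.ofReal_mul (by positivity), ENNReal.ofReal_le_one, div_mul_eq_mul_div,
        div_le_one hp]
      have hq : 0 < 1 / 2 * Y j ω + C + L := by linarith [hY0 j ω]
      simp only [hr]
      split_ifs with hω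
      · have h5 := exp_le_inv_one_sub (x := 1 / 5) (by norm_num)
        norm_num at h5
        nlinarith
      · have h5 : Real.exp (-(1 / 400)) ≤ (1 + 1 / 400)⁻¹ := by
          rw [Real.exp_neg]
          exact inv_anti₀ (by norm_num) (by linarith [Real.add_one_le_exp (1 / 400)])
        norm_num at h5
        have : C = L / 400 := by rw [hL]; ring
        have h6 := hY0 j ω
        norm_num at hω ⊢
        nlinarith

end counting

/-! ### From good blocks to stopping, and the potential -/

namespace Trace

variable {V Ω : Type*} {E : Trace V Ω} {n l a J : ℕ} {ω : Ω} {v : V}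

/-- If all but a few blocks are free of contention and detected as such, then `v` stops. -/
theorem stoppedBy_of_count_le (hn : 2 ≤ n) (hl : E.LengthBound l) (hw : E.wake v ω = a)
    {bad : Finset ℕ} (hgood : ∀ j < J, j ∉ bad →
      (∀ i ∈ E.innerRounds l v (a + j * (16 * l)) a, ¬ E.busy v i ω) ∧
      ∀ s, a + j * (16 * l) ≤ s → s ≤ a + j * (16 * l) + 16 * l → E.curProb n v s ω < 1 / 2)
    (hbad : (bad.card : ℝ) ≤ J / 10) (hJ : Real.log n < J) :
    E.StoppedBy v (a + J * (16 * l)) ω := by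
  by_contra hns
  have hlog : 0 < Real.log 2 := Real.log_pos (by norm_num)
  have hlog2 := Real.log_two_gt_d9
  have hn0 : (0 : ℝ) < n := by have : 0 < n := by omega
                               exact_mod_cast this
  -- On the scale of log 2, a good block gains 14 - 4 = 10 and a bad block loses at most 32, hence
  -- 42 less than a good one.
  have key : ∀ k ≤ J, 0 < E.curProb n v (a + k * (16 * l)) ω ∧
      -Real.log (2 * n) + Real.log 2 * (10 * k - 42 * (bad.filter (· < k)).card) ≤
        Real.log (E.curProb n v (a + k * (16 * l)) ω) := by
    intro k
    induction k with
    | zero =>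
      intro _
      rw [curProb_eq (hl.pos v) hw (by omega)]
      simp only [Nat.zero_mul, Nat.add_zero, Nat.sub_self, Nat.zero_div, prob_zero]
      refine ⟨by positivity, ?_⟩
      rw [one_div, Real.log_inv]
      simp
    | succ k ih =>
      intro hk
      obtain ⟨h0, h1⟩ := ih (by omega)
      have hs : ¬ E.StoppedBy v (a + k * (16 * l) + 16 * l) ω := fun hst =>
        hns (hst.mono (by
          have := Nat.mul_le_mul_right (16 * l) hk
          rw [add_mul] at this
          omega))
      rw [show a + (k + 1) * (16 * l) = a + k * (16 * l) + 16 * l by ring]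
      by_cases hkb : k ∈ bad
      · have h2 := curProb_div_le (m := 16) hn hl (Nat.le_add_right a _) hw (Nat.le_add_right _ _)
          le_rfl hs
        refine ⟨lt_of_lt_of_le (by positivity) h2, ?_⟩
        have h3 := Real.log_le_log (by positivity) h2
        rw [Real.log_div h0.ne' (by positivity), show (4 : ℝ) ^ 16 = 2 ^ 32 by norm_num,
          Real.log_pow] at h3
        have h4 : (bad.filter (· < k + 1)).card = (bad.filter (· < k)).card + 1 := by
          rw [← Finset.card_insert_of_notMem (a := k) (by simp)]
          congr 1
          ext x
          simp only [Finset.mem_filter, Finset.mem_insert]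
          constructor
          · rintro ⟨hx, hxk⟩
            by_cases hxe : x = k
            exacts [Or.inl hxe, Or.inr ⟨hx, by omega⟩]
          · rintro (rfl | ⟨hx, hxk⟩)
            exacts [⟨hkb, by omega⟩, ⟨hx, by omega⟩]
        rw [h4]
        push_cast at h3 ⊢
        linarith
      · obtain ⟨hb, hlt⟩ := hgood k (by omega) hkb
        have h2 := le_curProb_of_idle (k := 16) hn hl (Nat.le_add_right a _) hw (by norm_num) hs
          (fun i hi1 hi2 => hb i ((mem_innerRounds hl).mpr ⟨hi1, hi2⟩)) hlt
        norm_num at h2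
        refine ⟨lt_of_lt_of_le (by positivity) h2, ?_⟩
        have h3 := Real.log_le_log (by positivity) h2
        rw [Real.log_mul (by norm_num) h0.ne', show (1024 : ℝ) = 2 ^ 10 by norm_num,
          Real.log_pow] at h3
        have h4 : bad.filter (· < k + 1) = bad.filter (· < k) := by
          ext x
          simp only [Finset.mem_filter, and_congr_right_iff]
          intro hx
          have : x ≠ k := fun e => hkb (e ▸ hx)
          omega
        rw [h4]
        push_cast at h3 ⊢
        linarith
  obtain ⟨h0, h1⟩ := key J le_rfl
  have h2 := Real.log_le_log h0 (curProb_le_half hn (hl.pos v))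
  rw [one_div, Real.log_inv] at h2
  have h3 : ((bad.filter (· < J)).card : ℝ) ≤ bad.card :=
    Nat.cast_le.mpr (Finset.card_filter_le _ _)
  rw [Real.log_mul (by norm_num) hn0.ne'] at h1
  -- With at most J/10 bad blocks the net gain is at least 10 J - 4.2 J, more than log n after
  -- multiplication by log 2; this contradicts the cap 1/2.
  have h5 : Real.log 2 * (58 / 10 * J) ≤
      Real.log 2 * (10 * J - 42 * (bad.filter (· < J)).card) :=
    mul_le_mul_of_nonneg_left (by linarith) hlog.le
  have h6 : (J : ℝ) ≤ Real.log 2 * (58 / 10 * J) := by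
    have : (0 : ℝ) ≤ J := by positivity
    nlinarith
  linarith

/-- A monotone property changes at most once. -/
theorem card_filter_change_le_one (P : ℕ → Prop) [DecidablePred P] (hP : Monotone P) (J : ℕ) :
    ((Finset.range J).filter fun j => ¬ P j ∧ P (j + 1)).card ≤ 1 := by
  rw [Finset.card_le_one]
  intro i hi j hj
  simp only [Finset.mem_filter] at hi hj
  by_contra hne
  rcases lt_or_gt_of_ne hne with h | h
  · exact hj.2.1 (hP (Nat.succ_le_of_lt h) hi.2.2)
  · exact hi.2.1 (hP (Nat.succ_le_of_lt h) hj.2.2)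

/-- Each node of `D` stops in at most one block. This is where the term |D| in the running time
comes from. -/
theorem countMem_stopped_le (D : Finset V) (J : ℕ) :
    countMem (fun j => {ω | ∃ w ∈ D, ¬ E.StoppedBy w (a + j * (16 * l)) ω ∧
      E.StoppedBy w (a + j * (16 * l) + 16 * l) ω}) J ω ≤ D.card := by
  classical
  calc _ ≤ (D.biUnion fun w => (Finset.range J).filter fun j =>
        ¬ E.StoppedBy w (a + j * (16 * l)) ω ∧ E.StoppedBy w (a + (j + 1) * (16 * l)) ω).card := by
        refine Finset.card_le_card fun j hj => ?_
        simp only [Finset.mem_filter, Set.mem_ofPred_eq, Finset.mem_biUnion] at hj ⊢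
        obtain ⟨h1, w, hw, h2, h3⟩ := hj
        exact ⟨w, hw, h1, h2, by rwa [add_mul, one_mul, ← add_assoc]⟩
    _ ≤ D.card * 1 := Finset.card_biUnion_le_card_mul _ _ _ fun w _ => by
        refine card_filter_change_le_one (fun j => E.StoppedBy w (a + j * (16 * l)) ω)
          (fun i j hij hi => hi.mono ?_) J
        have := Nat.mul_le_mul_right (16 * l) hij
        omega
    _ = _ := mul_one _

/-- Each node starts in at most one block and contributes 1/(2n). -/
theorem sum_wokenMass_le [Fintype V] (hn : 2 ≤ n) (hV : Fintype.card V ≤ n) (D : Finset V)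
    (J : ℕ) :
    ∑ j ∈ Finset.range J,
      E.wokenMass n D (a + j * (16 * l)) (a + j * (16 * l) + 16 * l) ω ≤ 1 / 2 := by
  classical
  unfold wokenMass
  rw [Finset.sum_comm]
  refine le_trans (Finset.sum_le_sum fun x _ => ?_) (card_div_le_half hn hV D)
  rw [← Finset.sum_filter, Finset.sum_const, nsmul_eq_mul]
  refine mul_le_of_le_one_left (by positivity) ?_
  have := card_filter_change_le_one (fun j => ∃ b : ℕ, E.wake x ω = b ∧ b ≤ a + j * (16 * l))
    (fun i j hij ⟨b, hb, hbi⟩ => ⟨b, hb, hbi.trans (by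
      have := Nat.mul_le_mul_right (16 * l) hij
      omega)⟩) J
  refine le_trans (Nat.cast_le.mpr (Finset.card_le_card fun j hj => ?_)) (Nat.cast_le_one.mpr this)
  simp only [Finset.mem_filter] at hj ⊢
  obtain ⟨h1, b, hb, h2, h3⟩ := hj
  refine ⟨h1, ?_, b, hb, by rw [add_mul]; omega⟩
  rintro ⟨b', hb', h4⟩
  rw [hb] at hb'
  have : b = b' := by exact_mod_cast hb'
  omega

theorem card_wokenMass_lt [Fintype V] (hn : 2 ≤ n) (hV : Fintype.card V ≤ n) (D : Finset V)
    {η : ℝ} (hη : 0 < η) (hJ : 20 / η < J) :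
    (countMem (fun j => {ω | η < E.wokenMass n D (a + j * (16 * l)) (a + j * (16 * l) + 16 * l) ω})
      J ω : ℝ) < J / 40 := by
  classical
  have h1 := sum_wokenMass_le (E := E) (a := a) (l := l) (ω := ω) hn hV D J
  have h0 : ∀ j, 0 ≤ E.wokenMass n D (a + j * (16 * l)) (a + j * (16 * l) + 16 * l) ω :=
    fun j => Finset.sum_nonneg fun x _ => by split_ifs <;> positivity
  rw [div_lt_iff₀ hη] at hJ
  have h2 : (countMem (fun j => {ω | η < E.wokenMass n D (a + j * (16 * l))
      (a + j * (16 * l) + 16 * l) ω}) J ω : ℝ) * η ≤ 1 / 2 := by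
    refine le_trans ?_ h1
    rw [countMem, ← nsmul_eq_mul, ← Finset.sum_const]
    exact (Finset.sum_le_sum fun j hj => (Finset.mem_filter.mp hj).2.le).trans
      (Finset.sum_le_sum_of_subset_of_nonneg (Finset.filter_subset _ _) fun j _ _ => h0 j)
  nlinarith

/-- A weighted sum of the contentions in the balls of radius `R / 2`. -/
noncomputable def potential [Fintype V] (E : Trace V Ω) (G : Network V) (M : RadioParams) (n : ℕ)
    (S : Finset V) (α : V → ℝ) (t : ℕ) (ω : Ω) : ℝ :=
  ∑ s ∈ S, α s * E.contention n (G.ball M s (M.R / 2)) t ω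

section potential

variable [Fintype V] {G : Network V} {M : RadioParams} {S : Finset V} {α : V → ℝ} {t : ℕ}

theorem potential_nonneg (hn : 2 ≤ n) (hα : ∀ s, 0 ≤ α s) : 0 ≤ E.potential G M n S α t ω :=
  Finset.sum_nonneg fun s _ => mul_nonneg (hα s) (contention_nonneg hn _)

/-- This crude bound enters only through its logarithm. -/
theorem potential_le (hn : 2 ≤ n) (hV : Fintype.card V ≤ n) (hl : E.LengthBound l)
    (hα : ∀ s, 0 ≤ α s) (hα3 : ∑ s ∈ S, α s ≤ 3) : E.potential G M n S α t ω ≤ 3 / 2 * n := by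
  calc E.potential G M n S α t ω ≤ ∑ s ∈ S, α s * (n / 2) := by
        refine Finset.sum_le_sum fun s _ => mul_le_mul_of_nonneg_left
          ((contention_le_half_card hn hl.pos _).trans ?_) (hα s)
        have : ((G.ball M s (M.R / 2)).card : ℝ) ≤ n :=
          Nat.cast_le.mpr ((Finset.card_le_univ _).trans hV)
        linarith
    _ = (∑ s ∈ S, α s) * (n / 2) := by rw [Finset.sum_mul]
    _ ≤ 3 * (n / 2) := mul_le_mul_of_nonneg_right hα3 (by positivity)
    _ = _ := by ring

open scoped Classical in
/-- Weighted sums of the probabilities used by nodes that start a round in a short interval are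
controlled by the potential. -/
theorem sum_mul_startProb_le (hn : 2 ≤ n) (hV : Fintype.card V ≤ n) (hl : E.LengthBound l)
    (hα : ∀ s, 0 ≤ α s) (hα3 : ∑ s ∈ S, α s ≤ 3) {β : ℝ} (hβ : 0 ≤ β) {T : Finset V}
    {g : V → ℝ} (hg0 : ∀ x, 0 ≤ g x)
    (hg : ∀ x ∈ T, g x ≤ ∑ s ∈ S, if x ∈ G.ball M s (M.R / 2) then β * α s else 0) (m : ℕ) :
    ∑ s ∈ Finset.Ico t (t + m * l), ∑ x ∈ T, g x * E.startProb n x s ω ≤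
      (2 * m + 1) * 4 ^ m * β * (E.potential G M n S α t ω + 3 / 2) := by
  have hp : ∀ x, 0 ≤ E.curProb n x t ω + 1 / (2 * (n : ℝ)) := fun x =>
    add_nonneg (curProb_nonneg hn) (by positivity)
  rw [Finset.sum_comm]
  simp only [← Finset.mul_sum]
  calc ∑ x ∈ T, g x * ∑ s ∈ Finset.Ico t (t + m * l), E.startProb n x s ω
      ≤ ∑ x ∈ T, g x * ((2 * m + 1) * 4 ^ m * (E.curProb n x t ω + 1 / (2 * n))) :=
        Finset.sum_le_sum fun x _ =>
          mul_le_mul_of_nonneg_left (sum_startProb_le hn hl le_rfl) (hg0 x)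
    _ = (2 * m + 1) * 4 ^ m * ∑ x ∈ T, g x * (E.curProb n x t ω + 1 / (2 * n)) := by
        rw [Finset.mul_sum]; exact Finset.sum_congr rfl fun x _ => by ring
    _ ≤ (2 * m + 1) * 4 ^ m * ∑ s ∈ S, β * α s *
          ∑ x ∈ G.ball M s (M.R / 2), (E.curProb n x t ω + 1 / (2 * n)) :=
        mul_le_mul_of_nonneg_left (Network.sum_mul_le_of_cover hp T S
          (fun s => mul_nonneg hβ (hα s)) hg) (by positivity)
    _ ≤ (2 * m + 1) * 4 ^ m * ∑ s ∈ S, β * α s *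
          (E.contention n (G.ball M s (M.R / 2)) t ω + 1 / 2) := by
        refine mul_le_mul_of_nonneg_left (Finset.sum_le_sum fun s _ =>
          mul_le_mul_of_nonneg_left ?_ (mul_nonneg hβ (hα s))) (by positivity)
        rw [Finset.sum_add_distrib, contention]
        exact (add_le_add_iff_left _).mpr (card_div_le_half hn hV _)
    _ = (2 * m + 1) * 4 ^ m * β * (E.potential G M n S α t ω + (∑ s ∈ S, α s) / 2) := by
        rw [potential, Finset.sum_div, ← Finset.sum_add_distrib, Finset.mul_sum, Finset.mul_sum]
        exact Finset.sum_congr rfl fun s _ => by ring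
    _ ≤ _ := mul_le_mul_of_nonneg_left (by linarith) (by positivity)

end potential

end Trace

/-! ### Drift of the potential and choice of the weights -/

namespace IsLocalBcast

variable {V Ω : Type*} [Fintype V] [mΩ : MeasurableSpace Ω] {μ : Measure Ω}
  [IsProbabilityMeasure μ] {ℱ : Filtration ℕ mΩ} {n l : ℕ} {E : Trace V Ω}
  {G : Network V} {M : RadioParams} {Q : SenseParams} {ρ : ℝ} {S : Finset V} {α : V → ℝ}

omit [IsProbabilityMeasure μ] in
theorem measurable_potential (h : IsLocalBcast μ ℱ n E) (t : ℕ) :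
    Measurable[ℱ t] (E.potential G M n S α t) :=
  Finset.measurable_fun_sum _ fun _ _ => (h.measurable_contention _ t).const_mul _

-- The drift inequality is linear and passes to nonnegative combinations; the constant is multiplied
-- by the total weight.
omit [IsProbabilityMeasure μ] in
theorem setLIntegral_potential_le (h : IsLocalBcast μ ℱ n E) (hn : 2 ≤ n)
    (hV : Fintype.card V ≤ n) (hl : E.LengthBound l) (hcd : CDSpec M Q ρ G μ ℱ n E)
    (hα : ∀ s, 0 ≤ α s) (hα3 : ∑ s ∈ S, α s ≤ 3) (t : ℕ) {A : Set Ω} (hA : MeasurableSet[ℱ t] A) :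
    ∫⁻ ω in A, ENNReal.ofReal (E.potential G M n S α (t + 16 * l) ω) ∂μ ≤
      ∫⁻ ω in A, ENNReal.ofReal
        (1 / 2 * E.potential G M n S α t ω + 3 * Q.driftConst) ∂μ := by
  have hQ := Q.one_le_driftConst
  have hc : ∀ t' s ω, 0 ≤ E.contention n (G.ball M s (M.R / 2)) t' ω :=
    fun _ _ _ => contention_nonneg hn _
  have hm : ∀ t' s, Measurable (E.contention n (G.ball M s (M.R / 2)) t') := fun t' s =>
    (h.measurable_contention _ t').mono (ℱ.le t') le_rfl
  calc ∫⁻ ω in A, ENNReal.ofReal (E.potential G M n S α (t + 16 * l) ω) ∂μ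
      = ∑ s ∈ S, ENNReal.ofReal (α s) * ∫⁻ ω in A, ENNReal.ofReal
          (E.contention n (G.ball M s (M.R / 2)) (t + 16 * l) ω) ∂μ := by
        rw [← Finset.sum_congr rfl fun s _ => lintegral_const_mul _ (hm _ s).ennreal_ofReal,
          ← lintegral_finsetSum _ fun s _ => ((hm _ s).ennreal_ofReal.const_mul _)]
        refine lintegral_congr fun ω => ?_
        rw [potential, ENNReal.ofReal_sum_of_nonneg fun s _ => mul_nonneg (hα s) (hc _ s ω)]
        exact Finset.sum_congr rfl fun s _ => ENNReal.ofReal_mul (hα s)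
    _ ≤ ∑ s ∈ S, ENNReal.ofReal (α s) * ∫⁻ ω in A, ENNReal.ofReal
          (1 / 2 * E.contention n (G.ball M s (M.R / 2)) t ω + Q.driftConst) ∂μ :=
        Finset.sum_le_sum fun s _ =>
          mul_le_mul_right (setLIntegral_contention_le h hn hV hl hcd s t hA) _
    _ = ∫⁻ ω in A, ENNReal.ofReal (∑ s ∈ S, α s *
          (1 / 2 * E.contention n (G.ball M s (M.R / 2)) t ω + Q.driftConst)) ∂μ := by
        have hm' : ∀ s, Measurable fun ω => ENNReal.ofReal
            (1 / 2 * E.contention n (G.ball M s (M.R / 2)) t ω + Q.driftConst) := fun s =>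
          (((hm t s).const_mul _).add_const _).ennreal_ofReal
        rw [← Finset.sum_congr rfl fun s _ => lintegral_const_mul _ (hm' s),
          ← lintegral_finsetSum _ fun s _ => ((hm' s).const_mul _)]
        refine lintegral_congr fun ω => ?_
        rw [ENNReal.ofReal_sum_of_nonneg fun s _ => mul_nonneg (hα s) (by linarith [hc t s ω])]
        exact Finset.sum_congr rfl fun s _ => (ENNReal.ofReal_mul (hα s)).symm
    _ ≤ _ := by
        refine lintegral_mono fun ω => ENNReal.ofReal_le_ofReal ?_
        have : ∑ s ∈ S, α s * (1 / 2 * E.contention n (G.ball M s (M.R / 2)) t ω + Q.driftConst) =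
            1 / 2 * E.potential G M n S α t ω + (∑ s ∈ S, α s) * Q.driftConst := by
          rw [potential, Finset.mul_sum, Finset.sum_mul, ← Finset.sum_add_distrib]
          exact Finset.sum_congr rfl fun s _ => by ring
        rw [this]
        exact (add_le_add_iff_left _).mpr (mul_le_mul_of_nonneg_right hα3 (by linarith))

end IsLocalBcast

section weights

variable {V : Type*} [Fintype V] {G : Network V} {M : RadioParams}

open scoped Classical in
/-- Weights of balls around the nodes of `S` for which the potential controls the contention in the
vicinity of `v` of radius `K R`, and the interference at `v` from outside its vicinities of radius
`ρ R` and `K R`. -/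
structure IsWeight (G : Network V) (M : RadioParams) (ρ K : ℝ) (v : V) (S : Finset V)
    (α : V → ℝ) : Prop where
  nonneg : ∀ s, 0 ≤ α s
  sum_le : ∑ s ∈ S, α s ≤ 3
  near : ∀ x ∈ G.inBall M v (K * M.R),
    1 ≤ ∑ s ∈ S, if x ∈ G.ball M s (M.R / 2) then M.nearBound K * α s else 0
  mid : ∀ x, x ∉ G.inBall M v (ρ * M.R) → (G.dist M x v) ^ (-M.ζ) ≤
    ∑ s ∈ S, if x ∈ G.ball M s (M.R / 2) then M.farBound ρ * α s else 0
  far : ∀ x, x ∉ G.inBall M v (K * M.R) → (G.dist M x v) ^ (-M.ζ) ≤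
    ∑ s ∈ S, if x ∈ G.ball M s (M.R / 2) then M.farBound K * α s else 0

/-- Each of the three covering weights is normalized to total mass at most 1, and they are added. So
one potential, with one drift constant not depending on ρ and K, serves all purposes; otherwise the
choice of ρ and K below would be circular. -/
theorem Network.Admissible.exists_isWeight (hA : G.Admissible M) {ρ K : ℝ} (hρ : 2 ≤ ρ)
    (hK : 2 ≤ K) (v : V) : ∃ S α, IsWeight G M ρ K v S α := by
  classical
  obtain ⟨S, hS⟩ := hA.exists_isNet
  obtain ⟨a₁, h1, h1s, h1c⟩ := hS.exists_near_weights hA v (by linarith : 0 ≤ K)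
  obtain ⟨a₂, h2, h2s, h2c⟩ := hS.exists_far_weights hA v hρ
  obtain ⟨a₃, h3, h3s, h3c⟩ := hS.exists_far_weights hA v hK
  have b1 := M.nearBound_pos (by linarith : 0 ≤ K)
  have b2 := M.farBound_pos (by linarith : 0 < ρ)
  have b3 := M.farBound_pos (by linarith : 0 < K)
  have e1 : ∀ s, 0 ≤ a₁ s / M.nearBound K := fun s => div_nonneg (h1 s) b1.le
  have e2 : ∀ s, 0 ≤ a₂ s / M.farBound ρ := fun s => div_nonneg (h2 s) b2.le
  have e3 : ∀ s, 0 ≤ a₃ s / M.farBound K := fun s => div_nonneg (h3 s) b3.le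
  have mono : ∀ (x : V) (f f' : V → ℝ), (∀ s, f s ≤ f' s) →
      ∑ s ∈ S, (if x ∈ G.ball M s (M.R / 2) then f s else 0) ≤
        ∑ s ∈ S, if x ∈ G.ball M s (M.R / 2) then f' s else 0 := by
    intro x f f' hf
    refine Finset.sum_le_sum fun s _ => ?_
    split_ifs
    exacts [hf s, le_rfl]
  refine ⟨S, fun s => a₁ s / M.nearBound K + a₂ s / M.farBound ρ + a₃ s / M.farBound K,
    fun s => by have := e1 s; have := e2 s; have := e3 s; linarith, ?_, fun x hx => ?_,
    fun x hx => ?_, fun x hx => ?_⟩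
  · rw [Finset.sum_add_distrib, Finset.sum_add_distrib, ← Finset.sum_div, ← Finset.sum_div,
      ← Finset.sum_div]
    have := (div_le_one b1).mpr h1s
    have := (div_le_one b2).mpr h2s
    have := (div_le_one b3).mpr h3s
    linarith
  · refine (h1c x hx).trans (mono x _ _ fun s => ?_)
    calc a₁ s = M.nearBound K * (a₁ s / M.nearBound K) := by field_simp
      _ ≤ _ := mul_le_mul_of_nonneg_left (by have := e2 s; have := e3 s; linarith) b1.le
  · refine (h2c x hx).trans (mono x _ _ fun s => ?_)
    calc a₂ s = M.farBound ρ * (a₂ s / M.farBound ρ) := by field_simp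
      _ ≤ _ := mul_le_mul_of_nonneg_left (by have := e1 s; have := e3 s; linarith) b2.le
  · refine (h3c x hx).trans (mono x _ _ fun s => ?_)
    calc a₃ s = M.farBound K * (a₃ s / M.farBound K) := by field_simp
      _ ≤ _ := mul_le_mul_of_nonneg_left (by have := e1 s; have := e2 s; linarith) b3.le

end weights

theorem Trace.sum_ofReal_mul_startProb_le {V Ω : Type*} {E : Trace V Ω} {n : ℕ} (hn : 2 ≤ n)
    {I : Finset ℕ} {T : Finset V} {g : V → ℝ}
    (hg : ∀ x ∈ T, 0 ≤ g x) {ω : Ω} {c : ℝ}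
    (hc : ∑ s ∈ I, ∑ x ∈ T, g x * E.startProb n x s ω ≤ c) :
    ∑ s ∈ I, ∑ x ∈ T, ENNReal.ofReal (g x) * ENNReal.ofReal (E.startProb n x s ω) ≤
      ENNReal.ofReal c := by
  refine le_trans (le_of_eq ?_) (ENNReal.ofReal_le_ofReal hc)
  have h0 : ∀ s, ∀ x ∈ T, 0 ≤ g x * E.startProb n x s ω := fun s x hx =>
    mul_nonneg (hg x hx) (startProb_nonneg hn)
  rw [ENNReal.ofReal_sum_of_nonneg fun s _ => Finset.sum_nonneg (h0 s)]
  refine Finset.sum_congr rfl fun s _ => ?_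
  rw [ENNReal.ofReal_sum_of_nonneg (h0 s)]
  exact Finset.sum_congr rfl fun x hx => (ENNReal.ofReal_mul (hg x hx)).symm

/-! ### Counting the bad blocks of each kind -/

namespace IsLocalBcast

variable {V Ω : Type*} [Fintype V] [mΩ : MeasurableSpace Ω] {μ : Measure Ω}
  [IsProbabilityMeasure μ] {ℱ : Filtration ℕ mΩ} {n l a : ℕ} {E : Trace V Ω}
  {G : Network V} {M : RadioParams} {Q : SenseParams} {ρ K : ℝ} {S : Finset V} {α : V → ℝ} {v : V}

section blocks

variable (h : IsLocalBcast μ ℱ n E) (hn : 2 ≤ n) (hV : Fintype.card V ≤ n)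
  (hl : E.LengthBound l) (hW : IsWeight G M ρ K v S α)
include h hn hV hl hW

-- The initial potential is at most 3n/2, which allows y = 2n in the excursion bound.
omit [IsProbabilityMeasure μ] in
theorem measure_countMem_potential_le (hcd : CDSpec M Q ρ G μ ℱ n E) (a J : ℕ) :
    μ ({ω | E.wake v ω = (a : ℕ∞)} ∩ {ω | (J : ℝ) / 40 ≤ countMem (fun j => {ω |
        400 * (3 * Q.driftConst) < E.potential G M n S α (a + j * (16 * l)) ω}) J ω}) ≤
      ENNReal.ofReal (Real.exp (-(J / 400 - Real.log (2 * n)))) *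
        μ {ω | E.wake v ω = (a : ℕ∞)} := by
  have hQ := Q.one_le_driftConst
  have h2 : (2 : ℝ) ≤ n := by exact_mod_cast hn
  refine measure_countMem_lt_le (𝒢 := fun j => ℱ (a + j * (16 * l)))
    (fun i j hij => ℱ.mono (by have := Nat.mul_le_mul_right (16 * l) hij; omega))
    (fun j => ℱ.le _) ?_ (Y := fun j => E.potential G M n S α (a + j * (16 * l)))
    (fun j => h.measurable_potential _) (fun j ω => potential_nonneg hn hW.nonneg)
    (C := 3 * Q.driftConst) (by linarith) (fun j B hB => ?_) (y := 2 * n) (by positivity)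
    (fun ω _ => ?_) J
  · exact h.measurableSet_wake v (by omega)
  · have := h.setLIntegral_potential_le hn hV hl hcd hW.nonneg hW.sum_le _ hB
    rwa [show a + j * (16 * l) + 16 * l = a + (j + 1) * (16 * l) by ring] at this
  · have := potential_le (ω := ω) (t := a + 0 * (16 * l)) (G := G) (M := M) hn hV hl hW.nonneg
      hW.sum_le
    nlinarith

/-- The conditional probability of such a block is at most 1/160, so the compensator is J/80 and a
count of J/40 exceeds it by J/80. -/
theorem measure_countMem_busy_le (hcd : CDSpec M Q ρ G μ ℱ n E) (hρ : 0 < ρ)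
    {L η : ℝ} (hη : 0 < η)
    (hδ : 33 * (1 - Q.h₂ ^ (-(4 ^ 16 * (2 * η)))) +
      M.P * (33 * 4 ^ 16 * M.farBound ρ * (L + 3 / 2)) / Q.Icd ≤ 1 / 160) (hL : 0 ≤ L) (a J : ℕ) :
    μ ({ω | E.wake v ω = (a : ℕ∞)} ∩ {ω | (J : ℝ) / 40 ≤ countMem (fun j => {ω |
        (E.potential G M n S α (a + j * (16 * l)) ω ≤ L ∧
          E.contention n (G.inBall M v (ρ * M.R)) (a + j * (16 * l)) ω ≤ η) ∧
        E.wokenMass n (G.inBall M v (ρ * M.R)) (a + j * (16 * l)) (a + j * (16 * l) + 16 * l) ω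
          ≤ η ∧
        ∃ i ∈ E.innerRounds l v (a + j * (16 * l)) a, E.wake v ω = (a : ℕ∞) ∧ E.busy v i ω})
        J ω}) ≤
      ENNReal.ofReal (Real.exp (-(J / 80))) * μ {ω | E.wake v ω = (a : ℕ∞)} := by
  classical
  set D := G.inBall M v (ρ * M.R)
  have hf := M.farBound_pos hρ
  have hP := M.P_pos
  have key := measure_countMem_ge_le (μ := μ) (𝒢 := fun j => ℱ (a + j * (16 * l)))
    (fun i j hij => ℱ.mono (by have := Nat.mul_le_mul_right (16 * l) hij; omega))
    (fun j => ℱ.le _) (h.measurableSet_wake v (by omega : a ≤ a + 0 * (16 * l)))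
    (F := fun j => {ω |
        (E.potential G M n S α (a + j * (16 * l)) ω ≤ L ∧
          E.contention n D (a + j * (16 * l)) ω ≤ η) ∧
        E.wokenMass n D (a + j * (16 * l)) (a + j * (16 * l) + 16 * l) ω ≤ η ∧
        -- Repeating the starting tick makes the event measurable: it fixes the tick at which round
        -- i ends.
        ∃ i ∈ E.innerRounds l v (a + j * (16 * l)) a, E.wake v ω = (a : ℕ∞) ∧ E.busy v i ω})
    (fun j => ?_) (δ := 1 / 160) (by norm_num) (fun j B hB hBA => ?_) J (J / 40)
  · refine key.trans (le_of_eq ?_)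
    congr 4
    ring
  · have e : a + (j + 1) * (16 * l) = a + j * (16 * l) + 16 * l := by ring
    have hm := ℱ.mono (show a + j * (16 * l) ≤ a + (j + 1) * (16 * l) by omega)
    refine MeasurableSet.inter (MeasurableSet.inter ?_ ?_) (MeasurableSet.inter ?_ ?_)
    · exact hm _ (measurableSet_le (h.measurable_potential _) measurable_const)
    · exact hm _ (measurableSet_le (h.measurable_contention _ _) measurable_const)
    · rw [e]
      exact measurableSet_le (h.measurable_wokenMass _ _ _) measurable_const
    · have : {ω | ∃ i ∈ E.innerRounds l v (a + j * (16 * l)) a,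
          E.wake v ω = (a : ℕ∞) ∧ E.busy v i ω} =
          ⋃ i ∈ E.innerRounds l v (a + j * (16 * l)) a,
            {ω | E.wake v ω = (a : ℕ∞) ∧ E.busy v i ω} := by
        ext ω
        simp only [Set.mem_ofPred_eq, Set.mem_iUnion, exists_prop]
      change MeasurableSet[ℱ (a + (j + 1) * (16 * l))] {ω | ∃ i ∈ E.innerRounds l v (a + j * (16 * l)) a,
          E.wake v ω = (a : ℕ∞) ∧ E.busy v i ω}
      rw [this]
      refine @Finset.measurableSet_biUnion _ _ (ℱ _) _ _ fun i hi => h.measurableSet_wake_busy v ?_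
      rw [e]
      exact ((mem_innerRounds hl).mp hi).2
  · set t := a + j * (16 * l)
    have hB' : MeasurableSet[ℱ t]
        (B ∩ {ω | E.potential G M n S α t ω ≤ L ∧ E.contention n D t ω ≤ η}) :=
      hB.inter ((measurableSet_le (h.measurable_potential _) measurable_const).inter
        (measurableSet_le (h.measurable_contention _ _) measurable_const))
    have := h.measure_inter_busy_le hn hl hcd v hB' (fun ω hω => hBA hω.1)
      (c := M.P * (33 * 4 ^ 16 * M.farBound ρ * (L + 3 / 2))) hη
      (by positivity) (fun ω hω => hω.2.2) (fun ω hω => ?_)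
    · refine le_trans (measure_mono ?_) (this.trans (mul_le_mul'
        (ENNReal.ofReal_le_ofReal hδ) (measure_mono Set.inter_subset_left)))
      rintro ω ⟨h1, h2, h3, i, hi, -, h4⟩
      exact ⟨⟨h1, h2⟩, h3, i, hi, h4⟩
    · refine sum_ofReal_mul_startProb_le hn (fun x hx => ?_) ?_
      · refine (Network.signal_pos fun e => ?_).le
        rw [Finset.mem_sdiff, e, Network.mem_inBall, Network.dist_self] at hx
        exact hx.2 (mul_pos hρ M.R_pos)
      · have h5 := sum_mul_startProb_le (ω := ω) (t := t) hn hV hl hW.nonneg hW.sum_le hf.le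
          (g := fun x => (G.dist M x v) ^ (-M.ζ))
          (fun x => Real.rpow_nonneg (Network.dist_nonneg x v) _) (T := Finset.univ \ D)
          (fun x hx => hW.mid x (Finset.mem_sdiff.mp hx).2) 16
        have h6 : (2 * ((16 : ℕ) : ℝ) + 1) * 4 ^ 16 * M.farBound ρ *
            (E.potential G M n S α t ω + 3 / 2) ≤ 33 * 4 ^ 16 * M.farBound ρ * (L + 3 / 2) := by
          norm_num
          exact mul_le_mul_of_nonneg_left (by linarith [hω.2.1]) (by positivity)
        refine le_trans (le_of_eq ?_) (mul_le_mul_of_nonneg_left (h5.trans h6) hP.le)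
        rw [Finset.mul_sum]
        refine Finset.sum_congr rfl fun s _ => ?_
        rw [Finset.mul_sum]
        refine Finset.sum_congr rfl fun x hx => ?_
        rw [Network.signal_eq, mul_assoc]
        rintro rfl
        rw [Finset.mem_sdiff, Network.mem_inBall, Network.dist_self] at hx
        exact hx.2 (mul_pos hρ M.R_pos)

/-- Many trials with constant success probability, but at most |D| successes. The condition ρ + ρc ≤
K puts the clear zones of the nodes of D inside D(v, KR), and 2ρ ≤ K makes the distances of an
outside node to v and to a node of D comparable up to a factor of 2. -/
theorem measure_countMem_contention_le {ρc Ic Iack θ : ℝ} (hsc : E.SuccClear G M ρc Ic)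
    (hack : E.AckSpec G M Iack) (hA : G.Admissible M) (hρ : 0 < ρ) (hK1 : 2 * ρ ≤ K)
    (hK2 : ρ + ρc ≤ K) (hθ : 0 < θ) (hI : 3 * θ ≤ Ic) (hIa : 3 * θ ≤ Iack)
    {L η q : ℝ} (hη : 0 ≤ η) (hη1 : η ≤ 1) (hL : 0 ≤ L)
    (hKθ : 2 ^ M.ζ * M.P * (7 * 4 ^ 3 * M.farBound K * (L + 3 / 2)) ≤ θ / 2)
    (hq : 7 * 4 ^ 3 * M.nearBound K * (L + 3 / 2) ≤ q) (a J : ℕ) (N : ℝ) :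
    μ ({ω | E.wake v ω = (a : ℕ∞)} ∩ {ω | N ≤ countMem (fun j => {ω |
        E.potential G M n S α (a + j * (16 * l)) ω ≤ L ∧
          η ≤ E.contention n (G.inBall M v (ρ * M.R)) (a + j * (16 * l)) ω}) J ω}) ≤
      ENNReal.ofReal (Real.exp (-(Real.exp (-(6 * q)) * η / 256 / 2 * N -
          Real.log 2 * (G.inBall M v (ρ * M.R)).card))) * μ {ω | E.wake v ω = (a : ℕ∞)} := by
  classical
  set D := G.inBall M v (ρ * M.R)
  have hR := M.R_pos
  have hP := M.P_pos
  have hζ := M.ζ_pos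
  have hK0 : 0 < K := by linarith
  have hf := M.farBound_pos hK0
  have hnb := M.nearBound_pos hK0.le
  have hq0 : 0 ≤ q := le_trans (by positivity) hq
  have hc1 : Real.exp (-(6 * q)) * η / 256 ≤ 1 := by
    have : Real.exp (-(6 * q)) ≤ 1 := Real.exp_le_one_iff.mpr (by linarith)
    have := mul_le_mul this hη1 hη zero_le_one
    linarith
  refine le_trans (measure_mono (Set.inter_subset_inter_right _ fun ω hω => ?_))
    (measure_countMem_ge_and_le (μ := μ) (𝒢 := fun j => ℱ (a + j * (16 * l)))
    (fun i j hij => ℱ.mono (by have := Nat.mul_le_mul_right (16 * l) hij; omega))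
    (fun j => ℱ.le _) (h.measurableSet_wake v (by omega : a ≤ a + 0 * (16 * l)))
    (T := fun j => {ω | E.potential G M n S α (a + j * (16 * l)) ω ≤ L ∧
          η ≤ E.contention n D (a + j * (16 * l)) ω})
    (S := fun j => {ω | ∃ w ∈ D, ¬ E.StoppedBy w (a + j * (16 * l)) ω ∧
      E.StoppedBy w (a + j * (16 * l) + 16 * l) ω})
    (fun j => ?_) (fun j => ?_) (by positivity) hc1 (fun j B hB hBA hBT => ?_) J N D.card)
  · exact ⟨hω, Nat.cast_le.mpr (countMem_stopped_le D J)⟩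
  · exact (measurableSet_le (h.measurable_potential _) measurable_const).inter
      (measurableSet_le measurable_const (h.measurable_contention _ _))
  · have : {ω | ∃ w ∈ D, ¬ E.StoppedBy w (a + j * (16 * l)) ω ∧
      E.StoppedBy w (a + j * (16 * l) + 16 * l) ω} =
        ⋃ w ∈ D, {ω | E.StoppedBy w (a + j * (16 * l)) ω}ᶜ ∩
          {ω | E.StoppedBy w (a + j * (16 * l) + 16 * l) ω} := by
      ext ω
      simp only [Set.mem_ofPred_eq, Set.mem_iUnion, Set.mem_inter_iff, Set.mem_compl_iff,
        exists_prop]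
    rw [this, show a + (j + 1) * (16 * l) = a + j * (16 * l) + 16 * l by ring]
    exact Finset.measurableSet_biUnion _ fun w _ =>
      (ℱ.mono (Nat.le_add_right _ _) _ (h.measurableSet_stoppedBy w _)).compl.inter
        (h.measurableSet_stoppedBy w _)
  · set t := a + j * (16 * l)
    have hDv : ∀ w ∈ D, G.dist M w v < ρ * M.R := fun w hw => Network.mem_inBall.mp hw
    have hKR : 2 * (ρ * M.R) ≤ K * M.R := by
      rw [← mul_assoc]; exact mul_le_mul_of_nonneg_right hK1 hR.le
    have hKR2 : ρ * M.R + ρc * M.R ≤ K * M.R := by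
      rw [← add_mul]; exact mul_le_mul_of_nonneg_right hK2 hR.le
    have hpos : 0 < ρ * M.R := mul_pos hρ hR
    refine h.le_measure_inter_stopped hn hl hsc hack (D₁ := D) (D₃ := G.inBall M v (K * M.R))
      (g := fun x => ENNReal.ofReal (2 ^ M.ζ * M.P * (G.dist M x v) ^ (-M.ζ)))
      (fun w hw => Network.mem_inBall.mpr (by linarith [hDv w hw])) (fun w hw x hx => ?_)
      (fun w hw x hx => ENNReal.ofReal_le_ofReal ?_) hθ hI hIa hB hη hη1 hq0 (fun ω hω => ?_)
      (fun ω hω => ?_) (fun ω hω => (hBT hω).2)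
    · have h1 := hA.metricity x v w
      have h2 := Network.mem_inBall.mp hx
      exact Network.mem_inBall.mpr (by linarith [hDv w hw])
    · rw [Network.mem_inBall, not_lt] at hx
      have h1 := hA.metricity x v w
      have h2 := hDv w hw
      have h3 : 0 < G.dist M x v / 2 := by linarith
      rw [Network.signal_eq (fun e => by rw [e] at hx; linarith)]
      calc M.P * (G.dist M x w) ^ (-M.ζ) ≤ M.P * (G.dist M x v / 2) ^ (-M.ζ) :=
            mul_le_mul_of_nonneg_left (Real.rpow_le_rpow_of_nonpos h3 (by linarith) (by linarith))
              hP.le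
        _ = _ := by
            rw [Real.div_rpow (by linarith) (by norm_num),
              Real.rpow_neg (by norm_num : (0 : ℝ) ≤ 2), div_inv_eq_mul]
            ring
    · have h5 := sum_mul_startProb_le (ω := ω) (t := t) hn hV hl hW.nonneg hW.sum_le hnb.le
        (g := fun _ => 1) (fun _ => zero_le_one) (T := G.inBall M v (K * M.R))
        (fun x hx => hW.near x hx) 3
      simp only [one_mul] at h5
      refine h5.trans (le_trans ?_ hq)
      norm_num
      exact mul_le_mul_of_nonneg_left (by linarith [(hBT hω).1]) (by positivity)
    · refine sum_ofReal_mul_startProb_le hn (fun x hx => ?_) ?_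
      · have := Real.rpow_nonneg (Network.dist_nonneg (G := G) (M := M) x v) (-M.ζ)
        positivity
      · have h5 := sum_mul_startProb_le (ω := ω) (t := t) hn hV hl hW.nonneg hW.sum_le hf.le
          (g := fun x => (G.dist M x v) ^ (-M.ζ))
          (fun x => Real.rpow_nonneg (Network.dist_nonneg x v) _)
          (T := Finset.univ \ G.inBall M v (K * M.R))
          (fun x hx => hW.far x (Finset.mem_sdiff.mp hx).2) 3
        have h6 : (2 * ((3 : ℕ) : ℝ) + 1) * 4 ^ 3 * M.farBound K *
            (E.potential G M n S α t ω + 3 / 2) ≤ 7 * 4 ^ 3 * M.farBound K * (L + 3 / 2) := by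
          norm_num
          exact mul_le_mul_of_nonneg_left (by linarith [(hBT hω).1]) (by positivity)
        refine le_trans (le_of_eq ?_) ((mul_le_mul_of_nonneg_left (h5.trans h6)
          (by positivity : 0 ≤ 2 ^ M.ζ * M.P)).trans hKθ)
        rw [Finset.mul_sum]
        refine Finset.sum_congr rfl fun s _ => ?_
        rw [Finset.mul_sum]
        exact Finset.sum_congr rfl fun x hx => by ring

end blocks

end IsLocalBcast

/-! ### The running time of LocalBcast -/

namespace IsLocalBcast

variable {V Ω : Type*} [Fintype V] [mΩ : MeasurableSpace Ω] {μ : Measure Ω}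
  [IsProbabilityMeasure μ] {ℱ : Filtration ℕ mΩ} {n l a : ℕ} {E : Trace V Ω}
  {G : Network V} {M : RadioParams} {Q : SenseParams} {ρ K : ℝ} {S : Finset V} {α : V → ℝ} {v : V}

/-- Given the tick at which `v` starts, `v` is unlikely to run for many blocks. -/
theorem measure_wake_inter_not_stoppedBy_le (h : IsLocalBcast μ ℱ n E) (hn : 2 ≤ n)
    (hV : Fintype.card V ≤ n) (hl : E.LengthBound l) (hW : IsWeight G M ρ K v S α)
    {ρc Ic Iack θ : ℝ} (hsc : E.SuccClear G M ρc Ic) (hack : E.AckSpec G M Iack)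
    (hcd : CDSpec M Q ρ G μ ℱ n E) (hA : G.Admissible M) (hρ : 0 < ρ) (hK1 : 2 * ρ ≤ K)
    (hK2 : ρ + ρc ≤ K) (hθ : 0 < θ) (hI : 3 * θ ≤ Ic) (hIa : 3 * θ ≤ Iack)
    {L η q : ℝ} (hη : 0 < η) (hη1 : η ≤ 1) (hη2 : 4 ^ 16 * (2 * η) < 1 / 2)
    (hL : L = 400 * (3 * Q.driftConst))
    (hδ : 33 * (1 - Q.h₂ ^ (-(4 ^ 16 * (2 * η)))) +
      M.P * (33 * 4 ^ 16 * M.farBound ρ * (L + 3 / 2)) / Q.Icd ≤ 1 / 160)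
    (hKθ : 2 ^ M.ζ * M.P * (7 * 4 ^ 3 * M.farBound K * (L + 3 / 2)) ≤ θ / 2)
    (hq : 7 * 4 ^ 3 * M.nearBound K * (L + 3 / 2) ≤ q) (a J : ℕ) (hJn : Real.log n < J)
    (hJη : 20 / η < J) {z : ℝ} (hz1 : z ≤ J / 400 - Real.log (2 * n))
    (hz2 : z ≤ Real.exp (-(6 * q)) * η / 256 / 2 * (J / 40) -
      Real.log 2 * (G.inBall M v (ρ * M.R)).card) (hz3 : z ≤ J / 80) :
    μ ({ω | E.wake v ω = (a : ℕ∞)} ∩ {ω | ¬ E.StoppedBy v (a + J * (16 * l)) ω}) ≤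
      ENNReal.ofReal (3 * Real.exp (-z)) * μ {ω | E.wake v ω = (a : ℕ∞)} := by
  classical
  set D := G.inBall M v (ρ * M.R) with hD
  have hQ := Q.one_le_driftConst
  have hL0 : 0 ≤ L := by linarith
  set A := {ω | E.wake v ω = (a : ℕ∞)} with hAdef
  have b1 := h.measure_countMem_potential_le hn hV hl hW hcd a J
  have b2 := h.measure_countMem_contention_le hn hV hl hW hsc hack hA hρ hK1 hK2 hθ hI hIa hη.le
    hη1 hL0 hKθ hq a J (J / 40)
  have b3 := h.measure_countMem_busy_le hn hV hl hW hcd hρ hη hδ hL0 a J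
  rw [← hL] at b1
  rw [← hD] at b2 b3
  have hbound : ∀ x : ℝ, z ≤ x → ENNReal.ofReal (Real.exp (-x)) * μ A ≤
      ENNReal.ofReal (Real.exp (-z)) * μ A := fun x hx =>
    mul_le_mul_left (ENNReal.ofReal_le_ofReal (Real.exp_le_exp.mpr (by linarith))) _
  refine le_trans (measure_mono ?_) ((measure_union_le _ _).trans (add_le_add
    ((measure_union_le _ _).trans (add_le_add (b1.trans (hbound _ hz1)) (b2.trans (hbound _ hz2))))
    (b3.trans (hbound _ hz3)))) |>.trans (le_of_eq ?_)
  · rintro ω ⟨hω, hns⟩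
    by_contra hcon
    simp only [Set.mem_union, not_or, Set.mem_inter_iff, not_and, Set.mem_ofPred_eq, not_le]
      at hcon
    obtain ⟨⟨c1, c2⟩, c3⟩ := hcon
    replace c1 := c1 hω
    replace c2 := c2 hω
    replace c3 := c3 hω
    have c4 := card_wokenMass_lt (E := E) (a := a) (l := l) (ω := ω) hn hV D hη hJη
    set F : (ℕ → Set Ω) → Finset ℕ := fun B => (Finset.range J).filter fun j => ω ∈ B j with hFdef
    have hF : ∀ B j, j ∈ F B ↔ j < J ∧ ω ∈ B j := fun B j => by
      rw [hFdef, Finset.mem_filter, Finset.mem_range]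
    have hFc : ∀ B, countMem B J ω = (F B).card := fun B => rfl
    -- Four kinds of bad blocks: large potential, high contention near v, a Busy outcome despite low
    -- contention, and many starting nodes. Each accounts for at most J/40 blocks.
    refine hns (stoppedBy_of_count_le hn hl hω (bad :=
      (F fun j => {ω | L < E.potential G M n S α (a + j * (16 * l)) ω}) ∪
      (F fun j => {ω | E.potential G M n S α (a + j * (16 * l)) ω ≤ L ∧
          η ≤ E.contention n D (a + j * (16 * l)) ω}) ∪
      (F fun j => {ω |
        (E.potential G M n S α (a + j * (16 * l)) ω ≤ L ∧
          E.contention n D (a + j * (16 * l)) ω ≤ η) ∧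
        E.wokenMass n D (a + j * (16 * l)) (a + j * (16 * l) + 16 * l) ω ≤ η ∧
        ∃ i ∈ E.innerRounds l v (a + j * (16 * l)) a, E.wake v ω = (a : ℕ∞) ∧ E.busy v i ω}) ∪
      (F fun j => {ω |
        η < E.wokenMass n D (a + j * (16 * l)) (a + j * (16 * l) + 16 * l) ω}))
      (fun j hj hjb => ?_) ?_ hJn)
    · simp only [Finset.mem_union, hF, Set.mem_ofPred_eq, not_or,
        not_and, not_lt, not_le] at hjb
      obtain ⟨⟨⟨d1, d2⟩, d3⟩, d4⟩ := hjb
      replace d1 := d1 hj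
      replace d2 := d2 hj d1
      replace d4 := d4 hj
      refine ⟨fun i hi hb => d3 hj ⟨d1, d2.le⟩ d4 ⟨i, hi, hω, hb⟩, fun s hs1 hs2 => ?_⟩
      -- In a good block the contention of D, to which v belongs, remains below 1/2, so v is never
      -- capped.
      have hc := contention_le_of_wokenMass (ω := ω) (t := a + j * (16 * l)) hn hl D (m := 16) hs1
        hs2
      have hvD : v ∈ D := by
        rw [hD, Network.mem_inBall, Network.dist_self]
        exact mul_pos hρ M.R_pos
      have hsingle : E.curProb n v s ω ≤ E.contention n D s ω :=
        Finset.single_le_sum (f := fun w => E.curProb n w s ω) (fun _ _ => curProb_nonneg hn) hvD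
      have : (4 : ℝ) ^ 16 * (E.contention n D (a + j * (16 * l)) ω +
          E.wokenMass n D (a + j * (16 * l)) (a + j * (16 * l) + 16 * l) ω) ≤
          4 ^ 16 * (2 * η) := mul_le_mul_of_nonneg_left (by linarith) (by positivity)
      linarith
    · rw [hFc] at c1 c2 c3 c4
      refine le_trans (Nat.cast_le.mpr ((Finset.card_union_le _ _).trans (Nat.add_le_add_right
        ((Finset.card_union_le _ _).trans (Nat.add_le_add_right (Finset.card_union_le _ _) _)) _)))
        ?_
      push_cast
      linarith
  · rw [← add_mul, ← add_mul, ← ENNReal.ofReal_add (Real.exp_pos _).le (Real.exp_pos _).le,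
      ← ENNReal.ofReal_add (by positivity) (Real.exp_pos _).le]
    congr 2
    ring

omit [Fintype V] [IsProbabilityMeasure μ] in
theorem measure_wake_ne_top_inter_le (h : IsLocalBcast μ ℱ n E) [IsProbabilityMeasure μ]
    {B : Set Ω} {ε : ℝ≥0∞} (v : V)
    (hB : ∀ a : ℕ, μ ({ω | E.wake v ω = (a : ℕ∞)} ∩ B) ≤ ε * μ {ω | E.wake v ω = (a : ℕ∞)}) :
    μ {ω | E.wake v ω ≠ ⊤ ∧ ω ∈ B} ≤ ε := by
  have hsub : {ω | E.wake v ω ≠ ⊤ ∧ ω ∈ B} ⊆ ⋃ a : ℕ, {ω | E.wake v ω = (a : ℕ∞)} ∩ B := by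
    rintro ω ⟨h1, h2⟩
    obtain ⟨a, ha⟩ := ENat.ne_top_iff_exists.mp h1
    exact Set.mem_iUnion.mpr ⟨a, ha.symm, h2⟩
  calc _ ≤ ∑' a : ℕ, μ ({ω | E.wake v ω = (a : ℕ∞)} ∩ B) :=
        (measure_mono hsub).trans (measure_iUnion_le _)
    _ ≤ ∑' a : ℕ, ε * μ {ω | E.wake v ω = (a : ℕ∞)} := ENNReal.tsum_le_tsum hB
    _ = ε * μ (⋃ a : ℕ, {ω | E.wake v ω = (a : ℕ∞)}) := by
        rw [ENNReal.tsum_mul_left, measure_iUnion (fun a b hab => ?_)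
          fun a => ℱ.le a _ (h.wake_adapted v a)]
        refine Set.disjoint_left.mpr fun ω h1 h2 => hab ?_
        have : (a : ℕ∞) = b := h1.symm.trans h2
        exact_mod_cast this
    _ ≤ ε * 1 := mul_le_mul_right prob_le_one _
    _ = ε := mul_one _

end IsLocalBcast

namespace Trace

/-- A stop requires an acknowledgement, which is never given without mass delivery. As rounds have
at least l/2 ticks, J blocks contain at most 32 J rounds. -/
theorem StoppedBy.completesWithin {V Ω : Type*} [Fintype V] {E : Trace V Ω} {l a J : ℕ} {v : V}
    {ω : Ω} {G : Network V} {M : RadioParams} {Iack T : ℝ} (hl : E.LengthBound l)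
    (hack : E.AckSpec G M Iack) (hw : E.wake v ω = a) (hs : E.StoppedBy v (a + J * (16 * l)) ω)
    (hT : 32 * (J : ℝ) ≤ T) : E.CompletesWithin G M v T ω := by
  obtain ⟨i, b, hb, h1, htx, hack'⟩ := hs
  have hab : a = b := by
    have : (a : ℕ∞) = b := hw.symm.trans hb
    exact_mod_cast this
  subst hab
  refine ⟨i, le_trans ?_ hT, by_contra fun hm => hack.negative v i ω htx hm hack'⟩
  have h2 : (i + 1) * E.len v ≤ 32 * J * E.len v := by
    have h3 := Nat.mul_le_mul_left (J * 16) (hl.le_two_mul v)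
    calc (i + 1) * E.len v ≤ J * (16 * l) := by omega
      _ = J * 16 * l := by ring
      _ ≤ J * 16 * (2 * E.len v) := h3
      _ = _ := by ring
  exact_mod_cast Nat.le_of_mul_le_mul_right h2 (hl.pos v)

end Trace

theorem three_mul_exp_neg_le {n : ℕ} (hn : 2 ≤ n) (κ : ℝ) :
    3 * Real.exp (-((κ + 2) * Real.log n)) ≤ (n : ℝ) ^ (-κ) := by
  have hnR : (2 : ℝ) ≤ n := by exact_mod_cast hn
  rw [Real.rpow_def_of_pos (by linarith), show -((κ + 2) * Real.log n) =
    Real.log n * -κ + -(2 * Real.log n) by ring, Real.exp_add]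
  have : Real.exp (-(2 * Real.log n)) ≤ 1 / 4 := by
    rw [show -(2 * Real.log n) = -(Real.log n) + -(Real.log n) by ring, Real.exp_add,
      Real.exp_neg, Real.exp_log (by linarith)]
    have : (n : ℝ)⁻¹ ≤ 2⁻¹ := inv_anti₀ (by norm_num) hnR
    have h0 : 0 ≤ (n : ℝ)⁻¹ := by positivity
    nlinarith
  have h0 := Real.exp_pos (Real.log n * -κ)
  nlinarith

/-- The summands of c₁ serve, in this order, the excursions of the potential, the trials with high
contention, and the blocks with many starting nodes. With z = (κ + 2) log n, the spare factor n²
absorbs the three tail bounds. -/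
theorem IsLocalBcast.measure_not_completesWithin_le {V Ω : Type*} [Fintype V]
    [mΩ : MeasurableSpace Ω] {μ : Measure Ω} [IsProbabilityMeasure μ] {ℱ : Filtration ℕ mΩ} {n : ℕ}
    {E : Trace V Ω} {G : Network V} {M : RadioParams} {Q : SenseParams} {ρ K : ℝ}
    (h : IsLocalBcast μ ℱ n E) (hn : 2 ≤ n) (hV : Fintype.card V ≤ n)
    {ρc Ic θ : ℝ} (hsc : E.SuccClear G M ρc Ic) (hack : E.AckSpec G M Q.Iack)
    (hcd : CDSpec M Q ρ G μ ℱ n E) (hA : G.Admissible M) (hρ : 2 ≤ ρ) (hK1 : 2 * ρ ≤ K)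
    (hK2 : ρ + ρc ≤ K) (hθ : 0 < θ) (hI : 3 * θ ≤ Ic) (hIa : 3 * θ ≤ Q.Iack)
    {L η q : ℝ} (hη : 0 < η) (hη1 : η ≤ 1) (hη2 : 4 ^ 16 * (2 * η) < 1 / 2)
    (hL : L = 400 * (3 * Q.driftConst))
    (hδ : 33 * (1 - Q.h₂ ^ (-(4 ^ 16 * (2 * η)))) +
      M.P * (33 * 4 ^ 16 * M.farBound ρ * (L + 3 / 2)) / Q.Icd ≤ 1 / 160)
    (hKθ : 2 ^ M.ζ * M.P * (7 * 4 ^ 3 * M.farBound K * (L + 3 / 2)) ≤ θ / 2)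
    (hq : 7 * 4 ^ 3 * M.nearBound K * (L + 3 / 2) ≤ q) {c c₁ κ : ℝ}
    (hc : c = Real.exp (-(6 * q)) * η / 256) (hκ : 0 < κ)
    (hc₁ : c₁ = 400 * (κ + 4) + 80 / c * (κ + 3) + 20 / η) (v : V) :
    μ {ω | E.wake v ω ≠ ⊤ ∧ ¬ E.CompletesWithin G M v
        (32 * (c₁ + 1) * ((G.inBall M v (ρ * M.R)).card + Real.log n)) ω}
      ≤ ENNReal.ofReal ((n : ℝ) ^ (-κ)) := by
  have hlog2 : 0 < Real.log 2 := Real.log_pos (by norm_num)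
  have hlog2' := Real.log_two_lt_d9
  have hc0 : 0 < c := by rw [hc]; positivity
  have hnR : (2 : ℝ) ≤ n := by exact_mod_cast hn
  have hlogn : Real.log 2 ≤ Real.log n := Real.log_le_log (by norm_num) hnR
  obtain ⟨l, hl⟩ := h.exists_lengthBound v
  obtain ⟨S, α, hW⟩ := hA.exists_isWeight hρ (by linarith : 2 ≤ K) v
  have hD1 : (1 : ℝ) ≤ (G.inBall M v (ρ * M.R)).card := by
    rw [Nat.one_le_cast]
    refine Finset.card_pos.mpr ⟨v, ?_⟩
    rw [Network.mem_inBall, Network.dist_self]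
    exact mul_pos (by linarith) M.R_pos
  have main := fun a J : ℕ => h.measure_wake_inter_not_stoppedBy_le hn hV hl hW hsc hack hcd hA
    (by linarith) hK1 hK2 hθ hI hIa hη hη1 hη2 hL hδ hKθ hq a J
  generalize (((G.inBall M v (ρ * M.R)).card : ℕ) : ℝ) = d at hD1 main ⊢
  rw [← hc] at main
  set X := d + Real.log n with hX
  have hX1 : 1 ≤ X := by linarith
  have p1 : 0 < 400 * (κ + 4) * X := by positivity
  have p2 : 0 < 80 / c * (κ + 3) * X := by positivity
  have p3 : 20 / η ≤ 20 / η * X := le_mul_of_one_le_right (by positivity) hX1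
  have p4 : 0 < 20 / η := by positivity
  have p5 : (κ + 4) * Real.log n ≤ (κ + 4) * X :=
    mul_le_mul_of_nonneg_left (by linarith) (by linarith)
  have p6 : 0 < κ * Real.log n := mul_pos hκ (by linarith)
  have p7 : c₁ * X = 400 * (κ + 4) * X + 80 / c * (κ + 3) * X + 20 / η * X := by
    rw [hc₁]; ring
  set J := ⌈c₁ * X⌉₊
  have hJ1 : c₁ * X ≤ J := Nat.le_ceil _
  have hJ2 : (J : ℝ) < c₁ * X + 1 := Nat.ceil_lt_add_one (by linarith)
  have main' := fun a : ℕ => main a J (by linarith) (by linarith) (z := (κ + 2) * Real.log n)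
    (by rw [Real.log_mul (by norm_num) (by positivity)]; linarith)
    (by
      have e : c * (80 / c * (κ + 3) * X) = 80 * ((κ + 3) * X) := by field_simp
      have e1 : 80 * ((κ + 3) * X) ≤ c * J := by
        rw [← e]; exact mul_le_mul_of_nonneg_left (by linarith) hc0.le
      have e2 : (κ + 3) * X = (κ + 2) * Real.log n + (Real.log n + (κ + 3) * d) := by
        rw [hX]; ring
      have e3 : Real.log 2 * d ≤ (κ + 3) * d :=
        mul_le_mul_of_nonneg_right (by linarith) (by positivity)
      linarith)
    (by linarith)
  refine (h.measure_wake_ne_top_inter_le v (B := {ω | ¬ E.CompletesWithin G M v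
    (32 * (c₁ + 1) * X) ω}) fun a => ?_).trans (ENNReal.ofReal_le_ofReal
      (three_mul_exp_neg_le hn κ))
  refine (measure_mono ?_).trans (main' a)
  rintro ω ⟨h1, h2⟩
  refine ⟨h1, fun hs => h2 (hs.completesWithin hl hack h1 ?_)⟩
  rw [mul_assoc]
  exact mul_le_mul_of_nonneg_left (by linarith) (by norm_num)

/-- The running time of LocalBcast. -/
theorem localBcast_completes (M : RadioParams) (Q : SenseParams) (ρc Ic : ℝ) (hIc : 0 < Ic) :
    ∃ ρ₀ : ℝ, 1 < ρ₀ ∧ ∀ ρ : ℝ, ρ₀ ≤ ρ → ∀ κ : ℝ, 0 < κ → ∃ C C' : ℝ, 0 < C ∧ 0 < C' ∧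
      ∀ (V : Type) [Fintype V] (G : Network V) (n : ℕ),
        G.Admissible M → Fintype.card V ≤ n →
        (∀ (Ω : Type) [mΩ : MeasurableSpace Ω] (μ : Measure Ω) [IsProbabilityMeasure μ]
          (ℱ : Filtration ℕ mΩ) (E : Trace V Ω),
          IsLocalBcast μ ℱ n E → E.SuccClear G M ρc Ic → E.AckSpec G M Q.Iack →
          CDSpec M Q ρ G μ ℱ n E →
          ∀ v : V, μ {ω | E.wake v ω ≠ ⊤ ∧ ¬ E.CompletesWithin G M v
              (C * ((G.inBall M v (ρ * M.R)).card + Real.log n)) ω}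
            ≤ ENNReal.ofReal ((n : ℝ) ^ (-κ))) ∧
        (2 * M.rmin ≤ (1 - M.ε) * M.R → ∀ v : V,
          C * ((G.inBall M v (ρ * M.R)).card + Real.log n)
            ≤ C' * (G.maxDegree M + Real.log n)) := by
  set L := 400 * (3 * Q.driftConst) with hL
  have hQ := Q.one_le_driftConst
  have hIcd := Q.Icd_pos
  have hlog2 : 0 < Real.log 2 := Real.log_pos (by norm_num)
  have hlog2' := Real.log_two_lt_d9
  have hfar : ∀ c : ℝ, Filter.Tendsto (fun ρ => c * M.farBound ρ) Filter.atTop (nhds 0) :=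
    fun c => by simpa using M.tendsto_farBound.const_mul c
  -- Half of the error budget 1/160 for Busy outcomes goes to the interference from outside, via ρ,
  -- the other half to the contention η inside.
  obtain ⟨ρ₁, hρ₁⟩ := Filter.eventually_atTop.mp ((hfar (M.P * (33 * 4 ^ 16 * (L + 3 / 2)) /
    Q.Icd)).eventually_le_const (by norm_num : (0 : ℝ) < 1 / 320))
  refine ⟨max ρ₁ 2, lt_of_lt_of_le one_lt_two (le_max_right _ _), fun ρ hρ κ hκ => ?_⟩
  have hρ2 : 2 ≤ ρ := (le_max_right _ _).trans hρ
  have hρδ := hρ₁ ρ ((le_max_left _ _).trans hρ)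
  obtain ⟨η, hη, hη1, hη2, hηδ⟩ : ∃ η : ℝ, 0 < η ∧ η ≤ 1 ∧ (4 : ℝ) ^ 16 * (2 * η) < 1 / 2 ∧
      33 * (1 - Q.h₂ ^ (-((4 : ℝ) ^ 16 * (2 * η)))) ≤ 1 / 320 := by
    have hh : 0 < Q.h₂ := by linarith [Q.one_lt_h₂]
    have hc : Continuous fun η : ℝ => 33 * (1 - Q.h₂ ^ (-((4 : ℝ) ^ 16 * (2 * η)))) :=
      continuous_const.mul (continuous_const.sub
        ((Real.continuous_const_rpow hh.ne').comp (by fun_prop)))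
    have e1 := (hc.tendsto 0).eventually_le_const (by norm_num : _ < (1 : ℝ) / 320)
    have e2 : ∀ᶠ η : ℝ in nhds 0, (4 : ℝ) ^ 16 * (2 * η) < 1 / 2 :=
      (Continuous.tendsto (by fun_prop : Continuous fun η : ℝ => (4 : ℝ) ^ 16 * (2 * η))
        0).eventually_lt_const (by norm_num)
    obtain ⟨η, ⟨h1, h2⟩, h3⟩ := (((e1.and e2).filter_mono (nhdsWithin_le_nhds
      (s := Set.Ioi 0))).and self_mem_nhdsWithin).exists
    have h3' : 0 < η := h3
    exact ⟨η, h3', by norm_num at h2; linarith, h2, h1⟩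
  set θ := min Ic Q.Iack / 3 with hθdef
  have hθ : 0 < θ := by have := lt_min hIc Q.Iack_pos; positivity
  -- K comes last: it may depend on ρ and only influences the success probability c.
  obtain ⟨K, hKθ, hK⟩ := (((hfar (2 ^ M.ζ * M.P * (7 * 4 ^ 3 * (L + 3 / 2)))).eventually_le_const
    (by positivity : 0 < θ / 2)).and
    (Filter.eventually_ge_atTop (max (2 * ρ) (ρ + ρc)))).exists
  have hK1 : 2 * ρ ≤ K := (le_max_left _ _).trans hK
  have hK2 : ρ + ρc ≤ K := (le_max_right _ _).trans hK
  set q := 7 * 4 ^ 3 * M.nearBound K * (L + 3 / 2) with hq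
  set c := Real.exp (-(6 * q)) * η / 256 with hc
  have hc0 : 0 < c := by positivity
  set c₁ := 400 * (κ + 4) + 80 / c * (κ + 3) + 20 / η with hc₁
  have hnb := M.nearBound_pos (by linarith : 0 ≤ ρ)
  have hc₁0 : 1600 < c₁ := by
    have : 0 < 80 / c * (κ + 3) := by positivity
    have : 0 < 20 / η := by positivity
    linarith
  refine ⟨32 * (c₁ + 1), 32 * (c₁ + 1) * max (M.nearBound ρ) 1, by linarith, by positivity,
    fun V _ G n hA hV => ⟨?_, fun h2 v => ?_⟩⟩
  · intro Ω _ μ _ ℱ E h hsc hack hcd v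
    have hn1 : 1 ≤ n := (Fintype.card_pos_iff.mpr ⟨v⟩).trans_le hV
    -- For n = 1 the failure bound is 1.
    rcases hn1.eq_or_lt with rfl | hn
    · simpa using prob_le_one
    exact h.measure_not_completesWithin_le hn hV hsc hack hcd hA hρ2 hK1 hK2 hθ
      (by rw [hθdef]; linarith [min_le_left Ic Q.Iack])
      (by rw [hθdef]; linarith [min_le_right Ic Q.Iack]) hη hη1 hη2 hL
      (by
        have : M.P * (33 * 4 ^ 16 * M.farBound ρ * (L + 3 / 2)) / Q.Icd =
          M.P * (33 * 4 ^ 16 * (L + 3 / 2)) / Q.Icd * M.farBound ρ := by ring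
        rw [this]; linarith) (le_trans (le_of_eq (by ring)) hKθ) hq.ge hc hκ hc₁ v
  · have h3 := G.card_inBall_le hA v (by linarith : 0 ≤ ρ) h2
    have h4 : 0 ≤ Real.log n := Real.log_natCast_nonneg n
    have h5 : (0 : ℝ) ≤ G.maxDegree M := by positivity
    rw [mul_assoc (32 * (c₁ + 1))]
    refine mul_le_mul_of_nonneg_left ?_ (by linarith)
    rw [mul_add]
    exact add_le_add (h3.trans (mul_le_mul_of_nonneg_right (le_max_left _ _) h5))
      (le_mul_of_one_le_left h4 (le_max_right _ _))

/-! ### The SINR model -/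

theorem RadioParams.mul_noise_eq (M : RadioParams) {β noise : ℝ} (hβ : 1 ≤ β) (hN : 0 < noise)
    (hR : M.R = (M.P / (β * noise)) ^ (1 / M.ζ)) : M.P * M.R ^ (-M.ζ) = β * noise := by
  have hP := M.P_pos
  have h1 : 0 < β * noise := mul_pos (by linarith) hN
  rw [hR, ← Real.rpow_mul (by positivity), one_div_mul_eq_div, neg_div, div_self M.ζ_pos.ne',
    Real.rpow_neg_one, inv_div]
  field_simp

/-- In the SINR model, transmissions on a clear channel are received. -/
theorem Trace.SINRReception.succClear {V Ω : Type*} [Fintype V] {E : Trace V Ω} {G : Network V}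
    {M : RadioParams} {β noise : ℝ} (hA : G.Admissible M)
    (hsymm : ∀ u v, G.dist M u v = G.dist M v u) (hβ : 1 ≤ β) (hN : 0 < noise)
    (hR : M.R = (M.P / (β * noise)) ^ (1 / M.ζ)) (h : E.SINRReception G M β noise) :
    E.SuccClear G M 2 (noise * ((1 - M.ε) ^ (-M.ζ) - 1) / 2 / 2 ^ M.ζ) := by
  classical
  intro u i ω htx hclear hint w hw hwu
  have hP := M.P_pos
  have hζ := M.ζ_pos
  have hR0 := M.R_pos
  have hε := M.ε_pos
  have hε1 := M.ε_lt_one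
  have hduw := Network.mem_neighbors.mp hw
  have hduw' : G.dist M u w ≤ M.R := hduw.trans (mul_le_of_le_one_left hR0.le (by linarith))
  rw [h]
  refine ⟨htx, fun t ht => ⟨⟨i, ht, htx⟩, fun hwt => ?_, ?_⟩⟩
  · refine hclear w ⟨hwu, t, ht, hwt⟩ (Network.mem_inBall.mpr ?_)
    rw [hsymm]
    linarith
  · have hone : 1 < (1 - M.ε) ^ (-M.ζ) :=
      Real.one_lt_rpow_of_pos_of_lt_one_of_neg (by linarith) (by linarith) (by linarith)
    -- At distance R the signal is exactly β times the noise; the margin ε leaves room for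
    -- interference.
    have hsig : β * noise * (1 - M.ε) ^ (-M.ζ) ≤ G.signal M u w := by
      rw [Network.signal_eq hwu.symm, ← M.mul_noise_eq hβ hN hR, mul_assoc,
        ← Real.mul_rpow hR0.le (by linarith), mul_comm M.R]
      exact mul_le_mul_of_nonneg_left (Real.rpow_le_rpow_of_nonpos
        (Network.dist_pos hwu.symm) hduw (by linarith)) hP.le
    -- Interferers are at distance at least 2R from u and w is within R of u, so moving from u to w
    -- increases each signal by a factor of at most 2^ζ. The extra 1/2 in the threshold makes the
    -- SINR inequality strict.
    have hsum : ∑ x ∈ Finset.univ.filter (fun x => x ∈ E.transmitters t ω ∧ x ≠ u),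
        G.signal M x w ≤ noise * ((1 - M.ε) ^ (-M.ζ) - 1) / 2 := by
      have h2 : noise * ((1 - M.ε) ^ (-M.ζ) - 1) / 2 =
          2 ^ M.ζ * (noise * ((1 - M.ε) ^ (-M.ζ) - 1) / 2 / 2 ^ M.ζ) := by field_simp
      rw [h2]
      refine le_trans ?_ (mul_le_mul_of_nonneg_left hint (by positivity))
      rw [interference, interferenceOutside, Finset.mul_sum]
      calc _ ≤ ∑ x ∈ Finset.univ.filter (fun x => x ∈ E.transmitters t ω ∧ x ≠ u),
            2 ^ M.ζ * G.signal M x u := Finset.sum_le_sum fun x hx => ?_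
        _ ≤ _ := by
            refine Finset.sum_le_sum_of_subset_of_nonneg (fun x hx => ?_) fun x hx _ => ?_
            · have hx' := (Finset.mem_filter.mp hx).2
              exact Finset.mem_filter.mpr ⟨Finset.mem_univ _, ⟨hx'.2, t, ht, hx'.1⟩,
                Finset.notMem_empty _⟩
            · exact mul_nonneg (by positivity)
                (Network.signal_pos (Finset.mem_filter.mp hx).2.1.1).le
      have hx' := (Finset.mem_filter.mp hx).2
      have hfar := hclear x ⟨hx'.2, t, ht, hx'.1⟩
      rw [Network.mem_inBall, not_lt] at hfar
      have htri := hA.metricity x u w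
      rw [hsymm w u] at htri
      have hxw : x ≠ w := by
        rintro rfl
        rw [hsymm] at hfar
        linarith
      rw [Network.signal_eq hxw, Network.signal_eq hx'.2, mul_left_comm]
      refine mul_le_mul_of_nonneg_left ?_ hP.le
      have h3 : 0 < G.dist M x u / 2 := by linarith
      calc (G.dist M x w) ^ (-M.ζ) ≤ (G.dist M x u / 2) ^ (-M.ζ) :=
            Real.rpow_le_rpow_of_nonpos h3 (by linarith) (by linarith)
        _ = _ := by
            rw [Real.div_rpow (by linarith) (by norm_num),
              Real.rpow_neg (by norm_num : (0 : ℝ) ≤ 2), div_inv_eq_mul, mul_comm]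
    refine lt_of_lt_of_le ?_ hsig
    rw [mul_assoc]
    refine mul_lt_mul_of_pos_left ?_ (by linarith)
    refine lt_of_le_of_lt ((add_le_add_iff_right _).mpr ?_) (b := noise *
      ((1 - M.ε) ^ (-M.ζ) - 1) / 2 + noise) ?_
    · convert hsum
    · nlinarith

/-- The running time of LocalBcast in the SINR model. -/
theorem localBcast_completes_sinr (M : RadioParams) (Q : SenseParams) (β noise : ℝ) (hβ : 1 ≤ β)
    (hN : 0 < noise) (hR : M.R = (M.P / (β * noise)) ^ (1 / M.ζ)) :
    ∃ ρ₀ : ℝ, 1 < ρ₀ ∧ ∀ ρ : ℝ, ρ₀ ≤ ρ → ∀ κ : ℝ, 0 < κ → ∃ C C' : ℝ, 0 < C ∧ 0 < C' ∧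
      ∀ (V : Type) [Fintype V] (G : Network V) (n : ℕ),
        G.Admissible M → (∀ u v, G.dist M u v = G.dist M v u) → Fintype.card V ≤ n →
        (∀ (Ω : Type) [mΩ : MeasurableSpace Ω] (μ : Measure Ω) [IsProbabilityMeasure μ]
          (ℱ : Filtration ℕ mΩ) (E : Trace V Ω),
          IsLocalBcast μ ℱ n E → E.SINRReception G M β noise → E.AckSpec G M Q.Iack →
          CDSpec M Q ρ G μ ℱ n E →
          ∀ v : V, μ {ω | E.wake v ω ≠ ⊤ ∧ ¬ E.CompletesWithin G M v
              (C * ((G.inBall M v (ρ * M.R)).card + Real.log n)) ω}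
            ≤ ENNReal.ofReal ((n : ℝ) ^ (-κ))) ∧
        (2 * M.rmin ≤ (1 - M.ε) * M.R → ∀ v : V,
          C * ((G.inBall M v (ρ * M.R)).card + Real.log n)
            ≤ C' * (G.maxDegree M + Real.log n)) := by
  have hε := M.ε_pos
  have hε1 := M.ε_lt_one
  have hζ := M.ζ_pos
  have hone : 1 < (1 - M.ε) ^ (-M.ζ) :=
    Real.one_lt_rpow_of_pos_of_lt_one_of_neg (by linarith) (by linarith) (by linarith)
  have hI : 0 < noise * ((1 - M.ε) ^ (-M.ζ) - 1) / 2 / 2 ^ M.ζ := by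
    have : 0 < (1 - M.ε) ^ (-M.ζ) - 1 := by linarith
    positivity
  obtain ⟨ρ₀, h1, h2⟩ := localBcast_completes M Q 2 _ hI
  refine ⟨ρ₀, h1, fun ρ hρ κ hκ => ?_⟩
  obtain ⟨C, C', hC, hC', h3⟩ := h2 ρ hρ κ hκ
  refine ⟨C, C', hC, hC', fun V _ G n hA hsymm hV => ⟨?_, (h3 V G n hA hV).2⟩⟩
  intro Ω _ μ _ ℱ E h hrec
  exact (h3 V G n hA hV).1 Ω μ ℱ E h (hrec.succClear hA hsymm hβ hN hR)

/-! ### Lower bound: collisions of independent samples -/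

section collision

/-- Two independent samples from a finite set agree with probability at least the inverse of its
size. -/
theorem inv_card_le_lintegral_measure_eq {S H : Type*} [MeasurableSpace S] [MeasurableSpace H]
    [Fintype H] [MeasurableSingletonClass H] (μ : Measure S) [IsProbabilityMeasure μ] {h : S → H}
    (hh : Measurable h) :
    ((Fintype.card H : ℝ≥0∞))⁻¹ ≤ ∫⁻ s', μ {s | h s = h s'} ∂μ := by
  have e : ∀ s', μ {s | h s = h s'} = μ.map h {h s'} := fun s' => by
    rw [Measure.map_apply hh (measurableSet_singleton _)]
    rfl
  have := Measure.isProbabilityMeasure_map (μ := μ) hh.aemeasurable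
  simp only [e]
  rw [← lintegral_map (f := fun k => μ.map h {k}) (measurable_of_finite _) hh, lintegral_fintype]
  set ν := μ.map h
  have hsum : ∑ k, ν.real {k} = 1 := by
    have h1 := sum_measureReal_singleton (μ := ν) Finset.univ
    rw [h1, Finset.coe_univ, probReal_univ]
  -- Cauchy-Schwarz: the collision probability is the sum of the squared weights.
  have hcs := sq_sum_le_card_mul_sum_sq (s := Finset.univ) (f := fun k => ν.real {k})
  rw [hsum, one_pow, Finset.card_univ] at hcs
  have hpos : 0 < (Fintype.card H : ℝ) := by
    by_contra hc
    have h0 : (Fintype.card H : ℝ) = 0 := le_antisymm (not_lt.mp hc) (by positivity)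
    rw [h0, zero_mul] at hcs
    linarith
  have e2 : ∀ k, ν {k} * ν {k} = ENNReal.ofReal (ν.real {k} ^ 2) := fun k => by
    rw [ENNReal.ofReal_pow measureReal_nonneg, sq, measureReal_def,
      ENNReal.ofReal_toReal (measure_ne_top _ _)]
  simp only [e2]
  rw [← ENNReal.ofReal_sum_of_nonneg fun _ _ => sq_nonneg _, ← ENNReal.ofReal_natCast,
    ← ENNReal.ofReal_inv_of_pos hpos]
  refine ENNReal.ofReal_le_ofReal ?_
  rwa [inv_le_iff_one_le_mul₀' hpos]

theorem le_lintegral_pi_of_forall_update {V S : Type*} [Fintype V] [DecidableEq V]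
    [MeasurableSpace S] (μ : Measure S) [IsProbabilityMeasure μ] {f : (V → S) → ℝ≥0∞}
    (hf : Measurable f) {u u' : V} (huu' : u ≠ u') {r : ℝ≥0∞}
    (h : ∀ x, r ≤ ∫⁻ s, ∫⁻ s', f (Function.update (Function.update x u s) u' s') ∂μ ∂μ) :
    r ≤ ∫⁻ x, f x ∂Measure.pi fun _ => μ := by
  have h1 : ∫⁻ _x : V → S, r ∂(Measure.pi fun _ => μ) = r := by
    rw [lintegral_const, measure_univ, mul_one]
  rw [← h1]
  refine lintegral_le_of_lmarginal_le {u, u'} measurable_const hf fun x => ?_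
  rw [lmarginal_insert _ measurable_const (by simpa using huu'),
    lmarginal_insert _ hf (by simpa using huu')]
  simp only [lmarginal_singleton, lintegral_const, measure_univ, mul_one]
  exact h x

end collision

/-! ### Twins in the SINR model -/

namespace Network

variable {V : Type*} [DecidableEq V] {G : Network V} {M : RadioParams} {u u' : V}

/-- Exchanging the neighbouring nodes `u` and `u'` preserves all signals. -/
structure IsTwins [Fintype V] (G : Network V) (M : RadioParams) (u u' : V) : Prop where
  ne : u ≠ u'
  signal_swap : ∀ x y, x ≠ y →
    G.signal M (Equiv.swap u u' x) (Equiv.swap u u' y) = G.signal M x y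
  mem_neighbors : u' ∈ G.neighbors M u
  mem_neighbors' : u ∈ G.neighbors M u'

namespace IsTwins

variable [Fintype V] (h : G.IsTwins M u u') {β noise : ℝ} {S : Set V}
include h

omit h [Fintype V] in
theorem swap_mem_iff (hS : u ∈ S ↔ u' ∈ S) (x : V) : Equiv.swap u u' x ∈ S ↔ x ∈ S := by
  by_cases hx : x = u
  · rw [hx, Equiv.swap_apply_left, hS]
  by_cases hx' : x = u'
  · rw [hx', Equiv.swap_apply_right, hS]
  rw [Equiv.swap_apply_of_ne_of_ne hx hx']

theorem sum_signal_swap (hS : u ∈ S ↔ u' ∈ S) (w y : V) (hw : w = y ∨ y ∉ S)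
    {_ : DecidablePred fun x => x ∈ S ∧ x ≠ w}
    {_ : DecidablePred fun x => x ∈ S ∧ x ≠ Equiv.swap u u' w} :
    ∑ x ∈ Finset.univ.filter (fun x => x ∈ S ∧ x ≠ Equiv.swap u u' w),
        G.signal M x (Equiv.swap u u' y) =
      ∑ x ∈ Finset.univ.filter (fun x => x ∈ S ∧ x ≠ w), G.signal M x y := by
  symm
  refine Finset.sum_equiv (Equiv.swap u u') (fun x => ?_) fun x hx => (h.signal_swap _ _ ?_).symm
  · simp only [Finset.mem_filter, Finset.mem_univ, true_and, swap_mem_iff hS, ne_eq,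
      EmbeddingLike.apply_eq_iff_eq]
  · have := (Finset.mem_filter.mp hx).2
    rcases hw with rfl | hw
    · exact this.2
    · exact fun e => hw (e ▸ this.1)

theorem sinrReceives_swap (hS : u ∈ S ↔ u' ∈ S) (x w : V) :
    G.SINRReceives M β noise S (Equiv.swap u u' x) (Equiv.swap u u' w) ↔
      G.SINRReceives M β noise S x w := by
  classical
  unfold SINRReceives
  rw [swap_mem_iff hS, swap_mem_iff hS]
  refine and_congr_right fun hx => and_congr_right fun hw => ?_
  rw [h.sum_signal_swap hS x w (Or.inr hw), h.signal_swap x w fun e => hw (e ▸ hx)]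

/-- If two twins transmit, then their signals destroy each other. -/
theorem ne_of_sinrReceives (hβ : 1 ≤ β) (hN : 0 < noise) (hS : u ∈ S ↔ u' ∈ S) {x w : V}
    (hr : G.SINRReceives M β noise S x w) : x ≠ u ∧ x ≠ u' := by
  classical
  -- An equally strong second transmitter alone pushes the ratio below 1 ≤ β.
  have key : ∀ z z', z ≠ z' → z ∈ S → z' ∈ S → (w ∉ S → G.signal M z' w = G.signal M z w) →
      ¬ G.SINRReceives M β noise S z w := by
    rintro z z' hzz' hz hz' hsig ⟨-, hw, hlt⟩
    rw [← hsig hw] at hlt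
    have h2 : 0 ≤ G.signal M z' w := (signal_pos fun e => hw (by rwa [← e])).le
    refine absurd hlt (not_lt.mpr (le_trans (b := β * (G.signal M z' w + noise)) (by nlinarith)
      (mul_le_mul_of_nonneg_left ((add_le_add_iff_right _).mpr
      (Finset.single_le_sum (f := fun y => G.signal M y w) (fun y hy => ?_) ?_)) (by linarith))))
    · refine (signal_pos fun e => hw ?_).le
      simp only [Finset.mem_filter] at hy
      rw [← e]
      exact hy.2.1
    · simp only [Finset.mem_filter]
      exact ⟨Finset.mem_univ _, hz', hzz'.symm⟩
  have hsw : u ∈ S → w ∉ S → G.signal M u' w = G.signal M u w := fun hu hw => by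
    have hwu : w ≠ u := fun e => hw (e ▸ hu)
    have hwu' : w ≠ u' := fun e => hw (e ▸ hS.mp hu)
    have := h.signal_swap u w hwu.symm
    rwa [Equiv.swap_apply_left, Equiv.swap_apply_of_ne_of_ne hwu hwu'] at this
  constructor
  · rintro rfl
    exact key x u' h.ne hr.1 (hS.mp hr.1) (hsw hr.1) hr
  · rintro rfl
    exact key x u h.ne.symm hr.1 (hS.mpr hr.1) (fun hw => (hsw (hS.mpr hr.1) hw).symm) hr

theorem sinrReceives_left_iff (hβ : 1 ≤ β) (hN : 0 < noise) (hS : u ∈ S ↔ u' ∈ S) (x : V) :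
    G.SINRReceives M β noise S x u ↔ G.SINRReceives M β noise S x u' := by
  by_cases hx : x ≠ u ∧ x ≠ u'
  · have := h.sinrReceives_swap (β := β) (noise := noise) hS x u'
    rwa [Equiv.swap_apply_right, Equiv.swap_apply_of_ne_of_ne hx.1 hx.2] at this
  · exact iff_of_false (fun hr => hx (h.ne_of_sinrReceives hβ hN hS hr))
      fun hr => hx (h.ne_of_sinrReceives hβ hN hS hr)

end IsTwins

end Network

/-! ### Twins with equal decisions cannot break their symmetry -/

namespace RandAlgorithm

open Network

variable {S V : Type*} [MeasurableSpace S] [Fintype V] (A : RandAlgorithm S)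
  (M : RadioParams) (β noise : ℝ) (G : Network V)

/-- Node `v` mass-delivers when exactly the nodes in `B` transmit. -/
def MassDeliversOf (B : Set V) (v : V) : Prop :=
  v ∈ B ∧ ∀ w ∈ G.neighbors M v, w ≠ v → G.SINRReceives M β noise B v w

open scoped Classical in
/-- The feedback of node `v` when exactly the nodes in `B` transmit. -/
noncomputable def feedbackOf (B : Set V) (c : V → S) (v : V) : Feedback S :=
  (if h : ∃ u, G.SINRReceives M β noise B u v then Sum.inl (c h.choose) else Sum.inr (),
   ∑ x ∈ Finset.univ.filter (fun x => x ∈ B ∧ x ≠ v), G.signal M x v,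
   decide (MassDeliversOf M β noise G B v))

theorem feedback_eq (c : V → S) (v : V) :
    A.feedback M β noise G c v = feedbackOf M β noise G (A.senders c) c v := rfl

/-- There are finitely many sets of transmitters; for a fixed one, the feedback is constant except
for the state of a fixed sender. -/
theorem measurable_feedback (v : V) : Measurable fun c : V → S => A.feedback M β noise G c v := by
  classical
  have h1 : Measurable fun x : Set V × (V → S) => feedbackOf M β noise G x.1 x.2 v := by
    refine measurable_from_prod_countable_right fun B => ?_
    change Measurable fun y => feedbackOf M β noise G B y v
    unfold feedbackOf
    refine Measurable.prodMk ?_ measurable_const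
    by_cases hB : ∃ u, G.SINRReceives M β noise B u v
    · simp only [dif_pos hB]
      exact measurable_inl.comp (measurable_pi_apply _)
    · simp only [dif_neg hB]
      exact measurable_const
  have h2 : Measurable fun c : V → S => A.senders c :=
    measurable_set_iff.mpr fun v => (measurableSet_setOfPred.mp A.measurableSet_sends).comp
      (measurable_pi_apply v)
  exact h1.comp (h2.prodMk measurable_id)

theorem measurable_config (t : ℕ) : Measurable fun c : V → S => A.config M β noise G c t := by
  induction t with
  | zero => exact measurable_id
  | succ t ih =>
    refine measurable_pi_iff.mpr fun v => ?_
    exact A.measurable_next.comp (((measurable_pi_apply v).comp ih).prodMk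
      ((A.measurable_feedback M β noise G v).comp ih))

variable {A M β noise G} [DecidableEq V] {u u' : V} (h : G.IsTwins M u u') (hβ : 1 ≤ β)
  (hN : 0 < noise)
include h

theorem not_massDelivers_of_twins {c : V → S} (hc : c u ∈ A.sends ↔ c u' ∈ A.sends) :
    ¬ A.MassDelivers M β noise G c u := fun ⟨h1, h2⟩ =>
  (h2 u' h.mem_neighbors h.ne.symm).2.1 (hc.mp h1)

theorem not_massDelivers_of_twins' {c : V → S} (hc : c u ∈ A.sends ↔ c u' ∈ A.sends) :
    ¬ A.MassDelivers M β noise G c u' := fun ⟨h1, h2⟩ =>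
  (h2 u h.mem_neighbors' h.ne).2.1 (hc.mpr h1)

include hβ hN

/-- States enter the feedback only through the set of transmitters and the received message, and no
message of a twin is ever received. -/
theorem feedback_congr {c d : V → S} (hs : A.senders c = A.senders d)
    (hc : c u ∈ A.sends ↔ c u' ∈ A.sends) (hcd : ∀ x, x ≠ u → x ≠ u' → c x = d x) (w : V) :
    A.feedback M β noise G c w = A.feedback M β noise G d w := by
  classical
  rw [feedback_eq, feedback_eq, ← hs]
  unfold feedbackOf
  refine Prod.ext ?_ rfl
  dsimp only
  by_cases hB : ∃ x, G.SINRReceives M β noise (A.senders c) x w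
  · rw [dif_pos hB, dif_pos hB]
    have := h.ne_of_sinrReceives hβ hN hc hB.choose_spec
    rw [hcd _ this.1 this.2]
  · rw [dif_neg hB, dif_neg hB]

theorem feedback_twins {c : V → S} (hc : c u ∈ A.sends ↔ c u' ∈ A.sends) :
    A.feedback M β noise G c u = A.feedback M β noise G c u' := by
  classical
  have hS : u ∈ A.senders c ↔ u' ∈ A.senders c := hc
  refine Prod.ext ?_ (Prod.ext ?_ ?_)
  · have e : (fun x => G.SINRReceives M β noise (A.senders c) x u) =
        fun x => G.SINRReceives M β noise (A.senders c) x u' :=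
      funext fun x => propext (h.sinrReceives_left_iff hβ hN hS x)
    -- The twins can receive from the same nodes, so the chosen sender is the same as well.
    have key : ∀ p q : V → Prop, p = q →
        (if h : ∃ x, p x then Sum.inl (c h.choose) else Sum.inr () : S ⊕ Unit) =
          if h : ∃ x, q x then Sum.inl (c h.choose) else Sum.inr () := by
      rintro p _ rfl
      rfl
    exact key _ _ e
  · have e : ∀ z, z = u → ∑ x ∈ Finset.univ.filter (fun x => x ∈ A.senders c ∧ x ≠ z),
        G.signal M x z = ∑ x ∈ Finset.univ.filter (fun x => x ∈ A.senders c ∧ x ≠ u'),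
        G.signal M x u' := by
      rintro z hz
      rw [← Equiv.swap_apply_right u u'] at hz
      rw [hz]
      exact h.sum_signal_swap hS u' u' (Or.inl rfl)
    unfold feedback
    dsimp only
    convert e u rfl
  · unfold feedback
    dsimp only
    rw [decide_eq_decide]
    exact iff_of_false (not_massDelivers_of_twins h hc) (not_massDelivers_of_twins' h hc)

theorem config_twins {c : V → S} (hc : c u = c u') (t : ℕ) :
    A.config M β noise G c t u = A.config M β noise G c t u' := by
  induction t with
  | zero => exact hc
  | succ t ih =>
    change A.next _ _ = A.next _ _
    rw [ih, feedback_twins h hβ hN (by rw [ih])]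

/-- If `b` and `b'` are runs in which the twins start in the same state, and they lead to the same
transmission decisions of the twins, then also the twins make these decisions if one starts as in
`b` and the other as in `b'`. -/
theorem config_eq_of_twins {c b b' : V → S} (hb : b u = b u') (hb' : b' u = b' u')
    (hcu : c u = b u) (hcu' : c u' = b' u') (hcb : ∀ x, x ≠ u → x ≠ u' → c x = b x)
    (hcb' : ∀ x, x ≠ u → x ≠ u' → c x = b' x) {T : ℕ}
    (hdec : ∀ t < T, A.config M β noise G b t u ∈ A.sends ↔ A.config M β noise G b' t u ∈ A.sends)
    {t : ℕ} (ht : t ≤ T) :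
    A.config M β noise G c t u = A.config M β noise G b t u ∧
      A.config M β noise G c t u' = A.config M β noise G b' t u' ∧
      ∀ x, x ≠ u → x ≠ u' → A.config M β noise G c t x = A.config M β noise G b t x ∧
        A.config M β noise G c t x = A.config M β noise G b' t x := by
  induction t with
  | zero => exact ⟨hcu, hcu', fun x hx hx' => ⟨hcb x hx hx', hcb' x hx hx'⟩⟩
  | succ t ih =>
    obtain ⟨h1, h2, h3⟩ := ih (by omega)
    have hd := hdec t (by omega)
    have e1 := config_twins (A := A) h hβ hN hb t
    have e2 := config_twins (A := A) h hβ hN hb' t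
    set ct := A.config M β noise G c t with hct
    set bt := A.config M β noise G b t with hbt
    set bt' := A.config M β noise G b' t with hbt'
    -- The twins decide alike in the mixed run, so all three runs have the same transmitters in this
    -- round, and hence the same feedback.
    have hc : ct u ∈ A.sends ↔ ct u' ∈ A.sends := by rw [h1, h2, ← e2, hd]
    have s1 : A.senders ct = A.senders bt := by
      ext x
      change ct x ∈ A.sends ↔ bt x ∈ A.sends
      by_cases hx : x = u
      · rw [hx, h1]
      by_cases hx' : x = u'
      · rw [hx', ← e1, ← hc, h1]
      rw [(h3 x hx hx').1]
    have s2 : A.senders ct = A.senders bt' := by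
      ext x
      change ct x ∈ A.sends ↔ bt' x ∈ A.sends
      by_cases hx : x = u
      · rw [hx, h1, hd]
      by_cases hx' : x = u'
      · rw [hx', h2]
      rw [(h3 x hx hx').2]
    have f1 := feedback_congr h hβ hN s1 hc fun x hx hx' => (h3 x hx hx').1
    have f2 := feedback_congr h hβ hN s2 hc fun x hx hx' => (h3 x hx hx').2
    refine ⟨?_, ?_, fun x hx hx' => ⟨?_, ?_⟩⟩
    · change A.next (ct u) _ = A.next (bt u) _
      rw [h1, f1]
    · change A.next (ct u') _ = A.next (bt' u') _
      rw [h2, f2]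
    · change A.next (ct x) _ = A.next (bt x) _
      rw [(h3 x hx hx').1, f1]
    · change A.next (ct x) _ = A.next (bt' x) _
      rw [(h3 x hx hx').2, f2]

/-- For fixed states of the other nodes, let each state s determine the T decisions made when both
twins start in s. If two independent states give the same decisions, the twins starting in them stay
tied and block each other. -/
theorem inv_two_pow_le_measure_not_massDelivers (T : ℕ) :
    ((2 : ℝ≥0∞) ^ T)⁻¹ ≤ Measure.pi (fun _ : V => A.init)
      {c | ∀ t < T, ¬ A.MassDelivers M β noise G (A.config M β noise G c t) u} := by
  classical
  have := A.isProbabilityMeasure_init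
  set F := {c | ∀ t < T, ¬ A.MassDelivers M β noise G (A.config M β noise G c t) u}
  -- A measurable hull avoids proving measurability of the failure event.
  rw [← measure_toMeasurable F, ← lintegral_indicator_one (measurableSet_toMeasurable _ F)]
  refine le_lintegral_pi_of_forall_update A.init (measurable_one.indicator
    (measurableSet_toMeasurable _ F)) h.ne.symm fun x => ?_
  set dec : S → Fin T → Prop := fun s t =>
    A.config M β noise G (Function.update (Function.update x u' s) u s) t u ∈ A.sends
  have hdec : Measurable dec := by
    refine measurable_pi_iff.mpr fun t => (measurableSet_setOfPred.mp A.measurableSet_sends).comp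
      ((measurable_pi_apply u).comp ((A.measurable_config M β noise G t).comp
        (measurable_pi_iff.mpr fun w => ?_)))
    by_cases hw : w = u
    · simp only [hw, Function.update_self]; exact measurable_id
    by_cases hw' : w = u'
    · simp only [hw', Function.update_of_ne h.ne.symm, Function.update_self]; exact measurable_id
    simp only [Function.update_of_ne hw, Function.update_of_ne hw']
    exact measurable_const
  have hcard : Fintype.card (Fin T → Prop) = 2 ^ T := by
    rw [Fintype.card_fun, Fintype.card_prop, Fintype.card_fin]
  have hcol := inv_card_le_lintegral_measure_eq A.init hdec
  rw [hcard, Nat.cast_pow, Nat.cast_ofNat] at hcol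
  refine hcol.trans (lintegral_mono fun s' => ?_)
  have hm : MeasurableSet {s | dec s = dec s'} := hdec (measurableSet_singleton (dec s'))
  change A.init {s | dec s = dec s'} ≤ _
  rw [← lintegral_indicator_one hm]
  refine lintegral_mono fun s => ?_
  by_cases hs : dec s = dec s'
  swap
  · rw [Set.indicator_of_notMem (show s ∉ {s | dec s = dec s'} from hs)]; exact zero_le
  have hmem : Function.update (Function.update x u' s') u s ∈ F := by
    intro t ht
    have key := config_eq_of_twins (A := A) h hβ hN
      (c := Function.update (Function.update x u' s') u s)
      (b := Function.update (Function.update x u' s) u s)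
      (b' := Function.update (Function.update x u' s') u s')
      (by simp [h.ne.symm]) (by simp [h.ne.symm]) (by simp) (by simp [h.ne.symm])
      (fun x hx hx' => by simp [hx, hx']) (fun x hx hx' => by simp [hx, hx']) (T := T)
      (fun t ht => iff_of_eq (congrFun hs ⟨t, ht⟩)) ht.le
    refine not_massDelivers_of_twins h ?_
    rw [key.1, key.2.1, ← config_twins (A := A) h hβ hN
      (c := Function.update (Function.update x u' s') u s') (by simp [h.ne.symm])]
    exact iff_of_eq (congrFun hs ⟨t, ht⟩)
  rw [Set.indicator_of_mem (show s ∈ {s | dec s = dec s'} from hs),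
    Set.indicator_of_mem (subset_toMeasurable _ _ hmem), Pi.one_apply, Pi.one_apply]

omit h hβ hN in
/-- In a set of mutual neighbours, there is at most one mass delivery per round. -/
theorem card_mul_le_of_neighbors {K : Finset V}
    (hK : ∀ x ∈ K, ∀ y ∈ K, y ∈ G.neighbors M x) {T : ℕ} {p : ℝ} (hp : 0 ≤ p)
    (hfail : ∀ v ∈ K, Measure.pi (fun _ : V => A.init)
      {c | ∀ t < T, ¬ A.MassDelivers M β noise G (A.config M β noise G c t) v} ≤
        ENNReal.ofReal p) : (K.card : ℝ) * (1 - p) ≤ T := by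
  classical
  have := A.isProbabilityMeasure_init
  set μ := Measure.pi fun _ : V => A.init
  set F := fun v => {c | ∀ t < T, ¬ A.MassDelivers M β noise G (A.config M β noise G c t) v}
  have hcount : ∀ c, K.card ≤ T + ∑ v ∈ K, if c ∈ toMeasurable μ (F v) then 1 else 0 := by
    intro c
    have h1 : (K.filter fun v => c ∉ F v).card ≤ (Finset.range T).card * 1 := by
      refine le_trans (Finset.card_le_card (t := (Finset.range T).biUnion fun t =>
        K.filter fun v => A.MassDelivers M β noise G (A.config M β noise G c t) v) ?_)
        (Finset.card_biUnion_le_card_mul _ _ _ fun t _ => ?_)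
      · intro v hv
        simp only [Finset.mem_filter, Finset.mem_biUnion, Finset.mem_range, F, Set.mem_ofPred_eq,
          not_forall, not_not] at hv ⊢
        obtain ⟨h1, t, ht, h2⟩ := hv
        exact ⟨t, ht, h1, h2⟩
      · rw [Finset.card_le_one]
        intro x hx y hy
        rw [Finset.mem_filter] at hx hy
        by_contra hxy
        -- A second sender y would be a neighbor of x that does not listen.
        exact (hx.2.2 y (hK x hx.1 y hy.1) (Ne.symm hxy)).2.1 hy.2.1
    rw [Finset.card_range, mul_one] at h1
    have h2 := Finset.card_filter_add_card_filter_not (s := K) fun v => c ∈ F v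
    rw [Finset.sum_boole, Nat.cast_id]
    have h3 : (K.filter fun v => c ∈ F v).card ≤
        (K.filter fun v => c ∈ toMeasurable μ (F v)).card :=
      Finset.card_le_card (Finset.monotone_filter_right _ fun v _ hv => subset_toMeasurable _ _ hv)
    omega
  have hint : (K.card : ℝ≥0∞) ≤ T + K.card * ENNReal.ofReal p := by
    calc (K.card : ℝ≥0∞) = ∫⁻ _c, (K.card : ℝ≥0∞) ∂μ := by simp
      _ ≤ ∫⁻ c, ((T : ℝ≥0∞) + ∑ v ∈ K, (toMeasurable μ (F v)).indicator 1 c) ∂μ := by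
          refine lintegral_mono fun c => ?_
          have := hcount c
          have h4 : (∑ v ∈ K, (toMeasurable μ (F v)).indicator 1 c : ℝ≥0∞) =
              ((∑ v ∈ K, if c ∈ toMeasurable μ (F v) then 1 else 0 : ℕ) : ℝ≥0∞) := by
            push_cast
            exact Finset.sum_congr rfl fun v _ => by simp [Set.indicator_apply]
          rw [h4, ← Nat.cast_add]
          exact Nat.cast_le.mpr this
      _ = T + ∑ v ∈ K, μ (F v) := by
          rw [lintegral_add_left measurable_const, lintegral_const, measure_univ, mul_one,
            lintegral_finsetSum _ fun v _ =>
              measurable_one.indicator (measurableSet_toMeasurable _ _)]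
          congr 1
          refine Finset.sum_congr rfl fun v _ => ?_
          rw [lintegral_indicator_one (measurableSet_toMeasurable _ _), measure_toMeasurable]
      _ ≤ _ := by
          rw [← nsmul_eq_mul]
          exact add_le_add le_rfl (Finset.sum_le_card_nsmul _ _ _ hfail)
  rw [← ENNReal.ofReal_natCast, ← ENNReal.ofReal_natCast, ← ENNReal.ofReal_mul (by positivity),
    ← ENNReal.ofReal_add (by positivity) (by positivity),
    ENNReal.ofReal_le_ofReal_iff (by positivity)] at hint
  linarith

end RandAlgorithm

/-! ### The planar cluster network -/

section planar

theorem planarNetwork_dist {V : Type*} (M : RadioParams) {pos : V → EuclideanSpace ℝ (Fin 2)}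
    (hpos : Function.Injective pos) (i j : V) :
    (planarNetwork M pos hpos).dist M i j = Dist.dist (pos i) (pos j) := by
  by_cases h : i = j
  · rw [h, Network.dist_self, dist_self]
  · rw [Network.dist, if_neg h, planarNetwork, ← Real.rpow_mul dist_nonneg,
      mul_one_div_cancel M.ζ_pos.ne', Real.rpow_one]

namespace ClusterNetwork

variable (M : RadioParams) (n Δ : ℕ)

/-- The scale of the cluster. -/
noncomputable def scale : ℝ := min M.rmin ((1 - M.ε) * M.R) / 4

variable {n}

/-- The nodes below `Δ` form a cluster at slot `0`, and the other ones have slots of their own. -/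
def slot (i : Fin n) : ℕ := if (i : ℕ) < Δ then 0 else i

/-- Separates the remaining cluster nodes on the x-axis, within the scale of the cluster; nodes 0
and 1 stay at abscissa 0 and are told apart by their heights. -/
noncomputable def offset (i : Fin n) : ℝ :=
  if 2 ≤ (i : ℕ) ∧ (i : ℕ) < Δ then scale M * (i / n) else 0

noncomputable def height (i : Fin n) : ℝ :=
  if (i : ℕ) = 0 then scale M else if (i : ℕ) = 1 then -scale M else 0

/-- A cluster of nodes, two of which are mirror images, and isolated nodes on the `x`-axis. -/
noncomputable def position (i : Fin n) : EuclideanSpace ℝ (Fin 2) :=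
  !₂[2 * M.R * slot Δ i + offset M Δ i, height M i]

variable {M Δ} {i j : Fin n}

theorem scale_pos : 0 < scale M := by
  have := M.rmin_pos
  have := mul_pos (show 0 < 1 - M.ε by linarith [M.ε_lt_one]) M.R_pos
  have := lt_min M.rmin_pos this
  rw [scale]
  positivity

theorem four_mul_scale_le : 4 * scale M ≤ M.rmin := by
  rw [scale]
  linarith [min_le_left M.rmin ((1 - M.ε) * M.R)]

theorem four_mul_scale_le' : 4 * scale M ≤ (1 - M.ε) * M.R := by
  rw [scale]
  linarith [min_le_right M.rmin ((1 - M.ε) * M.R)]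

theorem offset_nonneg : 0 ≤ offset M Δ i := by
  have := scale_pos (M := M)
  rw [offset]
  split_ifs <;> positivity

theorem offset_le : offset M Δ i ≤ scale M := by
  have := scale_pos (M := M)
  rw [offset]
  split_ifs
  · refine mul_le_of_le_one_right this.le (div_le_one_of_le₀ ?_ (by positivity))
    exact_mod_cast i.2.le
  · exact this.le

theorem abs_height_le : |height M i| ≤ scale M := by
  have := scale_pos (M := M)
  rw [height]
  split_ifs
  · rw [abs_of_pos this]
  · rw [abs_neg, abs_of_pos this]
  · rw [abs_zero]; exact this.le

theorem dist_position : Dist.dist (position M Δ i) (position M Δ j) =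
    √((2 * M.R * slot Δ i + offset M Δ i - (2 * M.R * slot Δ j + offset M Δ j)) ^ 2 +
      (height M i - height M j) ^ 2) := by
  rw [EuclideanSpace.dist_eq, Fin.sum_univ_two, Real.dist_eq, Real.dist_eq, sq_abs, sq_abs]
  simp [position]

theorem dist_lt_of_slot_eq (h : slot Δ i = slot Δ j) :
    Dist.dist (position M Δ i) (position M Δ j) < 4 * scale M := by
  have hs := scale_pos (M := M)
  rw [dist_position, Real.sqrt_lt' (by linarith), h]
  have h1 := offset_nonneg (M := M) (Δ := Δ) (i := i)
  have h2 := offset_nonneg (M := M) (Δ := Δ) (i := j)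
  have h3 := offset_le (M := M) (Δ := Δ) (i := i)
  have h4 := offset_le (M := M) (Δ := Δ) (i := j)
  have h5 := abs_le.mp (abs_height_le (M := M) (i := i))
  have h6 := abs_le.mp (abs_height_le (M := M) (i := j))
  have e1 : (2 * M.R * slot Δ j + offset M Δ i - (2 * M.R * slot Δ j + offset M Δ j)) ^ 2 ≤
      scale M ^ 2 := sq_le_sq' (by linarith) (by linarith)
  have e2 : (height M i - height M j) ^ 2 ≤ (2 * scale M) ^ 2 :=
    sq_le_sq' (by linarith) (by linarith)
  nlinarith

/-- Slots are spaced 2R apart and the offsets are at most R, so each step between slots leaves at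
least R. -/
theorem mul_abs_slot_sub_le :
    M.R * |(slot Δ i : ℝ) - slot Δ j| ≤ Dist.dist (position M Δ i) (position M Δ j) := by
  have hR := M.R_pos
  by_cases hs : slot Δ i = slot Δ j
  · rw [hs, sub_self, abs_zero, mul_zero]; exact dist_nonneg
  rw [dist_position]
  refine le_trans ?_ (Real.abs_le_sqrt (le_add_of_nonneg_right (sq_nonneg _)))
  have h1 := offset_nonneg (M := M) (Δ := Δ) (i := i)
  have h2 := offset_nonneg (M := M) (Δ := Δ) (i := j)
  have h3 := offset_le (M := M) (Δ := Δ) (i := i)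
  have h4 := offset_le (M := M) (Δ := Δ) (i := j)
  have h5 : scale M ≤ M.R := by
    have := four_mul_scale_le (M := M)
    have := M.rmin_le
    have := scale_pos (M := M)
    linarith
  rcases lt_or_gt_of_ne hs with hlt | hlt
  · have h6 : (slot Δ i : ℝ) + 1 ≤ slot Δ j := by exact_mod_cast hlt
    have h7 := mul_le_mul_of_nonneg_left h6 hR.le
    rw [abs_of_nonpos (by linarith)]
    exact le_trans (by linarith) (neg_le_abs _)
  · have h6 : (slot Δ j : ℝ) + 1 ≤ slot Δ i := by exact_mod_cast hlt
    have h7 := mul_le_mul_of_nonneg_left h6 hR.le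
    rw [abs_of_nonneg (by linarith)]
    exact le_trans (by linarith) (le_abs_self _)

theorem slot_eq_iff (hΔ : 2 ≤ Δ) :
    slot Δ i = slot Δ j ↔ i = j ∨ ((i : ℕ) < Δ ∧ (j : ℕ) < Δ) := by
  rw [slot, slot, Fin.ext_iff]
  split_ifs <;> omega

theorem position_injective (hΔ : 2 ≤ Δ) : Function.Injective (position (n := n) M Δ) := by
  intro i j hij
  have hs := scale_pos (M := M)
  have hR := M.R_pos
  have h0 := mul_abs_slot_sub_le (M := M) (Δ := Δ) (i := i) (j := j)
  rw [hij, dist_self] at h0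
  have h1 : (slot Δ i : ℝ) = slot Δ j := by
    have : |(slot Δ i : ℝ) - slot Δ j| ≤ 0 := by
      by_contra hc
      exact absurd h0 (not_le.mpr (mul_pos hR (not_le.mp hc)))
    exact sub_eq_zero.mp (abs_nonpos_iff.mp this)
  have hx : 2 * M.R * slot Δ i + offset M Δ i = 2 * M.R * slot Δ j + offset M Δ j := by
    simpa [position] using congrArg (fun p : EuclideanSpace ℝ (Fin 2) => p 0) hij
  have hy : height M i = height M j := by
    simpa [position] using congrArg (fun p : EuclideanSpace ℝ (Fin 2) => p 1) hij
  rcases (slot_eq_iff hΔ).mp (by exact_mod_cast h1) with h | ⟨hi, hj⟩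
  · exact h
  rw [h1, add_right_inj, offset, offset] at hx
  rw [height, height] at hy
  have hn : (0 : ℝ) < n := by exact_mod_cast i.pos
  rw [Fin.ext_iff]
  by_cases hi2 : 2 ≤ (i : ℕ) <;> by_cases hj2 : 2 ≤ (j : ℕ)
  · rw [if_pos ⟨hi2, hi⟩, if_pos ⟨hj2, hj⟩] at hx
    have := (div_left_inj' hn.ne').mp (mul_left_cancel₀ hs.ne' hx)
    exact_mod_cast this
  · exfalso
    rw [if_neg (by omega), if_neg (by omega)] at hy
    split_ifs at hy <;> first | linarith | omega
  · exfalso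
    rw [if_neg (by omega : ¬ (j : ℕ) = 0), if_neg (by omega : ¬ (j : ℕ) = 1)] at hy
    split_ifs at hy <;> first | linarith | omega
  · split_ifs at hy <;> first | linarith | omega

/-- Nodes in the same slot are closer than rmin, so a packing uses each slot at most once. A ball of
radius q rmin meets at most 2⌊q⌋ + 1 ≤ 3q slots. -/
theorem admissible (hΔ : 2 ≤ Δ) (hlam : 1 ≤ M.lam) (hC : 9 ≤ M.Cind) :
    (planarNetwork M _ (position_injective (M := M) (n := n) hΔ)).Admissible M := by
  classical
  constructor
  · intro u v w
    simp only [planarNetwork_dist]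
    exact dist_triangle _ _ _
  · intro u q hq S hS
    have hr := M.rmin_pos
    have hrR : M.rmin ≤ M.R := by linarith [M.rmin_le]
    have hself : ∀ s ∈ S, s ∈ (planarNetwork M _ (position_injective (M := M) hΔ)).ball M s
        M.rmin := fun s _ => by
      rw [Network.mem_ball, Network.dist_self]; exact ⟨hr, hr⟩
    have hinj : Set.InjOn (fun s => (slot Δ s : ℤ)) (S : Set (Fin n)) := by
      intro s hs s' hs' hss
      by_contra hne
      have hd := dist_lt_of_slot_eq (M := M) (Δ := Δ) (i := s) (j := s') (Nat.cast_injective hss)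
      have h4 := four_mul_scale_le (M := M)
      refine Finset.disjoint_left.mp (hS.2 s hs s' hs' hne) ?_ (hself s' hs')
      rw [Network.mem_ball, planarNetwork_dist, planarNetwork_dist, dist_comm (position M Δ s')]
      exact ⟨by linarith, by linarith⟩
    have hsub : S.image (fun s => (slot Δ s : ℤ)) ⊆
        Finset.Icc ((slot Δ u : ℤ) - ⌊q⌋₊) ((slot Δ u : ℤ) + ⌊q⌋₊) := by
      intro k hk
      obtain ⟨s, hs, rfl⟩ := Finset.mem_image.mp hk
      have h1 := Network.mem_inBall.mp (hS.1 s hs (hself s hs))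
      rw [planarNetwork_dist] at h1
      have h2 := (mul_abs_slot_sub_le (M := M) (Δ := Δ) (i := s) (j := u)).trans_lt h1
      have h3 : |(slot Δ s : ℝ) - slot Δ u| < q := by
        refine lt_of_mul_lt_mul_left (a := M.rmin) ?_ hr.le
        rw [mul_comm M.rmin q]
        exact lt_of_le_of_lt (mul_le_mul_of_nonneg_right hrR (abs_nonneg _)) h2
      have h4 : ((slot Δ s : ℤ) - slot Δ u).natAbs ≤ ⌊q⌋₊ := by
        refine Nat.le_floor ?_
        rw [Nat.cast_natAbs]
        push_cast
        exact h3.le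
      rw [Finset.mem_Icc]
      omega
    have hcard := Finset.card_le_card hsub
    rw [Finset.card_image_of_injOn hinj, Int.card_Icc] at hcard
    have h5 : (S.card : ℝ) ≤ 2 * ⌊q⌋₊ + 1 := by
      have : S.card ≤ 2 * ⌊q⌋₊ + 1 := by omega
      exact_mod_cast this
    have h6 := Nat.floor_le (by linarith : 0 ≤ q)
    have h7 : q ≤ q ^ M.lam := by
      simpa using Real.rpow_le_rpow_of_exponent_le hq hlam
    nlinarith

theorem mem_neighbors_iff (hΔ : 2 ≤ Δ) :
    j ∈ (planarNetwork M _ (position_injective (M := M) hΔ)).neighbors M i ↔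
      slot Δ i = slot Δ j := by
  have hR := M.R_pos
  rw [Network.mem_neighbors, planarNetwork_dist]
  refine ⟨fun h => ?_, fun h => ((dist_lt_of_slot_eq h).trans_le four_mul_scale_le').le⟩
  by_contra hne
  have h1 := (mul_abs_slot_sub_le (M := M) (Δ := Δ) (i := i) (j := j)).trans h
  have h2 : (1 : ℝ) ≤ |(slot Δ i : ℝ) - slot Δ j| := by
    have : (1 : ℤ) ≤ |(slot Δ i : ℤ) - slot Δ j| := Int.one_le_abs (by omega)
    exact_mod_cast this
  nlinarith [M.ε_pos]

theorem maxDegree_eq (hΔ : 2 ≤ Δ) (hn : Δ ≤ n) :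
    (planarNetwork M _ (position_injective (M := M) (n := n) hΔ)).maxDegree M = Δ := by
  classical
  have hcard : (Finset.univ.filter fun j : Fin n => (j : ℕ) < Δ).card = Δ := by
    rw [Fin.card_filter_val_lt, min_eq_right hn]
  refine le_antisymm (Finset.sup_le fun i _ => ?_) ?_
  · by_cases hi : (i : ℕ) < Δ
    · refine le_trans (Finset.card_le_card fun j hj => ?_) hcard.le
      rw [mem_neighbors_iff hΔ, slot_eq_iff hΔ] at hj
      rw [Finset.mem_filter]
      rcases hj with rfl | hj
      exacts [⟨Finset.mem_univ _, hi⟩, ⟨Finset.mem_univ _, hj.2⟩]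
    · refine le_trans (Finset.card_le_card (t := {i}) fun j hj => ?_) (by simp; omega)
      rw [mem_neighbors_iff hΔ, slot_eq_iff hΔ] at hj
      rw [Finset.mem_singleton]
      rcases hj with rfl | hj
      exacts [rfl, absurd hj.1 hi]
  · refine le_trans ?_ (Finset.le_sup (Finset.mem_univ (⟨0, by omega⟩ : Fin n)))
    conv_lhs => rw [← hcard]
    refine Finset.card_le_card fun j hj => ?_
    rw [mem_neighbors_iff hΔ, slot_eq_iff hΔ]
    exact Or.inr ⟨by simp; omega, (Finset.mem_filter.mp hj).2⟩

/-- Reflection in the x-axis exchanges nodes 0 and 1 and fixes all others. -/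
theorem isTwins (hΔ : 2 ≤ Δ) (hn : 2 ≤ n) :
    (planarNetwork M _ (position_injective (M := M) hΔ)).IsTwins M
      (⟨0, by omega⟩ : Fin n) ⟨1, by omega⟩ := by
  set u : Fin n := ⟨0, by omega⟩ with hu
  set u' : Fin n := ⟨1, by omega⟩ with hu'
  have hne : u ≠ u' := by simp [hu, hu']
  have key : ∀ x : Fin n, slot Δ (Equiv.swap u u' x) = slot Δ x ∧
      offset M Δ (Equiv.swap u u' x) = offset M Δ x ∧
      height M (Equiv.swap u u' x) = -height M x := by
    intro x
    by_cases hx : x = u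
    · rw [hx, Equiv.swap_apply_left]
      have h0 : 0 < Δ := by omega
      have h1 : 1 < Δ := by omega
      simp [slot, offset, height, hu, hu', h0, h1]
    by_cases hx' : x = u'
    · rw [hx', Equiv.swap_apply_right]
      have h0 : 0 < Δ := by omega
      have h1 : 1 < Δ := by omega
      simp [slot, offset, height, hu, hu', h0, h1]
    rw [Equiv.swap_apply_of_ne_of_ne hx hx']
    refine ⟨rfl, rfl, ?_⟩
    rw [hu, Fin.ext_iff] at hx
    rw [hu', Fin.ext_iff] at hx'
    rw [height, if_neg hx, if_neg hx', neg_zero]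
  refine ⟨hne, fun x y hxy => ?_, ?_, ?_⟩
  · have hd : Dist.dist (position M Δ (Equiv.swap u u' x)) (position M Δ (Equiv.swap u u' y)) =
        Dist.dist (position M Δ x) (position M Δ y) := by
      rw [dist_position, dist_position, (key x).1, (key y).1, (key x).2.1, (key y).2.1,
        (key x).2.2, (key y).2.2]
      congr 2
      ring
    change M.P / _ ^ M.ζ = M.P / _ ^ M.ζ
    rw [hd]
  · rw [mem_neighbors_iff hΔ, slot_eq_iff hΔ]
    exact Or.inr ⟨by simp [hu]; omega, by simp [hu']; omega⟩
  · rw [mem_neighbors_iff hΔ, slot_eq_iff hΔ]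
    exact Or.inr ⟨by simp [hu']; omega, by simp [hu]; omega⟩

end ClusterNetwork

open ClusterNetwork in
/-- No algorithm is faster than LocalBcast by more than a constant factor. -/
theorem exists_planarNetwork_lower_bound (κ : ℝ) (hκ : 0 < κ) : ∃ c : ℝ, 0 < c ∧
    ∀ (M : RadioParams) (β noise : ℝ), 9 ≤ M.Cind → 1 ≤ β → 0 < noise →
      ∀ n Δ : ℕ, 2 ≤ Δ → Δ ≤ n →
        ∃ (pos : Fin n → EuclideanSpace ℝ (Fin 2)) (hpos : Function.Injective pos),
          (planarNetwork M pos hpos).Admissible M ∧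
          (planarNetwork M pos hpos).maxDegree M = Δ ∧
          ∀ (S : Type) [MeasurableSpace S] (A : RandAlgorithm S) (T : ℕ),
            (∀ v : Fin n, Measure.pi (fun _ : Fin n => A.init)
                {c₀ | ∀ t < T, ¬ A.MassDelivers M β noise (planarNetwork M pos hpos)
                  (A.config M β noise (planarNetwork M pos hpos) c₀ t) v}
              ≤ ENNReal.ofReal ((n : ℝ) ^ (-κ))) →
            c * (Δ + Real.log n) ≤ T := by
  have hlog2 : 0 < Real.log 2 := Real.log_pos (by norm_num)
  have h2κ : (2 : ℝ) ^ (-κ) < 1 := Real.rpow_lt_one_of_one_lt_of_neg one_lt_two (by linarith)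
  -- The bounds T ≥ Δ (1 - n^(-κ)) and T ≥ κ log n / log 2 each provide one half of T.
  refine ⟨min ((1 - 2 ^ (-κ)) / 2) (κ / (2 * Real.log 2)), lt_min (by linarith) (by positivity),
    fun M β noise hC hβ hN n Δ hΔ hn => ⟨position M Δ, position_injective hΔ,
      admissible hΔ M.one_le_lam hC, maxDegree_eq hΔ hn, fun S _ A T hT => ?_⟩⟩
  have hn2 : (2 : ℝ) ≤ n := by exact_mod_cast hΔ.trans hn
  have hp : (n : ℝ) ^ (-κ) ≤ 2 ^ (-κ) :=
    Real.rpow_le_rpow_of_nonpos (by norm_num) hn2 (by linarith)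
  have hp0 : 0 < (n : ℝ) ^ (-κ) := Real.rpow_pos_of_pos (by linarith) _
  have h1 := RandAlgorithm.card_mul_le_of_neighbors (A := A) (M := M) (β := β) (noise := noise)
    (K := Finset.univ.filter fun j : Fin n => (j : ℕ) < Δ) (fun x hx y hy => by
      rw [mem_neighbors_iff hΔ, slot_eq_iff hΔ]
      exact Or.inr ⟨(Finset.mem_filter.mp hx).2, (Finset.mem_filter.mp hy).2⟩) hp0.le
    fun v _ => hT v
  rw [Fin.card_filter_val_lt, min_eq_right hn] at h1
  have h2 := (RandAlgorithm.inv_two_pow_le_measure_not_massDelivers (A := A)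
    (isTwins (M := M) hΔ (hΔ.trans hn)) hβ hN T).trans (hT _)
  have h3 : ((2 : ℝ) ^ T)⁻¹ ≤ (n : ℝ) ^ (-κ) := by
    rw [← ENNReal.ofReal_le_ofReal_iff hp0.le, ENNReal.ofReal_inv_of_pos (by positivity),
      ENNReal.ofReal_pow (by norm_num), ENNReal.ofReal_ofNat]
    exact h2
  have h4 := Real.log_le_log (by positivity) h3
  rw [Real.log_inv, Real.log_pow, Real.log_rpow (by linarith)] at h4
  have hlogn : 0 ≤ Real.log n := Real.log_nonneg (by linarith)
  have hΔ0 : (0 : ℝ) ≤ Δ := by positivity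
  have a1 : min ((1 - 2 ^ (-κ)) / 2) (κ / (2 * Real.log 2)) * Δ ≤ T / 2 := by
    refine (mul_le_mul_of_nonneg_right (min_le_left _ _) hΔ0).trans ?_
    nlinarith
  have a2 : min ((1 - 2 ^ (-κ)) / 2) (κ / (2 * Real.log 2)) * Real.log n ≤ T / 2 := by
    refine (mul_le_mul_of_nonneg_right (min_le_right _ _) hlogn).trans ?_
    rw [div_mul_eq_mul_div, div_le_div_iff₀ (by positivity) (by norm_num)]
    nlinarith
  rw [mul_add]
  linarith

end planar

theorem mainTheorem3 :
    -- LocalBcast completes in `O(|D_v^ρ| + log n) = O(Δ + log n)` rounds, w.h.p.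
    (∀ (M : RadioParams) (Q : SenseParams) (ρc Ic : ℝ), 0 ≤ ρc → 0 < Ic →
      ∃ ρ₀ : ℝ, 1 < ρ₀ ∧ ∀ ρ : ℝ, ρ₀ ≤ ρ → ∀ κ : ℝ, 0 < κ → ∃ C C' : ℝ, 0 < C ∧ 0 < C' ∧
        ∀ (V : Type) [Fintype V] (G : Network V) (n : ℕ),
          G.Admissible M → Fintype.card V ≤ n →
          (∀ (Ω : Type) [mΩ : MeasurableSpace Ω] (μ : Measure Ω) [IsProbabilityMeasure μ]
            (ℱ : Filtration ℕ mΩ) (E : Trace V Ω),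
            IsLocalBcast μ ℱ n E → E.SuccClear G M ρc Ic → E.AckSpec G M Q.Iack →
            CDSpec M Q ρ G μ ℱ n E →
            ∀ v : V, μ {ω | E.wake v ω ≠ ⊤ ∧ ¬ E.CompletesWithin G M v
                (C * ((G.inBall M v (ρ * M.R)).card + Real.log n)) ω}
              ≤ ENNReal.ofReal ((n : ℝ) ^ (-κ))) ∧
          (2 * M.rmin ≤ (1 - M.ε) * M.R → ∀ v : V,
            C * ((G.inBall M v (ρ * M.R)).card + Real.log n)
              ≤ C' * (G.maxDegree M + Real.log n))) ∧
    -- the same in the SINR model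
    (∀ (M : RadioParams) (Q : SenseParams) (β noise : ℝ), 1 ≤ β → 0 < noise →
      M.R = (M.P / (β * noise)) ^ (1 / M.ζ) →
      ∃ ρ₀ : ℝ, 1 < ρ₀ ∧ ∀ ρ : ℝ, ρ₀ ≤ ρ → ∀ κ : ℝ, 0 < κ → ∃ C C' : ℝ, 0 < C ∧ 0 < C' ∧
        ∀ (V : Type) [Fintype V] (G : Network V) (n : ℕ),
          G.Admissible M → (∀ u v, G.dist M u v = G.dist M v u) → Fintype.card V ≤ n →
          (∀ (Ω : Type) [mΩ : MeasurableSpace Ω] (μ : Measure Ω) [IsProbabilityMeasure μ]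
            (ℱ : Filtration ℕ mΩ) (E : Trace V Ω),
            IsLocalBcast μ ℱ n E → E.SINRReception G M β noise → E.AckSpec G M Q.Iack →
            CDSpec M Q ρ G μ ℱ n E →
            ∀ v : V, μ {ω | E.wake v ω ≠ ⊤ ∧ ¬ E.CompletesWithin G M v
                (C * ((G.inBall M v (ρ * M.R)).card + Real.log n)) ω}
              ≤ ENNReal.ofReal ((n : ℝ) ^ (-κ))) ∧
          (2 * M.rmin ≤ (1 - M.ε) * M.R → ∀ v : V,
            C * ((G.inBall M v (ρ * M.R)).card + Real.log n)
              ≤ C' * (G.maxDegree M + Real.log n))) ∧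
    -- no algorithm is better by more than a constant factor, even in the SINR model in the plane,
    -- with synchronous rounds and spontaneous start
    (∀ κ : ℝ, 0 < κ → ∃ c : ℝ, 0 < c ∧
      ∀ (M : RadioParams) (β noise : ℝ), 2 ≤ M.lam → 9 ≤ M.Cind → 1 ≤ β → 0 < noise →
        M.R = (M.P / (β * noise)) ^ (1 / M.ζ) →
        ∀ n Δ : ℕ, 2 ≤ Δ → Δ ≤ n →
          ∃ (pos : Fin n → EuclideanSpace ℝ (Fin 2)) (hpos : Function.Injective pos),
            (planarNetwork M pos hpos).Admissible M ∧
            (planarNetwork M pos hpos).maxDegree M = Δ ∧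
            ∀ (S : Type) [MeasurableSpace S] (A : RandAlgorithm S) (T : ℕ),
              (∀ v : Fin n, Measure.pi (fun _ : Fin n => A.init)
                  {c₀ | ∀ t < T, ¬ A.MassDelivers M β noise (planarNetwork M pos hpos)
                    (A.config M β noise (planarNetwork M pos hpos) c₀ t) v}
                ≤ ENNReal.ofReal ((n : ℝ) ^ (-κ))) →
              c * (Δ + Real.log n) ≤ T) := by
  refine ⟨fun M Q ρc Ic _ hIc => localBcast_completes M Q ρc Ic hIc,
    fun M Q β noise hβ hN hR => localBcast_completes_sinr M Q β noise hβ hN hR, fun κ hκ => ?_⟩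
  obtain ⟨c, hc, h⟩ := exists_planarNetwork_lower_bound κ hκ
  exact ⟨c, hc, fun M β noise _ hC hβ hN _ => h M β noise hC hβ hN⟩
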